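/- \textbf{Model.} In the (deterministic) MPC model there are $\mathcal{M}$ machines, each with a local memory of $S$ words; the total space is $\mathcal{M}\cdot S$. The machines work in synchronous rounds. In each round every machine performs an arbitrary local computation on the content of its memory, decides which words to keep, and sends messages to other machines; the words that a machine sends in a round number at most $S$ in total, and the words that it keeps together with those that it receives have to fit into its memory. At the beginning, the edges of the input graph are distributed over the machines, each edge being stored (as the pair of its endpoints) on exactly one machine. \textbf{Theorem.} Let $k \ge 2$ be a constant integer and let $\delta > 0$. There is a deterministic MPC algorithm with words of $O(\log n)$ bits that, for every graph $G$ on the vertex set $\{0,\dots,n-1\}$ with $n \ge 3$, with $m \ge 1$ edges and with arboricity at most $\alpha$ (the arboricity is the least number of forests whose union is $G$), given $n$, $m$ and $\alpha$, and for every initial distribution of the edges of $G$ that fits into the memories of the machines (and such a distribution exists), computes the exact number of $k$-cliques of $G$, using - $O_\delta(\log\log n)$ rounds, - $O(n^{\delta})$ words of space per machine, and - $O(m\alpha^{k-2})$ words of total space. The constants in the bounds on the space per machine, the total space and the word length depend only on $k$; the constant in the bound on the number of rounds depends only on $k$ and $\delta$. -/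

import Mathlib

/-- The arboricity of a graph: the least number of forests (on the same vertex set) whose
union is the graph. -/
noncomputable def SimpleGraph.arboricity {V : Type*} (G : SimpleGraph V) : ℕ :=
  sInf {a : ℕ | ∃ F : Fin a → SimpleGraph V, (∀ i, (F i).IsAcyclic) ∧ ⨆ i, F i = G}

/-- Every finite graph is a union of finitely many forests, so the infimum that defines the
arboricity is attained. -/
theorem SimpleGraph.exists_forests_arboricity {V : Type*} [Finite V] (G : SimpleGraph V) :
    ∃ F : Fin G.arboricity → SimpleGraph V, (∀ i, (F i).IsAcyclic) ∧ ⨆ i, F i = G := by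
  refine Nat.sInf_mem (s := {a : ℕ | ∃ F : Fin a → SimpleGraph V,
    (∀ i, (F i).IsAcyclic) ∧ ⨆ i, F i = G}) ?_
  have hfin : Finite G.edgeSet := inferInstance
  obtain ⟨a, ⟨f⟩⟩ := Finite.exists_equiv_fin G.edgeSet
  refine ⟨a, fun i => SimpleGraph.fromEdgeSet {(f.symm i : Sym2 V)}, fun i => ?_, ?_⟩
  · intro v c hc
    have h3 := hc.three_le_length
    have hnd := hc.isTrail.edges_nodup
    have hall : ∀ x ∈ c.edges, x = (f.symm i : Sym2 V) := fun x hx => by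
      have := c.edges_subset_edgeSet hx
      rw [SimpleGraph.edgeSet_fromEdgeSet] at this
      exact Set.mem_singleton_iff.mp this.1
    rw [List.eq_replicate_of_mem hall, List.nodup_replicate, c.length_edges] at hnd
    omega
  · ext u v
    simp only [SimpleGraph.iSup_adj, SimpleGraph.fromEdgeSet_adj, Set.mem_singleton_iff]
    constructor
    · rintro ⟨i, h, -⟩
      rw [← SimpleGraph.mem_edgeSet, h]
      exact (f.symm i).2
    · intro h
      exact ⟨f ⟨s(u, v), h⟩, by simp, h.ne⟩

/-- A deterministic algorithm in the Massively Parallel Computation model: a number of machines,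
each with a local memory of `space` words of `wordBits` bits, that work in `rounds` synchronous
rounds. In round `t`, machine `i` turns the content of its memory, by an arbitrary local
computation, into the words that it keeps and, for every machine `j`, the message to `j`.
The result is read off one designated machine. -/
structure MPCAlgorithm where
  machines : ℕ
  space : ℕ
  wordBits : ℕ
  rounds : ℕ
  step : ℕ → Fin machines → List ℕ → List ℕ × (Fin machines → List ℕ)
  outputMachine : Fin machines

namespace MPCAlgorithm

/-- The content of the memory of each machine after `t` rounds, started from `input`: the words
that the machine kept, followed by the messages that it received, in the order of the senders. -/
def memory (A : MPCAlgorithm) (input : Fin A.machines → List ℕ) :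
    ℕ → Fin A.machines → List ℕ
  | 0, i => input i
  | t + 1, i => (A.step t i (A.memory input t i)).1 ++
      (List.ofFn fun j => (A.step t j (A.memory input t j)).2 i).flatten

/-- The number of words that machine `i` sends in round `t`. -/
def sent (A : MPCAlgorithm) (input : Fin A.machines → List ℕ) (t : ℕ) (i : Fin A.machines) : ℕ :=
  ∑ j, ((A.step t i (A.memory input t i)).2 j).length

/-- The run on `input` respects the limits of the model: at all times each machine holds at most
`space` words (in particular what it receives in a round fits into its memory), every
word has at most `wordBits` bits, and no machine sends more than `space` words in a round. -/
def RespectsLimits (A : MPCAlgorithm) (input : Fin A.machines → List ℕ) : Prop :=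
  (∀ t ≤ A.rounds, ∀ i, (A.memory input t i).length ≤ A.space ∧
    ∀ w ∈ A.memory input t i, w < 2 ^ A.wordBits) ∧
  ∀ t < A.rounds, ∀ i, A.sent input t i ≤ A.space

/-- The result of the run on `input`: the first word in the memory of the output machine. -/
def result (A : MPCAlgorithm) (input : Fin A.machines → List ℕ) : Option ℕ :=
  (A.memory input A.rounds A.outputMachine).head?

/-- An edge list stored in memory, with two words per edge. -/
def edgeWords {n : ℕ} (l : List (Fin n × Fin n)) : List ℕ :=
  l.flatMap fun e => [(e.1 : ℕ), (e.2 : ℕ)]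

/-- `I` places every edge of `G` (as an ordered pair of its ends, in one of the two orders)
exactly once, on one of the machines, in such a way that no memory overflows. -/
def IsDistribution (A : MPCAlgorithm) {n : ℕ} (G : SimpleGraph (Fin n)) [DecidableRel G.Adj]
    (I : Fin A.machines → List (Fin n × Fin n)) : Prop :=
  (∑ i, (I i : Multiset (Fin n × Fin n)).map fun e => s(e.1, e.2)) = G.edgeFinset.val ∧
  ∀ i, 2 * (I i).length ≤ A.space

/-- `A` counts the `k`-cliques of `G`: the edges of `G` fit into the machines and, however they
are distributed, the run respects the limits of the model and ends with the number of
`k`-cliques of `G`. -/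
def CountsCliques (A : MPCAlgorithm) {n : ℕ} (G : SimpleGraph (Fin n)) [DecidableRel G.Adj]
    (k : ℕ) : Prop :=
  (∃ I, A.IsDistribution G I) ∧
  ∀ I, A.IsDistribution G I →
    A.RespectsLimits (fun i => edgeWords (I i)) ∧
    A.result (fun i => edgeWords (I i)) = some (G.cliqueFinset k).card

end MPCAlgorithm

/-! Counting. Orient every edge upwards in some linear order of the vertices. A `k`-clique is then
exactly one chain, and for `k = j + 2` a chain is an arc `(u, v)` together with `j` further
out-neighbors of `u` such that `v` and these neighbors, in their order, are pairwise joined by arcs.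
So every arc spawns `outDeg u ^ j` candidates, one per virtual processor, and each candidate is
tested by a constant number of lookups. The space needed is the sum of `outDeg u ^ (j + 1)` over all
vertices, and the orientation has to make this `O(m α ^ j)`.

Orientation. A vertex survives phase `t` of peeling if it has more than `thr t` neighbors that
reached the phase; vertices are ordered by the phase at which they stop. Arboricity at most `α` lets
a vertex set `S` span at most `2 β |S|` arcs, where `β = min α n`
(`SimpleGraph.sum_card_adj_le_min`), so phase `t` shrinks the number `E_t` of alive arcs by a factor
of `thr t / (2 β)` (`aliveArcs_succ_mul_le`). The thresholds are `2 ^ a_t * β` with `a_(t+1)` about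
`(1 + 1/J) a_t` and `J = j + 1`. Large thresholds are affordable because arcs become rare at the
matching pace: `E_t * 2 ^ (J a_t + t)` never increases (`aliveArcs_mul_two_pow_le`). Hence the sum
of `E_t * (thr t) ^ j`, which bounds the number of candidates (`sum_outDeg_pow_le`), is dominated by
a geometric series of size `O(m β ^ j)` (`sum_aliveArcs_mul_le`). Since `a_t` grows exponentially,
no arc is left after `O(log log n)` phases (`aliveArcs_peelPhases`).

Implementation. Everything reduces to one primitive: each processor contributes a value at a key and
asks for the sum of the values in a range of keys (`rangeProg_exec`). It is implemented by radix
sort and prefix sums in a base `B` of order `n ^ (δ / 2)`, with order `B ^ 2` words per machine, so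
that a machine can exchange vectors of `B` counters with `B` other machines in one round. The
numbers of machines and keys are bounded by constant powers of `B`, so a range sum takes `O_δ(1)`
rounds. `Computes` composes such steps; a phase of peeling takes two of them, the distribution of
copies (`Computes.expand`) three, and the rest a number that depends only on `k`.

If `2 m ≤ n ^ δ`, a single machine with `2 m` words counts locally. -/

/-! ### Message passing between addressed memory cells -/

/-- The content of an addressed memory cell. -/
abbrev Cell := ℕ × ℕ × ℕ

/-- The contents of the slots of all machines. -/
abbrev Conf (M : ℕ) (Slot : Type) := Fin M → Slot → Option Cell

/-- A round in which every slot of every machine sends at most one addressed message. -/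
abbrev Push (M : ℕ) (Slot : Type) :=
  Fin M → (Slot → Option Cell) → Slot → Option (Fin M × Slot × Cell)

section Push

variable {M : ℕ} {Slot : Type}

/-- The round `w` leads from `c` to `c'`, and no slot receives two messages. -/
structure Push.Sends (w : Push M Slot) (c c' : Conf M Slot) : Prop where
  delivered : ∀ j s v, c' j s = some v ↔ ∃ i t, w i (c i) t = some (j, s, v)
  inj : ∀ i t i' t' j s v v', w i (c i) t = some (j, s, v) → w i' (c i') t' = some (j, s, v') →
    i = i' ∧ t = t'

/-- If the address of a message determines its sender, collisions are impossible. Naming this sender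
by `back` leaves only pointwise computations. -/
theorem Push.Sends.of_back {w : Push M Slot} {c c' : Conf M Slot}
    (back : Fin M → Slot → Fin M × Slot)
    (h1 : ∀ i t j s v, w i (c i) t = some (j, s, v) → back j s = (i, t) ∧ c' j s = some v)
    (h2 : ∀ j s v, c' j s = some v →
      w (back j s).1 (c (back j s).1) (back j s).2 = some (j, s, v)) : w.Sends c c' where
  delivered j s v := ⟨fun h => ⟨_, _, h2 j s v h⟩, fun ⟨i, t, h⟩ => (h1 i t j s v h).2⟩
  inj i t i' t' j s v v' h h' := by
    have := (h1 _ _ _ _ _ h).1.symm.trans (h1 _ _ _ _ _ h').1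
    simpa using this

/-- All numbers in the cells are less than `W`. -/
def Conf.Bounded (W : ℕ) (c : Conf M Slot) : Prop :=
  ∀ i s v, c i s = some v → v.1 < W ∧ v.2.1 < W ∧ v.2.2 < W

/-- The rounds of `prog` lead from `c` to `c'`, with all numbers less than `W` on the way. -/
def Exec (W : ℕ) : List (Push M Slot) → Conf M Slot → Conf M Slot → Prop
  | [], c, c' => c = c'
  | w :: ws, c, c' => ∃ c₁, w.Sends c c₁ ∧ c₁.Bounded W ∧ Exec W ws c₁ c'

theorem Exec.append {W : ℕ} {p q : List (Push M Slot)} {c₀ c₁ c₂ : Conf M Slot}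
    (hp : Exec W p c₀ c₁) (hq : Exec W q c₁ c₂) : Exec W (p ++ q) c₀ c₂ := by
  induction p generalizing c₀ with
  | nil => cases hp; exact hq
  | cons w ws ih =>
    obtain ⟨c, h1, h2, h3⟩ := hp
    exact ⟨c, h1, h2, ih h3⟩

theorem Exec.single {W : ℕ} {w : Push M Slot} {c₀ c₁ : Conf M Slot}
    (h : w.Sends c₀ c₁) (hb : c₁.Bounded W) : Exec W [w] c₀ c₁ :=
  ⟨c₁, h, hb, rfl⟩

variable [Fintype Slot]

/-- The word that stands for the content `v` of the slot `s`. -/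
noncomputable def cellWord (s : Slot) (v : Cell) : ℕ :=
  Nat.pair (Fintype.equivFin Slot s) (Nat.pair v.1 (Nat.pair v.2.1 v.2.2))

theorem cellWord_inj {s s' : Slot} {v v' : Cell} (h : cellWord s v = cellWord s' v') :
    s = s' ∧ v = v' := by
  obtain ⟨a, b, c⟩ := v
  obtain ⟨a', b', c'⟩ := v'
  simp only [cellWord, Nat.pair_eq_pair] at h
  obtain ⟨h1, h2, h3, h4⟩ := h
  refine ⟨(Fintype.equivFin Slot).injective (Fin.ext h1), ?_⟩
  simp [h2, h3, h4]

theorem Nat.pair_lt_sq {a b W : ℕ} (ha : a < W) (hb : b < W) : Nat.pair a b < W ^ 2 :=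
  (Nat.pair_lt_max_add_one_sq a b).trans_le (Nat.pow_le_pow_left (by omega) 2)

/-- Three nested pairings, each of which squares the bound: `W ^ 2`, `W ^ 4`, `W ^ 8`. -/
theorem cellWord_lt {W : ℕ} (hW : Fintype.card Slot ≤ W) (s : Slot) {v : Cell}
    (hv : v.1 < W ∧ v.2.1 < W ∧ v.2.2 < W) : cellWord s v < W ^ 8 := by
  have h0 : 1 ≤ W := by omega
  have h2 : W ≤ W ^ 2 := Nat.le_self_pow (by norm_num) W
  have h4 : W ≤ W ^ 4 := Nat.le_self_pow (by norm_num) W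
  have e1 : Nat.pair v.2.1 v.2.2 < W ^ 2 := Nat.pair_lt_sq hv.2.1 hv.2.2
  have e2 : Nat.pair v.1 (Nat.pair v.2.1 v.2.2) < (W ^ 2) ^ 2 :=
    Nat.pair_lt_sq (hv.1.trans_le h2) e1
  have e3 := Nat.pair_lt_sq (a := (Fintype.equivFin Slot s : ℕ)) (W := (W ^ 2) ^ 2)
    (lt_of_lt_of_le (Fin.is_lt _) (hW.trans (by rw [← pow_mul]; exact h4))) e2
  calc cellWord s v < ((W ^ 2) ^ 2) ^ 2 := e3
    _ = W ^ 8 := by ring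

/-- The list of words that stands for the contents of the slots of one machine. -/
noncomputable def cellWords (f : Slot → Option Cell) : List ℕ :=
  Finset.univ.toList.filterMap fun s => (f s).map (cellWord s)

/-- The words of `l` are the contents `f` of the slots of one machine, in some order. -/
def Holds (l : List ℕ) (f : Slot → Option Cell) : Prop :=
  l.Nodup ∧ ∀ w, w ∈ l ↔ ∃ s v, f s = some v ∧ w = cellWord s v

open Classical in
/-- The contents of the slots, read off a list of words. -/
noncomputable def cellsOf (l : List ℕ) (s : Slot) : Option Cell :=
  if h : ∃ v, cellWord s v ∈ l then some h.choose else none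

theorem Holds.cellsOf_eq {l : List ℕ} {f : Slot → Option Cell} (h : Holds l f) :
    cellsOf l = f := by
  funext s
  have key : ∀ v, cellWord s v ∈ l ↔ f s = some v := fun v => by
    rw [h.2]
    constructor
    · rintro ⟨s', v', hf, he⟩
      obtain ⟨rfl, rfl⟩ := cellWord_inj he
      exact hf
    · exact fun hf => ⟨s, v, hf, rfl⟩
  unfold cellsOf
  split_ifs with hex
  · exact ((key _).1 hex.choose_spec).symm
  · cases hf : f s with
    | none => rfl
    | some v => exact absurd ⟨v, (key v).2 hf⟩ hex

/-- Distinct words occupy distinct slots, because a slot determines its content. This lets the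
number of slots serve as the memory size. -/
theorem Holds.length_le {l : List ℕ} {f : Slot → Option Cell} (h : Holds l f) :
    l.length ≤ Fintype.card Slot := by
  classical
  rw [← List.toFinset_card_of_nodup h.1]
  have hsub : l.toFinset ⊆ Finset.univ.image fun s => cellWord s ((f s).getD default) := by
    intro w hw
    obtain ⟨s, v, hf, rfl⟩ := (h.2 w).1 (List.mem_toFinset.1 hw)
    exact Finset.mem_image.2 ⟨s, Finset.mem_univ _, by simp [hf]⟩
  exact (Finset.card_le_card hsub).trans Finset.card_image_le

theorem holds_cellWords (f : Slot → Option Cell) : Holds (cellWords f) f := by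
  constructor
  · refine List.Nodup.filterMap ?_ (Finset.nodup_toList _)
    intro s s' w hs hs'
    simp only [Option.mem_def, Option.map_eq_some_iff] at hs hs'
    obtain ⟨v, -, rfl⟩ := hs
    obtain ⟨v', -, he⟩ := hs'
    exact (cellWord_inj he).1.symm
  · intro w
    simp only [cellWords, List.mem_filterMap, Finset.mem_toList, Finset.mem_univ, true_and,
      Option.map_eq_some_iff]
    exact ⟨fun ⟨s, v, h, e⟩ => ⟨s, v, h, e.symm⟩, fun ⟨s, v, h, e⟩ => ⟨s, v, h, e.symm⟩⟩

/-- The message from machine `i` to machine `j` in the round `w`. -/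
noncomputable def Push.message (w : Push M Slot) (i : Fin M) (f : Slot → Option Cell)
    (j : Fin M) : List ℕ :=
  Finset.univ.toList.filterMap fun t =>
    (w i f t).bind fun m => if m.1 = j then some (cellWord m.2.1 m.2.2) else none

theorem Push.mem_message {w : Push M Slot} {i j : Fin M} {f : Slot → Option Cell} {x : ℕ} :
    x ∈ w.message i f j ↔ ∃ t s v, w i f t = some (j, s, v) ∧ x = cellWord s v := by
  simp only [Push.message, List.mem_filterMap, Finset.mem_toList, Finset.mem_univ, true_and,
    Option.bind_eq_some_iff]
  constructor
  · rintro ⟨t, ⟨j', s, v⟩, h1, h2⟩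
    split_ifs at h2 with hj
    exact ⟨t, s, v, by rw [h1, ← hj], by simpa using h2.symm⟩
  · rintro ⟨t, s, v, h1, h2⟩
    exact ⟨t, _, h1, by simp [h2]⟩

/-- Each slot sends at most one message, so the number of slots also bounds the traffic. -/
theorem Push.sum_length_message_le (w : Push M Slot) (i : Fin M) (f : Slot → Option Cell) :
    ∑ j, (w.message i f j).length ≤ Fintype.card Slot := by
  classical
  have h1 : ∀ (l : List Slot), ∑ j, (l.filterMap fun t => (w i f t).bind fun m =>
      if m.1 = j then some (cellWord m.2.1 m.2.2) else none).length ≤ l.length := by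
    intro l
    induction l with
    | nil => simp
    | cons t l ih =>
      have : ∀ j, ((t :: l).filterMap fun t => (w i f t).bind fun m =>
          if m.1 = j then some (cellWord m.2.1 m.2.2) else none).length ≤
          (if (w i f t).map (·.1) = some j then 1 else 0) +
          (l.filterMap fun t => (w i f t).bind fun m =>
          if m.1 = j then some (cellWord m.2.1 m.2.2) else none).length := by
        intro j
        rw [List.filterMap_cons]
        cases hw : w i f t with
        | none => simp
        | some m => by_cases hm : m.1 = j <;> simp [hm, add_comm]
      refine (Finset.sum_le_sum fun j _ => this j).trans ?_
      rw [Finset.sum_add_distrib, List.length_cons, add_comm]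
      refine Nat.add_le_add ih ?_
      cases hw : w i f t with
      | none => simp
      | some m => simp
  have := h1 Finset.univ.toList
  rwa [Finset.length_toList, Finset.card_univ] at this

/-- Equal words that arrive at `j` name the same slot, so `Push.Sends.inj` makes them one message.
The order of arrival is irrelevant since every word carries its slot. -/
theorem Push.Sends.holds {w : Push M Slot} {c c' : Conf M Slot} (h : w.Sends c c') (j : Fin M) :
    Holds ((List.ofFn fun i => w.message i (c i) j).flatten) (c' j) := by
  constructor
  · rw [List.nodup_flatten]
    constructor
    · intro l hl
      obtain ⟨i, rfl⟩ := (List.mem_ofFn' _ _).1 hl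
      refine List.Nodup.filterMap ?_ (Finset.nodup_toList _)
      intro t t' x ht ht'
      simp only [Option.mem_def, Option.bind_eq_some_iff] at ht ht'
      obtain ⟨⟨j1, s, v⟩, h1, h2⟩ := ht
      obtain ⟨⟨j2, s', v'⟩, h1', h2'⟩ := ht'
      split_ifs at h2 h2' with e1 e2
      simp only at e1 e2
      subst e1
      subst e2
      have hx : cellWord s v = cellWord s' v' := by
        simpa using (Option.some.inj h2).trans (Option.some.inj h2').symm
      obtain ⟨rfl, rfl⟩ := cellWord_inj hx
      exact (h.inj _ _ _ _ _ _ _ _ h1 h1').2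
    · rw [List.pairwise_ofFn]
      intro i i' hii x hx hx'
      obtain ⟨t, s, v, h1, rfl⟩ := Push.mem_message.1 hx
      obtain ⟨t', s', v', h1', he⟩ := Push.mem_message.1 hx'
      obtain ⟨rfl, rfl⟩ := cellWord_inj he
      exact hii.ne (h.inj _ _ _ _ _ _ _ _ h1 h1').1
  · intro x
    simp only [List.mem_flatten, List.mem_ofFn', Set.mem_range]
    constructor
    · rintro ⟨l, ⟨i, rfl⟩, hx⟩
      obtain ⟨t, s, v, h1, rfl⟩ := Push.mem_message.1 hx
      exact ⟨s, v, (h.delivered j s v).2 ⟨i, t, h1⟩, rfl⟩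
    · rintro ⟨s, v, h1, rfl⟩
      obtain ⟨i, t, h2⟩ := (h.delivered j s v).1 h1
      exact ⟨_, ⟨i, rfl⟩, Push.mem_message.2 ⟨t, s, v, h2, rfl⟩⟩

/-- The steps of the algorithm that loads its input into slots, runs `prog` and outputs `out`. -/
noncomputable def pushStep (start : Fin M → List ℕ → Slot → Option Cell)
    (prog : List (Push M Slot)) (out : (Slot → Option Cell) → ℕ) (t : ℕ) (i : Fin M)
    (l : List ℕ) : List ℕ × (Fin M → List ℕ) :=
  if t = 0 then (cellWords (start i l), fun _ => []) else
    match prog[t - 1]? with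
    | some w => ([], w.message i (cellsOf l))
    | none => ([out (cellsOf l)], fun _ => [])

/-- The algorithm that loads its input into slots, runs `prog` and outputs `out`. -/
noncomputable def pushAlgorithm (start : Fin M → List ℕ → Slot → Option Cell)
    (prog : List (Push M Slot)) (out : (Slot → Option Cell) → ℕ) (o : Fin M) (bits : ℕ) :
    MPCAlgorithm where
  machines := M
  space := Fintype.card Slot
  wordBits := bits
  rounds := prog.length + 2
  step := pushStep start prog out
  outputMachine := o

/-- The memory of `pushAlgorithm`. -/
noncomputable def pushMemory (start : Fin M → List ℕ → Slot → Option Cell)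
    (prog : List (Push M Slot)) (out : (Slot → Option Cell) → ℕ) (input : Fin M → List ℕ) :
    ℕ → Fin M → List ℕ
  | 0, i => input i
  | t + 1, i => (pushStep start prog out t i (pushMemory start prog out input t i)).1 ++
      (List.ofFn fun j =>
        (pushStep start prog out t j (pushMemory start prog out input t j)).2 i).flatten

theorem pushAlgorithm_memory (start : Fin M → List ℕ → Slot → Option Cell)
    (prog : List (Push M Slot)) (out : (Slot → Option Cell) → ℕ) (o : Fin M) (bits : ℕ)
    (input : Fin M → List ℕ) (t : ℕ) :
    (pushAlgorithm start prog out o bits).memory input t = pushMemory start prog out input t := by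
  induction t with
  | zero => rfl
  | succ t ih =>
    funext i
    simp only [MPCAlgorithm.memory, ih]
    rfl

variable {start : Fin M → List ℕ → Slot → Option Cell} {prog : List (Push M Slot)}
  {out : (Slot → Option Cell) → ℕ} {o : Fin M} {bits W : ℕ} {input : Fin M → List ℕ}

/-- The memory of `pushAlgorithm` during the execution of `prog`. -/
theorem pushMemory_exec {c₀ c₁ : Conf M Slot} (t : ℕ) (q : List (Push M Slot))
    (hq : prog.drop t = q) (ht : t ≤ prog.length) (hc : c₀.Bounded W)
    (hexec : Exec W q c₀ c₁)
    (hmem : ∀ i, Holds (pushMemory start prog out input (t + 1) i) (c₀ i)) :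
    (∀ u, t ≤ u → u ≤ prog.length → ∃ c : Conf M Slot, c.Bounded W ∧
      ∀ i, Holds (pushMemory start prog out input (u + 1) i) (c i)) ∧
    ∀ i, Holds (pushMemory start prog out input (prog.length + 1) i) (c₁ i) := by
  induction q generalizing t c₀ with
  | nil =>
    have : prog.length = t := le_antisymm (by simpa using hq) ht
    cases hexec
    rw [this]
    exact ⟨fun u h1 h2 => ⟨_, hc, by rwa [show u = t by omega]⟩, hmem⟩
  | cons w q ih =>
    obtain ⟨c, h1, h2, h3⟩ := hexec
    have htl : t < prog.length := by
      by_contra hcon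
      rw [List.drop_eq_nil_of_le (by omega)] at hq
      simp at hq
    rw [List.drop_eq_getElem_cons htl] at hq
    obtain ⟨hw, hq'⟩ := List.cons.inj hq
    have hstep : ∀ i, Holds (pushMemory start prog out input (t + 1 + 1) i) (c i) := by
      intro i
      have := h1.holds i
      rw [pushMemory]
      have hs : ∀ j l, pushStep start prog out (t + 1) j l = ([], w.message j (cellsOf l)) := by
        intro j l
        simp [pushStep, List.getElem?_eq_getElem htl, hw]
      have e : ∀ j, cellsOf (pushMemory start prog out input (t + 1) j) = c₀ j :=
        fun j => (hmem j).cellsOf_eq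
      simp only [hs, List.nil_append, e]
      exact this
    obtain ⟨g1, g2⟩ := ih (t + 1) hq' (by omega) h2 h3 hstep
    refine ⟨fun u hu hu' => ?_, g2⟩
    rcases hu.eq_or_lt with rfl | hlt
    · exact ⟨c₀, hc, hmem⟩
    · exact g1 u hlt hu'

/-- The two rounds besides `prog` load the input and write the output. In between nothing is kept: a
cell that stays is a message to its own machine, so the memory is exactly what was received, and
memory and traffic are both bounded by the number of slots. -/
theorem pushAlgorithm_spec {c₁ : Conf M Slot} (hW : Fintype.card Slot ≤ W)
    (hS : 1 ≤ Fintype.card Slot) (hbits : W ^ 8 ≤ 2 ^ bits)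
    (hin : ∀ i, (input i).length ≤ Fintype.card Slot ∧ ∀ w ∈ input i, w < 2 ^ bits)
    (hstart : Conf.Bounded W (fun i => start i (input i)))
    (hexec : Exec W prog (fun i => start i (input i)) c₁)
    (hout : ∀ i, out (c₁ i) < 2 ^ bits) :
    (pushAlgorithm start prog out o bits).RespectsLimits input ∧
    (pushAlgorithm start prog out o bits).result input = some (out (c₁ o)) := by
  have hmem1 : ∀ i, Holds (pushMemory start prog out input (0 + 1) i) (start i (input i)) := by
    intro i
    have : pushMemory start prog out input (0 + 1) i = cellWords (start i (input i)) := by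
      rw [pushMemory]
      simp [pushStep, pushMemory]
    rw [this]
    exact holds_cellWords _
  obtain ⟨g1, g2⟩ := pushMemory_exec (out := out) (input := input)
    (start := start) 0 prog (by simp) (Nat.zero_le _) hstart hexec hmem1
  have hlast : ∀ i, pushMemory start prog out input (prog.length + 1 + 1) i = [out (c₁ i)] := by
    intro i
    rw [pushMemory]
    have hs : ∀ j l, pushStep start prog out (prog.length + 1) j l =
        ([out (cellsOf l)], fun _ => []) := by
      intro j l
      simp [pushStep]
    simp only [hs]
    have : cellsOf (pushMemory start prog out input (prog.length + 1) i) = c₁ i :=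
      (g2 i).cellsOf_eq
    simp [this]
  have hlim : ∀ t ≤ prog.length + 2, ∀ i : Fin M,
      (pushMemory start prog out input t i).length ≤ Fintype.card Slot ∧
      ∀ w ∈ pushMemory start prog out input t i, w < 2 ^ bits := by
    intro t ht i
    rcases Nat.eq_zero_or_pos t with rfl | htpos
    · exact hin i
    obtain ⟨u, rfl⟩ : ∃ u, t = u + 1 := ⟨t - 1, by omega⟩
    rcases Nat.lt_or_ge prog.length u with hu | hu
    · obtain rfl : u = prog.length + 1 := by omega
      rw [hlast]
      exact ⟨by simpa using hS, by simpa using hout i⟩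
    · obtain ⟨c, hc, hh⟩ := g1 u (Nat.zero_le _) hu
      refine ⟨(hh i).length_le, fun x hx => ?_⟩
      obtain ⟨s, v, hv, rfl⟩ := ((hh i).2 x).1 hx
      exact (cellWord_lt hW s (hc i s v hv)).trans_le hbits
  have hsent : ∀ t, ∀ i : Fin M, ∑ j : Fin M, ((pushStep start prog out t i
      (pushMemory start prog out input t i)).2 j).length ≤ Fintype.card Slot := by
    intro t i
    by_cases h0 : t = 0
    · simp [pushStep, h0]
    · cases hp : prog[t - 1]? with
      | none => simp [pushStep, h0, hp]
      | some w =>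
        simp only [pushStep, h0, hp, if_false]
        exact w.sum_length_message_le i _
  refine ⟨⟨?_, ?_⟩, ?_⟩
  · intro t ht i
    rw [pushAlgorithm_memory]
    exact hlim t ht i
  · intro t _ i
    simp only [MPCAlgorithm.sent, pushAlgorithm_memory]
    exact hsent t i
  · have := congrFun (pushAlgorithm_memory start prog out o bits input (prog.length + 2)) o
    exact congrArg List.head? (this.trans (hlast o))

end Push

/-! ### Prefix sums by doubling with a large base -/

section Scan

/-- The machine at distance `u` above (`true`) or below (`false`) machine `j`. -/
def Fin.shift {M : ℕ} (b : Bool) (j : Fin M) (u : ℕ) : Option (Fin M) :=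
  if b then (if h : j + u < M then some ⟨j + u, h⟩ else none)
  else (if u ≤ j then some ⟨j - u, by omega⟩ else none)

theorem Fin.shift_eq_some {M : ℕ} {b : Bool} {j i : Fin M} {u : ℕ} :
    j.shift b u = some i ↔ if b then (j : ℕ) + u = i else (i : ℕ) + u = j := by
  unfold Fin.shift
  cases b
  · by_cases h : u ≤ j <;> simp [h, Fin.ext_iff] <;> omega
  · by_cases h : j + u < M <;> simp [h, Fin.ext_iff]; omega

/-- The recipient sees the sender at the same distance in the opposite direction; this gives the
return address in a scan. -/
theorem Fin.shift_symm {M : ℕ} {b : Bool} {j i : Fin M} {u : ℕ} :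
    j.shift b u = some i ↔ i.shift (!b) u = some j := by
  simp only [Fin.shift_eq_some]
  cases b <;> simp

theorem Fin.shift_add {M : ℕ} (b : Bool) (j : Fin M) (u v : ℕ) :
    j.shift b (u + v) = (j.shift b u).bind fun i => i.shift b v := by
  ext i
  simp only [Option.bind_eq_some_iff, Fin.shift_eq_some]
  cases b
  · simp only [Bool.false_eq_true, if_false]
    exact ⟨fun h => ⟨⟨i + v, by omega⟩, by simp; omega, rfl⟩, fun ⟨k, h1, h2⟩ => by omega⟩
  · simp only [if_true]
    exact ⟨fun h => ⟨⟨j + u, by omega⟩, rfl, by simp; omega⟩, fun ⟨k, h1, h2⟩ => by omega⟩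

/-- The sum of `g` over the `n` machines that start at `i` and go up or down. -/
def windowSum {M : ℕ} (b : Bool) (n : ℕ) (g : Fin M → ℕ) (i : Fin M) : ℕ :=
  ∑ u ∈ Finset.range n, (i.shift b u).elim 0 g

theorem windowSum_eq {M : ℕ} (b : Bool) (n : ℕ) (g : Fin M → ℕ) (i : Fin M) :
    windowSum b n g i = ∑ j : Fin M, if (if b then (i : ℕ) ≤ j ∧ (j : ℕ) - i < n
      else (j : ℕ) ≤ i ∧ (i : ℕ) - j < n) then g j else 0 := by
  have h1 : ∀ o : Option (Fin M), o.elim 0 g = ∑ j : Fin M, if o = some j then g j else 0 := by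
    intro o
    cases o <;> simp
  unfold windowSum
  simp only [h1]
  rw [Finset.sum_comm]
  refine Finset.sum_congr rfl fun j _ => ?_
  simp only [Fin.shift_eq_some]
  cases b
  · simp only [Bool.false_eq_true, if_false]
    split_ifs with h
    · rw [Finset.sum_eq_single_of_mem ((i : ℕ) - j) (Finset.mem_range.2 h.2)
        (fun u _ hu => if_neg (by omega)), if_pos (by omega)]
    · exact Finset.sum_eq_zero fun u hu => if_neg (by have := Finset.mem_range.1 hu; omega)
  · simp only [if_true]
    split_ifs with h
    · rw [Finset.sum_eq_single_of_mem ((j : ℕ) - i) (Finset.mem_range.2 h.2)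
        (fun u _ hu => if_neg (by omega)), if_pos (by omega)]
    · exact Finset.sum_eq_zero fun u hu => if_neg (by have := Finset.mem_range.1 hu; omega)

theorem windowSum_le {M : ℕ} (b : Bool) (n : ℕ) (g : Fin M → ℕ) (i : Fin M) :
    windowSum b n g i ≤ ∑ j, g j := by
  rw [windowSum_eq]
  exact Finset.sum_le_sum fun j _ => by split_ifs <;> simp

theorem windowSum_true {M n : ℕ} (hn : M ≤ n) (g : Fin M → ℕ) (i : Fin M) :
    windowSum true n g i = ∑ j, if i ≤ j then g j else 0 := by
  rw [windowSum_eq]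
  refine Finset.sum_congr rfl fun j _ => if_congr ?_ rfl rfl
  simp only [if_true, Fin.le_def]
  omega

theorem windowSum_false {M n : ℕ} (hn : M ≤ n) (g : Fin M → ℕ) (i : Fin M) :
    windowSum false n g i = ∑ j, if j ≤ i then g j else 0 := by
  rw [windowSum_eq]
  refine Finset.sum_congr rfl fun j _ => if_congr ?_ rfl rfl
  simp only [Bool.false_eq_true, if_false, Fin.le_def]
  omega

/-- A window of length `B * n` consists of `B` adjacent windows of length `n`, at the shifts `a *
n`. Those that start beyond the last machine are empty and count as 0. -/
theorem windowSum_mul {M : ℕ} (b : Bool) (B n : ℕ) (g : Fin M → ℕ) (i : Fin M) :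
    ∑ a : Fin B, ((i.shift b (a * n)).map (windowSum b n g)).getD 0 = windowSum b (B * n) g i := by
  have : ∀ a : ℕ, ((i.shift b (a * n)).map (windowSum b n g)).getD 0 =
      ∑ u ∈ Finset.range n, (i.shift b (a * n + u)).elim 0 g := by
    intro a
    simp only [Fin.shift_add]
    cases i.shift b (a * n) with
    | none => simp
    | some j => simp [windowSum]
  simp only [this]
  unfold windowSum
  rw [Fin.sum_univ_eq_sum_range fun a => ∑ u ∈ Finset.range n, (i.shift b (a * n + u)).elim 0 g]
  clear this
  induction B with
  | zero => simp
  | succ B ih =>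
    rw [Finset.sum_range_succ, ih, Nat.succ_mul, Finset.sum_range_add]

end Scan

/-! ### Layout of the slots and the rounds of a scan -/

section Slots

/-- The slots of a machine that takes part in range sums: `L` main slots, `3 * L` slots for the
items to be sorted, `2 * L` slots for answers, and `2 * B * B` slots for prefix sums. -/
abbrev RSlot (B L : ℕ) := Fin L ⊕ Fin (3 * L) ⊕ (Bool × Fin L) ⊕ (Bool × Fin B × Fin B)

variable {M B L : ℕ}

/-- The configuration with the given contents. -/
def mkConf (mn : Fin M → Fin L → ℕ) (it : Fin M → Fin (3 * L) → Option Cell)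
    (an : Fin M → Bool → Fin L → Option ℕ) (vc : Fin M → Bool → Fin B → Fin B → Option ℕ) :
    Conf M (RSlot B L) := fun i x =>
  match x with
  | .inl s => some (mn i s, 0, 0)
  | .inr (.inl t) => it i t
  | .inr (.inr (.inl (b, s))) => (an i b s).map fun a => (a, 0, 0)
  | .inr (.inr (.inr (b, a, d))) => (vc i b a d).map fun a => (a, 0, 0)

theorem mkConf_bounded {W : ℕ} (hW : 0 < W) {mn : Fin M → Fin L → ℕ}
    {it : Fin M → Fin (3 * L) → Option Cell}
    {an : Fin M → Bool → Fin L → Option ℕ} {vc : Fin M → Bool → Fin B → Fin B → Option ℕ}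
    (h1 : ∀ i s, mn i s < W) (h2 : ∀ i t v, it i t = some v → v.1 < W ∧ v.2.1 < W ∧ v.2.2 < W)
    (h3 : ∀ i b s v, an i b s = some v → v < W)
    (h4 : ∀ i b a d v, vc i b a d = some v → v < W) : (mkConf mn it an vc).Bounded W := by
  intro i x v hv
  rcases x with s | t | ⟨b, s⟩ | ⟨b, a, d⟩
  · simp only [mkConf, Option.some.injEq] at hv
    subst hv
    exact ⟨h1 i s, hW, hW⟩
  · exact h2 i t v hv
  · simp only [mkConf, Option.map_eq_some_iff] at hv
    obtain ⟨u, hu, rfl⟩ := hv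
    exact ⟨h3 i b s u hu, hW, hW⟩
  · simp only [mkConf, Option.map_eq_some_iff] at hv
    obtain ⟨u, hu, rfl⟩ := hv
    exact ⟨h4 i b a d u hu, hW, hW⟩

/-- The content of a main slot. -/
def mainOf (f : RSlot B L → Option Cell) (s : Fin L) : ℕ := ((f (.inl s)).getD 0).1

/-- The content of an item slot. -/
def itemOf (f : RSlot B L → Option Cell) (t : Fin (3 * L)) : Cell := (f (.inr (.inl t))).getD 0

/-- The content of an answer slot. -/
def ansOf (f : RSlot B L → Option Cell) (b : Bool) (s : Fin L) : ℕ :=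
  ((f (.inr (.inr (.inl (b, s))))).getD 0).1

/-- The sum of the vectors that a machine holds. -/
def vecOf (f : RSlot B L → Option Cell) (b : Bool) (d : Fin B) : ℕ :=
  ∑ a, ((f (.inr (.inr (.inr (b, a, d))))).getD 0).1

variable {mn : Fin M → Fin L → ℕ} {it : Fin M → Fin (3 * L) → Option Cell}
  {an : Fin M → Bool → Fin L → Option ℕ} {vc : Fin M → Bool → Fin B → Fin B → Option ℕ}

@[simp] theorem mainOf_mkConf (i : Fin M) (s : Fin L) : mainOf (mkConf mn it an vc i) s = mn i s :=
  rfl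

@[simp] theorem itemOf_mkConf (i : Fin M) (t : Fin (3 * L)) :
    itemOf (mkConf mn it an vc i) t = (it i t).getD 0 := rfl

@[simp] theorem ansOf_mkConf (i : Fin M) (b : Bool) (s : Fin L) :
    ansOf (mkConf mn it an vc i) b s = (an i b s).getD 0 := by
  simp only [ansOf, mkConf]
  cases an i b s <;> rfl

@[simp] theorem vecOf_mkConf (i : Fin M) (b : Bool) (d : Fin B) :
    vecOf (mkConf mn it an vc i) b d = ∑ a, (vc i b a d).getD 0 := by
  simp only [vecOf, mkConf]
  refine Finset.sum_congr rfl fun a _ => ?_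
  cases vc i b a d <;> rfl

/-- The total weight of the items of a machine with the digit `d`. -/
def histogram (dig : Cell → Fin B) (wt : Cell → ℕ) {T : ℕ} (it : Fin T → Cell) (d : Fin B) : ℕ :=
  ∑ t, if dig (it t) = d then wt (it t) else 0

/-- The round that starts a scan. -/
def scanInit (dig : Cell → Fin B) (wt : Cell → ℕ) : Push M (RSlot B L) := fun i f x =>
  match x with
  | .inl s => some (i, .inl s, (mainOf f s, 0, 0))
  | .inr (.inl t) => some (i, .inr (.inl t), itemOf f t)
  | .inr (.inr (.inl _)) => none
  | .inr (.inr (.inr (b, a, d))) =>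
    if (a : ℕ) = 0 then some (i, .inr (.inr (.inr (b, a, d))), (histogram dig wt (itemOf f) d, 0, 0))
    else none

/-- The round of a scan in which the windows grow from length `n` to length `B * n`. -/
def scanLevel (n : ℕ) : Push M (RSlot B L) := fun i f x =>
  match x with
  | .inl s => some (i, .inl s, (mainOf f s, 0, 0))
  | .inr (.inl t) => some (i, .inr (.inl t), itemOf f t)
  | .inr (.inr (.inl _)) => none
  | .inr (.inr (.inr (b, a, d))) =>
    (i.shift (!b) (a * n)).map fun j => (j, .inr (.inr (.inr (b, a, d))), (vecOf f b d, 0, 0))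

theorem scanInit_sends (dig : Cell → Fin B) (wt : Cell → ℕ) (mn : Fin M → Fin L → ℕ)
    (it : Fin M × Fin (3 * L) → Cell) :
    (scanInit dig wt).Sends
      (mkConf (B := B) mn (fun i t => some (it (i, t))) (fun _ _ _ => none) (fun _ _ _ _ => none))
      (mkConf mn (fun i t => some (it (i, t))) (fun _ _ _ => none) (fun i _ a d =>
        if (a : ℕ) = 0 then some (histogram dig wt (fun t => it (i, t)) d) else none)) := by
  refine Push.Sends.of_back (fun j x => (j, x)) ?_ ?_
  · rintro i (s | t | ⟨b, s⟩ | ⟨b, a, d⟩) j x v h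
    · simp only [scanInit, Option.some.injEq, Prod.mk.injEq] at h
      obtain ⟨rfl, rfl, rfl⟩ := h
      exact ⟨rfl, rfl⟩
    · simp only [scanInit, Option.some.injEq, Prod.mk.injEq] at h
      obtain ⟨rfl, rfl, rfl⟩ := h
      exact ⟨rfl, rfl⟩
    · simp [scanInit] at h
    · simp only [scanInit, Option.ite_none_right_eq_some, Option.some.injEq, Prod.mk.injEq] at h
      obtain ⟨h0, rfl, rfl, rfl⟩ := h
      refine ⟨rfl, ?_⟩
      simp only [mkConf, h0, if_true, Option.map_some]
      rfl
  · rintro j (s | t | ⟨b, s⟩ | ⟨b, a, d⟩) v h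
    · simp only [mkConf, Option.some.injEq] at h
      subst h
      rfl
    · simp only [mkConf, Option.some.injEq] at h
      subst h
      rfl
    · simp [mkConf] at h
    · simp only [mkConf, Option.map_eq_some_iff, Option.ite_none_right_eq_some] at h
      obtain ⟨u, ⟨h0, h1⟩, rfl⟩ := h
      simp only [scanInit, h0, if_true, ← Option.some.inj h1]
      rfl

/-- The slot index `a` records the distance `a * n` to the sender, so the vectors that reach a
machine never collide. -/
theorem scanLevel_sends (n : ℕ) (mn : Fin M → Fin L → ℕ)
    (it : Fin M × Fin (3 * L) → Cell) (vc : Fin M → Bool → Fin B → Fin B → Option ℕ) :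
    (scanLevel n).Sends
      (mkConf mn (fun i t => some (it (i, t))) (fun _ _ _ => none) vc)
      (mkConf mn (fun i t => some (it (i, t))) (fun _ _ _ => none) (fun j b a d =>
        (j.shift b (a * n)).map fun i => ∑ a', (vc i b a' d).getD 0)) := by
  refine Push.Sends.of_back (fun j x =>
    match x with
    | .inr (.inr (.inr (b, a, d))) => ((j.shift b (a * n)).getD j, x)
    | _ => (j, x)) ?_ ?_
  · rintro i (s | t | ⟨b, s⟩ | ⟨b, a, d⟩) j x v h
    · simp only [scanLevel, Option.some.injEq, Prod.mk.injEq] at h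
      obtain ⟨rfl, rfl, rfl⟩ := h
      exact ⟨rfl, rfl⟩
    · simp only [scanLevel, Option.some.injEq, Prod.mk.injEq] at h
      obtain ⟨rfl, rfl, rfl⟩ := h
      exact ⟨rfl, rfl⟩
    · simp [scanLevel] at h
    · simp only [scanLevel, Option.map_eq_some_iff, Prod.mk.injEq] at h
      obtain ⟨j', h0, rfl, rfl, rfl⟩ := h
      have h0' : j'.shift b (a * n) = some i := by rw [Fin.shift_symm]; exact h0
      simp [mkConf, h0']
  · rintro j (s | t | ⟨b, s⟩ | ⟨b, a, d⟩) v h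
    · simp only [mkConf, Option.some.injEq] at h
      subst h
      rfl
    · simp only [mkConf, Option.some.injEq] at h
      subst h
      rfl
    · simp [mkConf] at h
    · simp only [mkConf, Option.map_eq_some_iff] at h
      obtain ⟨u, ⟨i, h0, rfl⟩, rfl⟩ := h
      have h0' : i.shift (!b) (a * n) = some j := by rw [← Fin.shift_symm]; exact h0
      simp [scanLevel, h0, h0']

/-- The rounds of a scan. -/
def scanProg (dig : Cell → Fin B) (wt : Cell → ℕ) (lev : ℕ) : List (Push M (RSlot B L)) :=
  scanInit dig wt :: (List.range lev).map fun l => scanLevel (B ^ l)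

/-- The windows start with length 1 and each level multiplies their length by `B` (`windowSum_mul`).
No window sum exceeds the total weight, so all numbers stay below `W`. -/
theorem scanProg_exec {W : ℕ} (hW : 0 < W) (hB : 0 < B) (dig : Cell → Fin B) (wt : Cell → ℕ)
    (lev : ℕ) (mn : Fin M → Fin L → ℕ) (it : Fin M × Fin (3 * L) → Cell)
    (hmn : ∀ i s, mn i s < W) (hit : ∀ p, (it p).1 < W ∧ (it p).2.1 < W ∧ (it p).2.2 < W)
    (hwt : ∑ p, wt (it p) < W) :
    ∃ vc : Fin M → Bool → Fin B → Fin B → Option ℕ,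
      Exec W (scanProg dig wt lev)
        (mkConf (B := B) mn (fun i t => some (it (i, t))) (fun _ _ _ => none) (fun _ _ _ _ => none))
        (mkConf mn (fun i t => some (it (i, t))) (fun _ _ _ => none) vc) ∧
      ∀ i b d, ∑ a, (vc i b a d).getD 0 =
        windowSum b (B ^ lev) (fun j => histogram dig wt (fun t => it (j, t)) d) i := by
  have htot : ∀ d, ∑ j, histogram dig wt (fun t => it (j, t)) d < W := by
    intro d
    refine lt_of_le_of_lt ?_ hwt
    rw [Fintype.sum_prod_type]
    exact Finset.sum_le_sum fun j _ => Finset.sum_le_sum fun t _ => by split_ifs <;> simp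
  have hitem : ∀ (i : Fin M) (t : Fin (3 * L)) (v : Cell), some (it (i, t)) = some v →
      v.1 < W ∧ v.2.1 < W ∧ v.2.2 < W := by
    intro i t v hv
    rw [← Option.some.inj hv]
    exact hit _
  induction lev with
  | zero =>
    refine ⟨_, Exec.single (scanInit_sends dig wt mn it) (mkConf_bounded hW hmn hitem
      (by simp) ?_), ?_⟩
    · intro i b a d v hv
      rw [Option.ite_none_right_eq_some] at hv
      rw [← Option.some.inj hv.2]
      exact lt_of_le_of_lt (Finset.single_le_sum
        (f := fun j => histogram dig wt (fun t => it (j, t)) d) (by simp) (Finset.mem_univ i))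
        (htot d)
    · intro i b d
      have h0 : i.shift b 0 = some i := by rw [Fin.shift_eq_some]; simp
      rw [Finset.sum_eq_single (⟨0, hB⟩ : Fin B)]
      · simp [windowSum, h0]
      · intro a _ ha
        rw [if_neg (fun h => ha (Fin.ext h))]
        rfl
      · simp
  | succ lev ih =>
    obtain ⟨vc, h1, h2⟩ := ih
    refine ⟨fun j b a d => (j.shift b (a * B ^ lev)).map fun i => ∑ a', (vc i b a' d).getD 0,
      ?_, ?_⟩
    · rw [scanProg, List.range_succ, List.map_append, ← List.cons_append]
      refine h1.append (Exec.single (scanLevel_sends (B ^ lev) mn it vc) ?_)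
      refine mkConf_bounded hW hmn hitem (by simp) ?_
      intro i b a d v hv
      rw [Option.map_eq_some_iff] at hv
      obtain ⟨j, -, rfl⟩ := hv
      rw [h2]
      exact (windowSum_le _ _ _ _).trans_lt (htot d)
    · intro i b d
      simp only [h2]
      rw [pow_succ', ← windowSum_mul]

end Slots

/-! ### Sorting by rank -/

section Rank

variable {ι κ : Type*} [Fintype ι] [LinearOrder κ]

/-- The number of indices with a smaller key. -/
def rankOf (g : ι → κ) (p : ι) : ℕ := ∑ q, if g q < g p then 1 else 0

theorem rankOf_eq_card (g : ι → κ) (p : ι) :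
    rankOf g p = (Finset.univ.filter fun q => g q < g p).card := by
  rw [rankOf, Finset.card_filter]

theorem rankOf_lt_rankOf {g : ι → κ} {p q : ι} (h : g p < g q) : rankOf g p < rankOf g q := by
  rw [rankOf_eq_card, rankOf_eq_card]
  refine Finset.card_lt_card ⟨fun r hr => ?_, fun hsub => ?_⟩
  · simp only [Finset.mem_filter, Finset.mem_univ, true_and] at hr ⊢
    exact hr.trans h
  · have := hsub (Finset.mem_filter.2 ⟨Finset.mem_univ p, h⟩)
    simp at this

theorem lt_of_rankOf_lt {g : ι → κ} {p q : ι} (h : rankOf g p < rankOf g q) : g p < g q := by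
  by_contra hcon
  rcases (not_lt.1 hcon).lt_or_eq with h1 | h1
  · exact absurd (rankOf_lt_rankOf h1) (by omega)
  · simp [rankOf, h1] at h

theorem rankOf_lt (g : ι → κ) (p : ι) : rankOf g p < Fintype.card ι := by
  rw [rankOf_eq_card]
  refine Finset.card_lt_card ⟨Finset.filter_subset _ _, fun h => ?_⟩
  have := h (Finset.mem_univ p)
  simp at this

theorem rankOf_injective {g : ι → κ} (hg : Function.Injective g) :
    Function.Injective (rankOf g) := by
  intro p q h
  by_contra hne
  rcases lt_or_gt_of_ne fun h' => hne (hg h') with h1 | h1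
  · exact absurd (rankOf_lt_rankOf h1) (by omega)
  · exact absurd (rankOf_lt_rankOf h1) (by omega)

/-- Ranks, for an injective key, as a bijection. -/
noncomputable def rankEquiv (g : ι → κ) (hg : Function.Injective g) {n : ℕ}
    (hn : Fintype.card ι = n) : ι ≃ Fin n :=
  Equiv.ofBijective (fun p => ⟨rankOf g p, hn ▸ rankOf_lt g p⟩)
    ((Fintype.bijective_iff_injective_and_card _).2
      ⟨fun _ _ h => rankOf_injective hg (by simpa using h), by simp [hn]⟩)

@[simp] theorem rankEquiv_val (g : ι → κ) (hg : Function.Injective g) {n : ℕ}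
    (hn : Fintype.card ι = n) (p : ι) : (rankEquiv g hg hn p : ℕ) = rankOf g p := rfl

end Rank

/-! ### The rank of an item from local data and prefix sums -/

section LocalRank

variable {M B T : ℕ}

/-- The key by which a pass of radix sort orders the items. -/
def digitKey (dig : Cell → Fin B) (it : Fin M × Fin T → Cell) (p : Fin M × Fin T) :
    Fin B ×ₗ (Fin M ×ₗ Fin T) := toLex (dig (it p), toLex p)

/-- The position breaks ties between equal digits. Hence ranks are distinct and a pass of radix sort
is stable. -/
theorem digitKey_injective (dig : Cell → Fin B) (it : Fin M × Fin T → Cell) :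
    Function.Injective (digitKey dig it) := by
  intro p q h
  simp only [digitKey, EmbeddingLike.apply_eq_iff_eq, Prod.mk.injEq] at h
  exact h.2

theorem digitKey_lt {dig : Cell → Fin B} {it : Fin M × Fin T → Cell} {p q : Fin M × Fin T} :
    digitKey dig it p < digitKey dig it q ↔ dig (it p) < dig (it q) ∨
      dig (it p) = dig (it q) ∧ (p.1 < q.1 ∨ p.1 = q.1 ∧ p.2 < q.2) := by
  simp only [digitKey, Prod.Lex.lt_iff, ofLex_toLex]

theorem finProdFinEquiv_lt {p q : Fin M × Fin T} :
    finProdFinEquiv p < finProdFinEquiv q ↔ p.1 < q.1 ∨ p.1 = q.1 ∧ p.2 < q.2 := by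
  obtain ⟨i, t⟩ := p
  obtain ⟨j, u⟩ := q
  have ht := t.2
  have hu := u.2
  simp only [Fin.lt_def, finProdFinEquiv_apply_val, Fin.ext_iff]
  constructor
  · intro h
    rcases Nat.lt_trichotomy i j with h1 | h1 | h1
    · exact Or.inl h1
    · rw [h1] at h
      exact Or.inr ⟨h1, by omega⟩
    · have : T * (j + 1) ≤ T * i := Nat.mul_le_mul_left _ h1
      rw [Nat.mul_succ] at this
      omega
  · rintro (h | ⟨h1, h2⟩)
    · have : T * (i + 1) ≤ T * j := Nat.mul_le_mul_left _ h
      rw [Nat.mul_succ] at this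
      omega
    · rw [h1]
      omega

/-- The weight of the items before an item, in the order of digits and positions, computed from
the items of a machine and from the histogram sums of the machines up to it and from it on. -/
def localRank (dig : Cell → Fin B) (wt : Cell → ℕ) (it : Fin T → Cell) (V : Bool → Fin B → ℕ)
    (t : Fin T) : ℕ :=
  (∑ d, if d < dig (it t) then V false d + V true d - histogram dig wt it d else 0) +
  (V false (dig (it t)) - histogram dig wt it (dig (it t))) +
  ∑ t', if dig (it t') = dig (it t) ∧ t' < t then wt (it t') else 0

/-- The items before a given one are of three kinds: smaller digit on any machine, equal digit on an
earlier machine, equal digit at an earlier place of the same machine. -/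
theorem localRank_eq {dig : Cell → Fin B} {wt : Cell → ℕ} {it : Fin M × Fin T → Cell} {i : Fin M}
    {V : Bool → Fin B → ℕ}
    (h1 : ∀ d, V false d = ∑ j, if j ≤ i then histogram dig wt (fun t => it (j, t)) d else 0)
    (h2 : ∀ d, V true d = ∑ j, if i ≤ j then histogram dig wt (fun t => it (j, t)) d else 0)
    (t : Fin T) :
    localRank dig wt (fun t => it (i, t)) V t =
      ∑ q, if digitKey dig it q < digitKey dig it (i, t) then wt (it q) else 0 := by
  set h : Fin M → Fin B → ℕ := fun j => histogram dig wt (fun t => it (j, t)) with hh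
  have e1 : ∀ d, V false d = (∑ j, if j < i then h j d else 0) + h i d := by
    intro d
    rw [h1, ← Fintype.sum_ite_eq' i fun j => h j d, ← Finset.sum_add_distrib]
    refine Finset.sum_congr rfl fun j _ => ?_
    rcases lt_trichotomy j i with hj | hj | hj
    · simp [hj.le, hj, hj.ne, h]
    · simp [hj, h]
    · simp [hj.not_ge, hj.not_gt, hj.ne']
  -- The windows up to `i` and from `i` on overlap exactly in machine `i`, whose histogram is
  -- therefore counted twice.
  have e2 : ∀ d, V false d + V true d = (∑ j, h j d) + h i d := by
    intro d
    rw [h1, h2, ← Fintype.sum_ite_eq' i fun j => h j d, ← Finset.sum_add_distrib,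
      ← Finset.sum_add_distrib]
    refine Finset.sum_congr rfl fun j _ => ?_
    rcases lt_trichotomy j i with hj | hj | hj
    · simp [hj.le, hj.not_ge, hj.ne, h]
    · simp [hj, h]
    · simp [hj.not_ge, hj.le, hj.ne', h]
  have e3 : ∀ q : Fin M × Fin T,
      (if digitKey dig it q < digitKey dig it (i, t) then wt (it q) else 0) =
      (∑ d, if d < dig (it (i, t)) then (if dig (it q) = d then wt (it q) else 0) else 0) +
      (if q.1 < i then (if dig (it q) = dig (it (i, t)) then wt (it q) else 0) else 0) +
      (if q.1 = i then (if dig (it q) = dig (it (i, t)) ∧ q.2 < t then wt (it q) else 0)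
        else 0) := by
    intro q
    have : (∑ d, if d < dig (it (i, t)) then (if dig (it q) = d then wt (it q) else 0) else 0) =
        if dig (it q) < dig (it (i, t)) then wt (it q) else 0 := by
      rw [Finset.sum_eq_single (dig (it q))]
      · simp
      · intro d _ hd
        rw [if_neg hd.symm, ite_self]
      · simp
    rw [this]
    simp only [digitKey_lt]
    rcases lt_trichotomy (dig (it q)) (dig (it (i, t))) with hd | hd | hd
    · simp [hd, hd.ne]
    · rcases lt_trichotomy q.1 i with hj | hj | hj
      · simp [hd, hj, hj.ne]
      · simp [hd, hj]
      · simp [hd, hj.not_gt, hj.ne']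
    · simp [hd.not_gt, hd.ne']
  simp only [e3]
  rw [Finset.sum_add_distrib, Finset.sum_add_distrib, localRank]
  congr 1
  · congr 1
    · rw [Finset.sum_comm]
      refine Finset.sum_congr rfl fun d _ => ?_
      split_ifs with hd
      · rw [e2]
        change ∑ j, h j d + h i d - h i d = _
        rw [Nat.add_sub_cancel, Fintype.sum_prod_type]
        rfl
      · simp
    · rw [e1]
      change (∑ j, if j < i then h j _ else 0) + h i _ - h i _ = _
      rw [Nat.add_sub_cancel, Fintype.sum_prod_type]
      refine Finset.sum_congr rfl fun j _ => ?_
      split_ifs with hj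
      · rfl
      · simp
  · rw [Fintype.sum_prod_type, Finset.sum_eq_single i]
    · simp
    · intro j _ hj
      simp [hj]
    · simp

end LocalRank

/-! ### Range sums by message passing -/

section Radix

variable {M B L : ℕ}

/-- The round that sends every item to the position given by its rank. -/
def routePush (dig : Cell → Fin B) : Push M (RSlot B L) := fun i f x =>
  match x with
  | .inl s => some (i, .inl s, (mainOf f s, 0, 0))
  | .inr (.inl t) =>
    let E := localRank dig (fun _ => 1) (itemOf f) (vecOf f) t
    if h : E < M * (3 * L) then
      let p := finProdFinEquiv.symm (⟨E, h⟩ : Fin (M * (3 * L)))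
      some (p.1, .inr (.inl p.2), itemOf f t)
    else none
  | .inr (.inr _) => none

/-- The bijection from items to ranks in a pass of radix sort. -/
noncomputable def passEquiv {T : ℕ} (dig : Cell → Fin B) (it : Fin M × Fin T → Cell) :
    Fin M × Fin T ≃ Fin (M * T) :=
  rankEquiv (digitKey dig it) (digitKey_injective dig it) (by simp)

/-- The permutation of the positions in a pass of radix sort. -/
noncomputable def passPerm {T : ℕ} (dig : Cell → Fin B) (it : Fin M × Fin T → Cell) :
    Equiv.Perm (Fin M × Fin T) :=
  finProdFinEquiv.trans (passEquiv dig it).symm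

/-- Ranks by an injective key form a permutation of the positions, so no slot receives two items. -/
theorem routePush_sends (dig : Cell → Fin B) (mn : Fin M → Fin L → ℕ)
    (it : Fin M × Fin (3 * L) → Cell) (vc : Fin M → Bool → Fin B → Fin B → Option ℕ) {n : ℕ}
    (hn : M ≤ n)
    (hvc : ∀ i b d, ∑ a, (vc i b a d).getD 0 =
      windowSum b n (fun j => histogram dig (fun _ => 1) (fun t => it (j, t)) d) i) :
    (routePush dig).Sends
      (mkConf mn (fun i t => some (it (i, t))) (fun _ _ _ => none) vc)
      (mkConf mn (fun i t => some (it (passPerm dig it (i, t)))) (fun _ _ _ => none)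
        (fun _ _ _ _ => none)) := by
  have hE : ∀ i t, localRank dig (fun _ => 1) (fun t => it (i, t))
      (fun b d => ∑ a, (vc i b a d).getD 0) t = passEquiv dig it (i, t) := by
    intro i t
    rw [localRank_eq (i := i)]
    · rfl
    · intro d
      rw [hvc, windowSum_false hn]
    · intro d
      rw [hvc, windowSum_true hn]
  have hpush : ∀ i t, routePush dig i (mkConf (B := B) mn (fun i t => some (it (i, t)))
      (fun _ _ _ => none) vc i) (.inr (.inl t)) =
      some (((passPerm dig it).symm (i, t)).1, .inr (.inl ((passPerm dig it).symm (i, t)).2),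
        it (i, t)) := by
    intro i t
    simp only [routePush]
    have e1 : itemOf (mkConf (B := B) mn (fun i t => some (it (i, t)))
      (fun _ _ _ => none) vc i) = fun t => it (i, t) := rfl
    have e2 : vecOf (mkConf (B := B) mn (fun i t => some (it (i, t)))
      (fun _ _ _ => none) vc i) = fun b d => ∑ a, (vc i b a d).getD 0 := by
      funext b d
      simp
    simp only [e1, e2, hE, Fin.is_lt, dif_pos, Fin.eta]
    rfl
  refine Push.Sends.of_back (fun j x =>
    match x with
    | .inr (.inl t) => ((passPerm dig it (j, t)).1, .inr (.inl (passPerm dig it (j, t)).2))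
    | _ => (j, x)) ?_ ?_
  · rintro i (s | t | x) j x v h
    · simp only [routePush, Option.some.injEq, Prod.mk.injEq] at h
      obtain ⟨rfl, rfl, rfl⟩ := h
      exact ⟨rfl, rfl⟩
    · rw [hpush] at h
      simp only [Option.some.injEq, Prod.mk.injEq] at h
      obtain ⟨rfl, rfl, rfl⟩ := h
      simp [mkConf]
    · simp [routePush] at h
  · rintro j (s | t | ⟨b, s⟩ | ⟨b, a, d⟩) v h
    · simp only [mkConf, Option.some.injEq] at h
      subst h
      rfl
    · simp only [mkConf, Option.some.injEq] at h
      subst h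
      simp [hpush]
    · simp [mkConf] at h
    · simp [mkConf] at h

/-- The digit number `r` of a key. -/
def keyDigit (hB : 0 < B) (r : ℕ) (c : Cell) : Fin B := ⟨c.1 / B ^ r % B, Nat.mod_lt _ hB⟩

/-- The rounds of radix sort. -/
def sortProg (hB : 0 < B) (lev D : ℕ) : List (Push M (RSlot B L)) :=
  (List.range D).flatMap fun r =>
    scanProg (keyDigit hB r) (fun _ => 1) lev ++ [routePush (keyDigit hB r)]

theorem length_sortProg (hB : 0 < B) (lev D : ℕ) :
    (sortProg hB lev D : List (Push M (RSlot B L))).length = D * (lev + 2) := by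
  simp [sortProg, scanProg, List.length_flatMap]

/-- Radix sort from the least significant digit: a pass orders by the new digit, and among equal
digits stability preserves the order by the lower digits. -/
theorem sortProg_exec {W : ℕ} (hW : M * (3 * L) < W) (hB : 0 < B) {lev : ℕ}
    (hlev : M ≤ B ^ lev) (D : ℕ) (mn : Fin M → Fin L → ℕ) (it : Fin M × Fin (3 * L) → Cell)
    (hmn : ∀ i s, mn i s < W) (hit : ∀ p, (it p).1 < W ∧ (it p).2.1 < W ∧ (it p).2.2 < W) :
    ∃ π : Equiv.Perm (Fin M × Fin (3 * L)),
      Exec W (sortProg hB lev D)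
        (mkConf (B := B) mn (fun i t => some (it (i, t))) (fun _ _ _ => none) (fun _ _ _ _ => none))
        (mkConf mn (fun i t => some (it (π (i, t)))) (fun _ _ _ => none) (fun _ _ _ _ => none)) ∧
      ∀ p q, finProdFinEquiv p < finProdFinEquiv q →
        (it (π p)).1 % B ^ D ≤ (it (π q)).1 % B ^ D := by
  have hW0 : 0 < W := by omega
  induction D with
  | zero => exact ⟨1, rfl, fun p q _ => by simp [Nat.mod_one]⟩
  | succ D ih =>
    obtain ⟨π, h1, h2⟩ := ih
    obtain ⟨vc, h3, h4⟩ := scanProg_exec hW0 hB (keyDigit hB D) (fun _ => 1) lev mn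
      (it ∘ π) hmn (fun p => hit _) (by simpa using hW)
    have h5 := routePush_sends (keyDigit hB D) mn (it ∘ π) vc hlev h4
    set ρ := passPerm (keyDigit hB D) (it ∘ π) with hρ
    refine ⟨ρ.trans π, ?_, ?_⟩
    · rw [sortProg, List.range_succ, List.flatMap_append]
      refine h1.append ?_
      rw [List.flatMap_singleton]
      refine h3.append (Exec.single h5 (mkConf_bounded hW0 hmn ?_ (by simp) (by simp)))
      intro i t v hv
      rw [← Option.some.inj hv]
      exact hit _
    · intro p q hpq
      -- Routing makes the position of an item its rank, so positions compare as the keys of the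
      -- pass do.
      have h6 : digitKey (keyDigit hB D) (it ∘ π) (ρ p) < digitKey (keyDigit hB D) (it ∘ π) (ρ q) := by
        apply lt_of_rankOf_lt
        have : ∀ p, rankOf (digitKey (keyDigit hB D) (it ∘ π)) (ρ p) = finProdFinEquiv p := by
          intro p
          rw [hρ, passPerm, Equiv.trans_apply]
          have := congrArg Fin.val ((passEquiv (keyDigit hB D) (it ∘ π)).apply_symm_apply
            (finProdFinEquiv p))
          exact this
        rw [this, this]
        exact hpq
      rw [digitKey_lt, ← finProdFinEquiv_lt] at h6
      -- A key modulo `B ^ (D + 1)` is its residue modulo `B ^ D` plus `B ^ D` times its digit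
      -- number `D`.
      simp only [Equiv.trans_apply, pow_succ, Nat.mod_mul, Function.comp] at h6 ⊢
      rcases h6 with h7 | ⟨h7, h8⟩
      · have h9 : (it (π (ρ p))).1 / B ^ D % B + 1 ≤ (it (π (ρ q))).1 / B ^ D % B := h7
        have h10 : (it (π (ρ p))).1 % B ^ D < B ^ D := Nat.mod_lt _ (by positivity)
        have := Nat.mul_le_mul_left (B ^ D) h9
        rw [mul_add, mul_one] at this
        exact (Nat.add_le_add_right h10.le _).trans
          (by rw [add_comm]; exact this.trans (Nat.le_add_left _ _))
      · have h9 : (it (π (ρ p))).1 / B ^ D % B = (it (π (ρ q))).1 / B ^ D % B :=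
          congrArg Fin.val h7
        rw [h9]
        exact Nat.add_le_add_right (h2 _ _ h8) _

end Radix

/-! ### Sums over ranges of keys, by sorting and prefix sums -/

section RangeSum

variable {M B L : ℕ}

/-- The data and the queries of a range-sum step: processor `p`, with content `x`, contributes the
value `val p x` at the key `key p x` and asks for the sum of the values with keys in
`[lo p x, hi p x)`. -/
structure RangeQuery (N : ℕ) where
  key : Fin N → ℕ → ℕ
  val : Fin N → ℕ → ℕ
  lo : Fin N → ℕ → ℕ
  hi : Fin N → ℕ → ℕ

/-- The code of the origin of a query. -/
def originCode (b : Bool) (p : Fin M × Fin L) : ℕ := 2 * finProdFinEquiv p + b.toNat + 1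

/-- The origin of a query, from its code. -/
def originOf (M L : ℕ) (c : ℕ) : Option (Bool × Fin M × Fin L) :=
  if c = 0 then none else if h : (c - 1) / 2 < M * L then
    some (decide ((c - 1) % 2 = 1), finProdFinEquiv.symm ⟨(c - 1) / 2, h⟩) else none

@[simp] theorem originOf_zero : originOf M L 0 = none := rfl

@[simp] theorem originOf_originCode (b : Bool) (p : Fin M × Fin L) :
    originOf M L (originCode b p) = some (b, p) := by
  have h1 : (originCode b p - 1) / 2 = finProdFinEquiv p := by
    cases b <;> simp [originCode]; omega
  have h2 : (originCode b p - 1) % 2 = b.toNat := by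
    cases b <;> simp [originCode]
  have h0 : originCode b p ≠ 0 := by simp [originCode]
  rw [originOf, if_neg h0, dif_pos (by rw [h1]; exact Fin.is_lt _)]
  simp only [h1, h2, Fin.eta, Equiv.symm_apply_apply]
  cases b <;> simp

/-- The three items of a processor: its value and the two ends of its query. -/
def queryItem (R : RangeQuery (M * L)) (p : Fin M × Fin L) (x : ℕ) (c : Fin 3) : Cell :=
  if c = 0 then (2 * R.key (finProdFinEquiv p) x + 1, R.val (finProdFinEquiv p) x, 0)
  else if c = 1 then (2 * R.lo (finProdFinEquiv p) x, 0, originCode false p)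
  else (2 * R.hi (finProdFinEquiv p) x, 0, originCode true p)

/-- All items of a range-sum step. -/
def queryItems (R : RangeQuery (M * L)) (mn : Fin M → Fin L → ℕ) (p : Fin M × Fin (3 * L)) : Cell :=
  let u := finProdFinEquiv.symm p.2
  queryItem R (p.1, u.2) (mn p.1 u.2) u.1

/-- The round that creates the items of a range-sum step. -/
def beginPush (R : RangeQuery (M * L)) : Push M (RSlot B L) := fun i f x =>
  match x with
  | .inl s => some (i, .inl s, (mainOf f s, 0, 0))
  | .inr (.inl t) => some (i, .inr (.inl t), queryItems R (fun _ => mainOf f) (i, t))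
  | .inr (.inr _) => none

/-- The round that sends the prefix sums at the ends of the queries to their origins. -/
def deliverPush (hB : 0 < B) : Push M (RSlot B L) := fun i f x =>
  match x with
  | .inl s => some (i, .inl s, (mainOf f s, 0, 0))
  | .inr (.inl t) => (originOf M L (itemOf f t).2.2).map fun o =>
    (o.2.1, .inr (.inr (.inl (o.1, o.2.2))),
      (localRank (fun _ => (⟨0, hB⟩ : Fin B)) (fun c => c.2.1) (itemOf f) (vecOf f) t, 0, 0))
  | .inr (.inr _) => none

/-- The round that updates the main slots. -/
def finishPush (upd : Fin (M * L) → ℕ → ℕ → ℕ) : Push M (RSlot B L) := fun i f x =>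
  match x with
  | .inl s => some (i, .inl s,
      (upd (finProdFinEquiv (i, s)) (mainOf f s) (ansOf f true s - ansOf f false s), 0, 0))
  | .inr _ => none

theorem beginPush_sends (R : RangeQuery (M * L)) (mn : Fin M → Fin L → ℕ) :
    (beginPush R).Sends
      (mkConf (B := B) mn (fun _ _ => none) (fun _ _ _ => none) (fun _ _ _ _ => none))
      (mkConf mn (fun i t => some (queryItems R mn (i, t))) (fun _ _ _ => none)
        (fun _ _ _ _ => none)) := by
  refine Push.Sends.of_back (fun j x => (j, x)) ?_ ?_
  · rintro i (s | t | x) j x v h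
    · simp only [beginPush, Option.some.injEq, Prod.mk.injEq] at h
      obtain ⟨rfl, rfl, rfl⟩ := h
      exact ⟨rfl, rfl⟩
    · simp only [beginPush, Option.some.injEq, Prod.mk.injEq] at h
      obtain ⟨rfl, rfl, rfl⟩ := h
      exact ⟨rfl, rfl⟩
    · simp [beginPush] at h
  · rintro j (s | t | ⟨b, s⟩ | ⟨b, a, d⟩) v h
    · simp only [mkConf, Option.some.injEq] at h
      subst h
      rfl
    · simp only [mkConf, Option.some.injEq] at h
      subst h
      rfl
    · simp [mkConf] at h
    · simp [mkConf] at h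

theorem finishPush_sends (upd : Fin (M * L) → ℕ → ℕ → ℕ) (mn : Fin M → Fin L → ℕ)
    (an : Fin M → Bool → Fin L → ℕ) :
    (finishPush upd).Sends
      (mkConf (B := B) mn (fun _ _ => none) (fun i b s => some (an i b s)) (fun _ _ _ _ => none))
      (mkConf (fun i s => upd (finProdFinEquiv (i, s)) (mn i s) (an i true s - an i false s))
        (fun _ _ => none) (fun _ _ _ => none) (fun _ _ _ _ => none)) := by
  refine Push.Sends.of_back (fun j x => (j, x)) ?_ ?_
  · rintro i (s | x) j x v h
    · simp only [finishPush, Option.some.injEq, Prod.mk.injEq] at h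
      obtain ⟨rfl, rfl, rfl⟩ := h
      simp [mkConf]
    · simp [finishPush] at h
  · rintro j (s | t | ⟨b, s⟩ | ⟨b, a, d⟩) v h
    · simp only [mkConf, Option.some.injEq] at h
      subst h
      simp [finishPush]
    · simp [mkConf] at h
    · simp [mkConf] at h
    · simp [mkConf] at h

/-- The answer at one end of a query. -/
def prefixAns (R : RangeQuery (M * L)) (mn : Fin M → Fin L → ℕ) (i : Fin M) (b : Bool)
    (s : Fin L) : ℕ :=
  ∑ q : Fin M × Fin L, if R.key (finProdFinEquiv q) (mn q.1 q.2) <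
    (bif b then R.hi (finProdFinEquiv (i, s)) (mn i s) else R.lo (finProdFinEquiv (i, s)) (mn i s))
    then R.val (finProdFinEquiv q) (mn q.1 q.2) else 0

/-- The position at which the query of a processor is created. -/
def queryPos (i : Fin M) (b : Bool) (s : Fin L) : Fin M × Fin (3 * L) :=
  (i, finProdFinEquiv (bif b then (2 : Fin 3) else 1, s))

theorem queryItems_queryPos (R : RangeQuery (M * L)) (mn : Fin M → Fin L → ℕ) (i : Fin M)
    (b : Bool) (s : Fin L) : queryItems R mn (queryPos i b s) =
      (2 * (bif b then R.hi (finProdFinEquiv (i, s)) (mn i s)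
        else R.lo (finProdFinEquiv (i, s)) (mn i s)), 0, originCode b (i, s)) := by
  cases b <;> simp [queryItems, queryPos, queryItem]

/-- Value items carry the code 0, which has no origin, and the codes of query ends are distinct. So
an origin determines its item, which gives the return address for the delivery of answers. -/
theorem eq_queryPos (R : RangeQuery (M * L)) (mn : Fin M → Fin L → ℕ) {p : Fin M × Fin (3 * L)}
    {b : Bool} {i : Fin M} {s : Fin L}
    (h : originOf M L (queryItems R mn p).2.2 = some (b, i, s)) : p = queryPos i b s := by
  obtain ⟨j, t⟩ := p
  obtain ⟨⟨c, s'⟩, rfl⟩ := finProdFinEquiv.surjective t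
  simp only [queryItems, Equiv.symm_apply_apply, queryItem] at h
  fin_cases c
  · simp at h
  · simp only [Fin.mk_one, Fin.isValue, one_ne_zero, if_false, if_true,
      originOf_originCode, Option.some.injEq, Prod.mk.injEq] at h
    obtain ⟨rfl, rfl, rfl⟩ := h
    rfl
  · simp only [Fin.reduceFinMk, Fin.isValue, Fin.reduceEq, if_false,
      originOf_originCode, Option.some.injEq, Prod.mk.injEq] at h
    obtain ⟨rfl, rfl, rfl⟩ := h
    rfl

theorem sum_queryItems (R : RangeQuery (M * L)) (mn : Fin M → Fin L → ℕ) (P : ℕ → Prop)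
    [DecidablePred P] :
    (∑ p, if P (queryItems R mn p).1 then (queryItems R mn p).2.1 else 0) =
    ∑ q : Fin M × Fin L, if P (2 * R.key (finProdFinEquiv q) (mn q.1 q.2) + 1)
      then R.val (finProdFinEquiv q) (mn q.1 q.2) else 0 := by
  rw [Fintype.sum_prod_type, Fintype.sum_prod_type]
  refine Finset.sum_congr rfl fun i _ => ?_
  rw [← finProdFinEquiv.sum_comp, Fintype.sum_prod_type]
  simp [Fin.sum_univ_three, queryItems, queryItem]

/-- Values sit at odd keys and query ends at even keys, so an item that ties with a query end has
value 0 and its place in the sorted order is immaterial. The prefix in sorted order is thus the sum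
over smaller keys. -/
theorem queryItems_prefix (R : RangeQuery (M * L)) (mn : Fin M → Fin L → ℕ)
    (π : Equiv.Perm (Fin M × Fin (3 * L)))
    (hπ : ∀ p q, finProdFinEquiv p < finProdFinEquiv q →
        (queryItems R mn (π p)).1 ≤ (queryItems R mn (π q)).1)
    (i : Fin M) (b : Bool) (s : Fin L) (p : Fin M × Fin (3 * L)) (hp : π p = queryPos i b s) :
    (∑ q, if finProdFinEquiv q < finProdFinEquiv p then (queryItems R mn (π q)).2.1 else 0) =
      prefixAns R mn i b s := by
  have e1 : prefixAns R mn i b s = ∑ q, if (queryItems R mn q).1 < (queryItems R mn (π p)).1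
      then (queryItems R mn q).2.1 else 0 := by
    rw [sum_queryItems R mn (fun k => k < (queryItems R mn (π p)).1), hp, queryItems_queryPos,
      prefixAns]
    refine Finset.sum_congr rfl fun q _ => if_congr ?_ rfl rfl
    dsimp only
    omega
  rw [e1]
  refine Eq.trans ?_ (Equiv.sum_comp π _)
  refine Finset.sum_congr rfl fun q _ => ?_
  have key : ∀ q, (queryItems R mn q).1 = (queryItems R mn (π p)).1 →
      (queryItems R mn q).2.1 = 0 := by
    intro q hq
    rw [hp, queryItems_queryPos] at hq
    simp only [queryItems, queryItem] at hq ⊢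
    split_ifs at hq ⊢
    · dsimp only at hq
      omega
    · rfl
    · rfl
  by_cases hval : (queryItems R mn (π q)).2.1 = 0
  · simp [hval]
  refine if_congr ?_ rfl rfl
  constructor
  · intro h
    exact lt_of_le_of_ne (hπ _ _ h) fun h' => hval (key _ h')
  · intro h
    rcases lt_trichotomy (finProdFinEquiv q) (finProdFinEquiv p) with h1 | h1 | h1
    · exact h1
    · rw [finProdFinEquiv.injective h1] at h
      exact absurd h (lt_irrefl _)
    · exact absurd (hπ _ _ h1) (by omega)

theorem deliverPush_sends (hB : 0 < B) (R : RangeQuery (M * L)) (mn : Fin M → Fin L → ℕ)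
    (π : Equiv.Perm (Fin M × Fin (3 * L)))
    (hπ : ∀ p q, finProdFinEquiv p < finProdFinEquiv q →
        (queryItems R mn (π p)).1 ≤ (queryItems R mn (π q)).1)
    (vc : Fin M → Bool → Fin B → Fin B → Option ℕ) {n : ℕ} (hn : M ≤ n)
    (hvc : ∀ i b d, ∑ a, (vc i b a d).getD 0 =
      windowSum b n (fun j => histogram (fun _ => (⟨0, hB⟩ : Fin B)) (fun c => c.2.1)
        (fun t => queryItems R mn (π (j, t))) d) i) :
    (deliverPush hB).Sends
      (mkConf mn (fun i t => some (queryItems R mn (π (i, t)))) (fun _ _ _ => none) vc)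
      (mkConf mn (fun _ _ => none) (fun i b s => some (prefixAns R mn i b s))
        (fun _ _ _ _ => none)) := by
  have hpush : ∀ i t, deliverPush hB i
      (mkConf (B := B) mn (fun i t => some (queryItems R mn (π (i, t))))
      (fun _ _ _ => none) vc i) (.inr (.inl t)) =
      (originOf M L (queryItems R mn (π (i, t))).2.2).map fun o =>
        (o.2.1, .inr (.inr (.inl (o.1, o.2.2))),
          (∑ q, if finProdFinEquiv q < finProdFinEquiv (i, t) then
            (queryItems R mn (π q)).2.1 else 0, 0, 0)) := by
    intro i t
    simp only [deliverPush]
    have e1 : itemOf (mkConf (B := B) mn (fun i t => some (queryItems R mn (π (i, t))))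
      (fun _ _ _ => none) vc i) = fun t => (queryItems R mn ∘ π) (i, t) := rfl
    have e2 : vecOf (mkConf (B := B) mn (fun i t => some (queryItems R mn (π (i, t))))
      (fun _ _ _ => none) vc i) = fun b d => ∑ a, (vc i b a d).getD 0 := by
      funext b d
      simp
    -- With a single digit the order of the items is that of their positions, and with values as
    -- weights the rank is a prefix sum.
    have e3 : localRank (fun _ => (⟨0, hB⟩ : Fin B)) (fun c => c.2.1)
        (fun t => (queryItems R mn ∘ π) (i, t)) (fun b d => ∑ a, (vc i b a d).getD 0) t =
        ∑ q, if finProdFinEquiv q < finProdFinEquiv (i, t) then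
            (queryItems R mn (π q)).2.1 else 0 := by
      rw [localRank_eq (i := i)]
      · refine Finset.sum_congr rfl fun q _ => if_congr ?_ rfl rfl
        rw [digitKey_lt, finProdFinEquiv_lt]
        simp
      · intro d
        rw [hvc, windowSum_false hn]
        rfl
      · intro d
        rw [hvc, windowSum_true hn]
        rfl
    simp only [e1, e2, e3]
    rfl
  refine Push.Sends.of_back (fun j x =>
    match x with
    | .inr (.inr (.inl (b, s))) =>
      ((π.symm (queryPos j b s)).1, .inr (.inl (π.symm (queryPos j b s)).2))
    | _ => (j, x)) ?_ ?_
  · rintro i (s | t | x) j x v h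
    · simp only [deliverPush, Option.some.injEq, Prod.mk.injEq] at h
      obtain ⟨rfl, rfl, rfl⟩ := h
      exact ⟨rfl, rfl⟩
    · rw [hpush] at h
      simp only [Option.map_eq_some_iff, Prod.mk.injEq] at h
      obtain ⟨⟨b, j', s⟩, h0, rfl, rfl, rfl⟩ := h
      have h1 := eq_queryPos R mn h0
      have h2 : π.symm (queryPos j' b s) = (i, t) := by rw [← h1, Equiv.symm_apply_apply]
      simp only [h2, true_and]
      rw [queryItems_prefix R mn π hπ j' b s (i, t) h1]
      rfl
    · simp [deliverPush] at h
  · rintro j (s | t | ⟨b, s⟩ | ⟨b, a, d⟩) v h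
    · simp only [mkConf, Option.some.injEq] at h
      subst h
      rfl
    · simp [mkConf] at h
    · simp only [mkConf, Option.map_some, Option.some.injEq] at h
      subst h
      have h1 : π (π.symm (queryPos j b s)) = queryPos j b s := Equiv.apply_symm_apply _ _
      have h2 := queryItems_prefix R mn π hπ j b s _ h1
      change deliverPush hB _ _ (.inr (.inl (π.symm (queryPos j b s)).2)) = _
      rw [hpush]
      simp only [Prod.mk.eta, h1, queryItems_queryPos, originOf_originCode, Option.map_some, h2]
    · simp [mkConf] at h

/-- The rounds of a range-sum step. -/
def rangeProg (hB : 0 < B) (lev D : ℕ) (R : RangeQuery (M * L))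
    (upd : Fin (M * L) → ℕ → ℕ → ℕ) : List (Push M (RSlot B L)) :=
  beginPush R :: (sortProg hB lev D ++
    (scanProg (fun _ => ⟨0, hB⟩) (fun c => c.2.1) lev ++ [deliverPush hB, finishPush upd]))

theorem length_rangeProg (hB : 0 < B) (lev D : ℕ) (R : RangeQuery (M * L))
    (upd : Fin (M * L) → ℕ → ℕ → ℕ) :
    (rangeProg hB lev D R upd).length = (D + 1) * (lev + 2) + 2 := by
  simp only [rangeProg, List.length_cons, List.length_append, length_sortProg, scanProg,
    List.length_map, List.length_range, List.length_nil]
  ring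

/-- The configuration between range-sum steps. -/
def rangeConf (B : ℕ) (x : Fin (M * L) → ℕ) : Conf M (RSlot B L) :=
  mkConf (fun i s => x (finProdFinEquiv (i, s))) (fun _ _ => none) (fun _ _ _ => none)
    (fun _ _ _ _ => none)

/-- A sum over `[lo, hi)` is a difference of two prefix sums, and truncated subtraction gives 0 for
an empty range. The `D` digits cover the largest key `2 * K + 1`; `W` exceeds the number of items,
the keys, the origin codes and the largest possible prefix sum `M * L * K`, and `Z` bounds the
contents. -/
theorem rangeProg_exec {W K Z : ℕ} (hB : 0 < B) {lev D : ℕ} (hlev : M ≤ B ^ lev)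
    (hD : 2 * K + 2 ≤ B ^ D) (hW : (M * L + 1) * (3 * K + 3) + Z ≤ W)
    (R : RangeQuery (M * L)) (upd : Fin (M * L) → ℕ → ℕ → ℕ)
    (hupd : ∀ p x a, upd p x a < Z)
    (x : Fin (M * L) → ℕ) (hx : ∀ p, x p < Z) (hkey : ∀ p, R.key p (x p) ≤ K)
    (hval : ∀ p, R.val p (x p) ≤ K)
    (hlo : ∀ p, R.lo p (x p) ≤ K) (hhi : ∀ p, R.hi p (x p) ≤ K) :
    Exec W (rangeProg hB lev D R upd) (rangeConf B x) (rangeConf B fun p => upd p (x p)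
      (∑ q, if R.lo p (x p) ≤ R.key q (x q) ∧ R.key q (x q) < R.hi p (x p)
        then R.val q (x q) else 0)) := by
  rw [show (M * L + 1) * (3 * K + 3) = 3 * (M * L * K) + 3 * (M * L) + 3 * K + 3 by ring] at hW
  have hW0 : 0 < W := by omega
  have hZW : Z ≤ W := by omega
  have hWK : 2 * K + 2 < W := by omega
  have hWNK : M * L * K < W := by omega
  have hWN : 3 * (M * L) < W := by omega
  set mn : Fin M → Fin L → ℕ := fun i s => x (finProdFinEquiv (i, s)) with hmn
  have hmnW : ∀ i s, mn i s < W := fun i s => (hx _).trans_le hZW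
  have hcode : ∀ b (p : Fin M × Fin L), originCode b p < W := by
    intro b p
    have h1 : (finProdFinEquiv p : ℕ) < M * L := Fin.is_lt _
    have h2 : b.toNat ≤ 1 := Bool.toNat_le b
    rw [originCode]
    omega
  have hitW : ∀ p, (queryItems R mn p).1 < W ∧ (queryItems R mn p).2.1 < W ∧
      (queryItems R mn p).2.2 < W := by
    intro p
    simp only [queryItems, queryItem]
    split_ifs
    · have h1 := hkey (finProdFinEquiv (p.1, (finProdFinEquiv.symm p.2).2))
      have h2 := hval (finProdFinEquiv (p.1, (finProdFinEquiv.symm p.2).2))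
      exact ⟨by simp only [hmn]; omega, by simp only [hmn]; omega, hW0⟩
    · have h1 := hlo (finProdFinEquiv (p.1, (finProdFinEquiv.symm p.2).2))
      exact ⟨by simp only [hmn]; omega, hW0, hcode _ _⟩
    · have h1 := hhi (finProdFinEquiv (p.1, (finProdFinEquiv.symm p.2).2))
      exact ⟨by simp only [hmn]; omega, hW0, hcode _ _⟩
  have hitK : ∀ p, (queryItems R mn p).1 < B ^ D := by
    intro p
    simp only [queryItems, queryItem]
    have h1 := hkey (finProdFinEquiv (p.1, (finProdFinEquiv.symm p.2).2))
    have h2 := hlo (finProdFinEquiv (p.1, (finProdFinEquiv.symm p.2).2))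
    have h3 := hhi (finProdFinEquiv (p.1, (finProdFinEquiv.symm p.2).2))
    split_ifs <;> simp only [hmn] <;> omega
  have htot : ∀ (P : Fin M × Fin L → Prop) [DecidablePred P],
      (∑ q : Fin M × Fin L, if P q then R.val (finProdFinEquiv q) (mn q.1 q.2) else 0) ≤ M * L * K := by
    intro P _
    calc _ ≤ ∑ _q : Fin M × Fin L, K := Finset.sum_le_sum fun q _ => by
          split_ifs
          · exact hval _
          · exact Nat.zero_le _
      _ = M * L * K := by simp
  obtain ⟨π, hsort, hπ⟩ := sortProg_exec (by rw [show M * (3 * L) = 3 * (M * L) by ring]; exact hWN)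
    hB hlev D mn (queryItems R mn) hmnW hitW
  simp only [Nat.mod_eq_of_lt (hitK _)] at hπ
  obtain ⟨vc, hscan, hvc⟩ := scanProg_exec hW0 hB (fun _ => (⟨0, hB⟩ : Fin B)) (fun c => c.2.1) lev
    mn (queryItems R mn ∘ π) hmnW (fun p => hitW _) (by
      change ∑ p, (queryItems R mn (π p)).2.1 < W
      rw [Equiv.sum_comp π fun p => (queryItems R mn p).2.1]
      have := sum_queryItems R mn (fun _ => True)
      simp only [if_true] at this
      rw [this]
      have := htot (fun _ => True)
      simp only [if_true] at this
      omega)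
  have hdel := deliverPush_sends hB R mn π hπ vc hlev hvc
  have hfin := finishPush_sends (B := B) upd mn (prefixAns R mn)
  refine ⟨_, beginPush_sends R mn, mkConf_bounded hW0 hmnW ?_ (by simp) (by simp), ?_⟩
  · intro i t v hv
    rw [← Option.some.inj hv]
    exact hitW _
  refine hsort.append (hscan.append ⟨_, hdel, mkConf_bounded hW0 hmnW (by simp) ?_ (by simp),
    _, hfin, mkConf_bounded hW0 ?_ (by simp) (by simp) (by simp), ?_⟩)
  · intro i b s v hv
    rw [← Option.some.inj hv]
    exact (htot _).trans_lt hWNK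
  · intro i s
    exact (hupd _ _ _).trans_le hZW
  · have : ∀ i s, prefixAns R mn i true s - prefixAns R mn i false s =
        ∑ q, if R.lo (finProdFinEquiv (i, s)) (x (finProdFinEquiv (i, s))) ≤ R.key q (x q) ∧
          R.key q (x q) < R.hi (finProdFinEquiv (i, s)) (x (finProdFinEquiv (i, s)))
          then R.val q (x q) else 0 := by
      intro i s
      set lo := R.lo (finProdFinEquiv (i, s)) (x (finProdFinEquiv (i, s)))
      set hi := R.hi (finProdFinEquiv (i, s)) (x (finProdFinEquiv (i, s)))
      have e : ∀ b, prefixAns R mn i b s =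
          ∑ q, if R.key q (x q) < (bif b then hi else lo) then R.val q (x q) else 0 := by
        intro b
        rw [← finProdFinEquiv.sum_comp]
        rfl
      rw [e, e]
      simp only [cond_true, cond_false]
      rcases Nat.le_total lo hi with h | h
      · rw [Nat.sub_eq_iff_eq_add, ← Finset.sum_add_distrib]
        · refine Finset.sum_congr rfl fun q _ => ?_
          split_ifs <;> omega
        · refine Finset.sum_le_sum fun q _ => ?_
          split_ifs <;> omega
      · rw [Nat.sub_eq_zero_of_le]
        · refine (Finset.sum_eq_zero fun q _ => if_neg (by omega)).symm
        · refine Finset.sum_le_sum fun q _ => ?_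
          split_ifs <;> omega
    simp only [this]
    rfl

end RangeSum

/-! ### Parallel computation by range sums -/

/-- The parameters of the simulation of range-sum steps: `M` machines with `8 * L` slots, base `B`,
keys and contents less than `Q ^ c`, all numbers less than `W`. -/
structure RangeModel where
  M : ℕ
  B : ℕ
  L : ℕ
  lev : ℕ
  D : ℕ
  Q : ℕ
  c : ℕ
  W : ℕ
  hB : 0 < B
  hlev : M ≤ B ^ lev
  hD : 2 * Q ^ c + 2 ≤ B ^ D
  hW : (M * L + 1) * (3 * Q ^ c + 3) + Q ^ c ≤ W
  hQ : M * L < Q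
  hQ2 : 2 ≤ Q
  hc : 2 ≤ c

/-- `X` embeds into the numbers less than `Z`. -/
def Fits (Z : ℕ) (X : Type*) : Prop := ∃ e : X → ℕ, Function.Injective e ∧ ∀ x, e x < Z

theorem fits_iff {Z : ℕ} {X : Type*} : Fits Z X ↔ Nonempty (X ↪ Fin Z) :=
  ⟨fun ⟨e, he, h⟩ => ⟨⟨fun x => ⟨e x, h x⟩, fun _ _ hxy => he (by simpa using hxy)⟩⟩,
    fun ⟨f⟩ => ⟨fun x => f x, fun _ _ h => f.injective (Fin.ext h), fun x => (f x).2⟩⟩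

theorem Fits.mono {Z Z' : ℕ} {X : Type*} (h : Fits Z X) (hZ : Z ≤ Z') : Fits Z' X :=
  let ⟨e, he, hb⟩ := h
  ⟨e, he, fun x => (hb x).trans_le hZ⟩

theorem Fits.fin (n : ℕ) : Fits n (Fin n) := fits_iff.2 ⟨Function.Embedding.refl _⟩

theorem Fits.prod {Z Z' : ℕ} {X Y : Type*} (h : Fits Z X) (h' : Fits Z' Y) :
    Fits (Z * Z') (X × Y) := by
  obtain ⟨e⟩ := fits_iff.1 h
  obtain ⟨e'⟩ := fits_iff.1 h'
  exact fits_iff.2 ⟨(e.prodMap e').trans finProdFinEquiv.toEmbedding⟩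

theorem Fits.option {Z : ℕ} {X : Type*} (h : Fits Z X) : Fits (Z + 1) (Option X) := by
  obtain ⟨e⟩ := fits_iff.1 h
  exact fits_iff.2 ⟨e.optionMap.trans (finSuccEquiv Z).symm.toEmbedding⟩

theorem Fits.pi {Z : ℕ} {X : Type*} (h : Fits Z X) (k : ℕ) : Fits (Z ^ k) (Fin k → X) := by
  obtain ⟨e⟩ := fits_iff.1 h
  exact fits_iff.2 ⟨⟨fun f => finFunctionFinEquiv (e ∘ f), fun f g hfg => by
    have := finFunctionFinEquiv.injective hfg
    exact e.injective.comp_left this⟩⟩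

/-- Exponents of types that fit into powers of `Q`. -/
theorem Fits.prod_pow {Q a b : ℕ} {X Y : Type*} (h : Fits (Q ^ a) X) (h' : Fits (Q ^ b) Y) :
    Fits (Q ^ (a + b)) (X × Y) := by
  rw [pow_add]
  exact h.prod h'

theorem Fits.option_pow {Q a : ℕ} {X : Type*} (hQ : 2 ≤ Q) (h : Fits (Q ^ a) X) :
    Fits (Q ^ (a + 1)) (Option X) := by
  refine h.option.mono ?_
  have : 0 < Q ^ a := by positivity
  rw [pow_succ]
  nlinarith

theorem Fits.pi_pow {Q a : ℕ} {X : Type*} (h : Fits (Q ^ a) X) (k : ℕ) :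
    Fits (Q ^ (a * k)) (Fin k → X) := by
  rw [pow_mul]
  exact h.pi k

theorem Fits.fin_pow {Q n : ℕ} (h : n ≤ Q) : Fits (Q ^ 1) (Fin n) :=
  (Fits.fin n).mono (by simpa using h)

namespace RangeModel

variable (m : RangeModel) {X Y Y' : Type}

/-- The number of processors. -/
abbrev N : ℕ := m.M * m.L

/-- The bound on keys, values and contents. -/
abbrev K : ℕ := m.Q ^ m.c

/-- The number of rounds of a range-sum step. -/
def stepRounds : ℕ := (m.D + 1) * (m.lev + 2) + 2

theorem Q_pos : 0 < m.Q := by have := m.hQ; omega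

theorem sq_le_K : m.Q * m.Q ≤ m.K := by
  rw [← sq]
  exact Nat.pow_le_pow_right m.Q_pos m.hc

theorem Q_le_K : m.Q ≤ m.K :=
  (Nat.le_mul_of_pos_left _ m.Q_pos).trans m.sq_le_K

/-- A number modulo `Q`. -/
def clip (v : ℕ) : Fin m.Q := ⟨v % m.Q, Nat.mod_lt _ m.Q_pos⟩

theorem clip_val {v : ℕ} (h : v < m.Q) : (m.clip v : ℕ) = v := Nat.mod_eq_of_lt h

/-- The map `F` on the contents of all processors can be computed by `r` range-sum steps. -/
def Computes (r : ℕ) (F : (Fin m.N → X) → Fin m.N → Y) : Prop :=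
  ∀ (e : X → ℕ) (e' : Y → ℕ), Function.Injective e → Function.Injective e' → (∀ x, e x < m.K) →
    (∀ y, e' y < m.K) → ∃ prog : List (Push m.M (RSlot m.B m.L)),
      prog.length = r * m.stepRounds ∧
      ∀ x, Exec m.W prog (rangeConf m.B (e ∘ x)) (rangeConf m.B (e' ∘ F x))

variable {m}

/-- Since `Computes` admits every encoding of source and target, two programs can be joined along
any encoding of the middle type; `Fits` supplies one. -/
theorem Computes.comp {r s : ℕ} {F : (Fin m.N → X) → Fin m.N → Y} {G : (Fin m.N → Y) → Fin m.N → Y'}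
    (hG : m.Computes s G) (hF : m.Computes r F) (hY : Fits m.K Y) :
    m.Computes (r + s) (fun x => G (F x)) := by
  intro e e'' he he'' hb hb''
  obtain ⟨e', he', hb'⟩ := hY
  obtain ⟨p, hp, hp'⟩ := hF e e' he he' hb hb'
  obtain ⟨q, hq, hq'⟩ := hG e' e'' he' he'' hb' hb''
  exact ⟨p ++ q, by rw [List.length_append, hp, hq, add_mul], fun x => (hp' x).append (hq' _)⟩

/-- The processors hold codes; decoding by `Function.invFun` and encoding again are part of the free
local computation. -/
theorem Computes.rangeSum [Nonempty X] (key val lo hi : Fin m.N → X → ℕ)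
    (hkey : ∀ p x, key p x ≤ m.K) (hval : ∀ p x, val p x ≤ m.K) (hlo : ∀ p x, lo p x ≤ m.K)
    (hhi : ∀ p x, hi p x ≤ m.K) (upd : Fin m.N → X → ℕ → Y) :
    m.Computes 1 (fun x p => upd p (x p) (∑ q, if lo p (x p) ≤ key q (x q) ∧
      key q (x q) < hi p (x p) then val q (x q) else 0)) := by
  intro e e' he he' hb hb'
  set d := Function.invFun e with hd
  have hde : ∀ x, d (e x) = x := Function.leftInverse_invFun he
  refine ⟨rangeProg m.hB m.lev m.D ⟨fun p n => key p (d n), fun p n => val p (d n),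
    fun p n => lo p (d n), fun p n => hi p (d n)⟩ (fun p n a => e' (upd p (d n) a)), ?_, ?_⟩
  · rw [length_rangeProg, one_mul, stepRounds]
  · intro x
    have := rangeProg_exec m.hB m.hlev m.hD m.hW ⟨fun p n => key p (d n), fun p n => val p (d n),
      fun p n => lo p (d n), fun p n => hi p (d n)⟩ (fun p n a => e' (upd p (d n) a))
      (fun _ _ _ => hb' _) (e ∘ x) (fun _ => hb _) (fun _ => hkey _ _) (fun _ => hval _ _)
      (fun _ => hlo _ _) (fun _ => hhi _ _)
    simp only [Function.comp, hde] at this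
    exact this

theorem Computes.map [Nonempty X] (g : Fin m.N → X → Y) :
    m.Computes 1 (fun x p => g p (x p)) :=
  Computes.rangeSum (fun _ _ => 0) (fun _ _ => 0) (fun _ _ => 0) (fun _ _ => 0) (by simp) (by simp)
    (by simp) (by simp) (fun p x _ => g p x)

/-- Sums over the values at one key. -/
theorem Computes.lookup [Nonempty X] (key val at' : Fin m.N → X → ℕ)
    (hkey : ∀ p x, key p x ≤ m.K) (hval : ∀ p x, val p x ≤ m.K) (hat : ∀ p x, at' p x < m.K)
    (upd : Fin m.N → X → ℕ → Y) :
    m.Computes 1 (fun x p => upd p (x p) (∑ q, if key q (x q) = at' p (x p)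
      then val q (x q) else 0)) := by
  have := Computes.rangeSum (m := m) key val at' (fun p x => at' p x + 1) hkey hval
    (fun p x => (hat p x).le) (fun p x => hat p x) upd
  have e : (fun (x : Fin m.N → X) p => upd p (x p) (∑ q, if key q (x q) = at' p (x p)
      then val q (x q) else 0)) = fun x p => upd p (x p) (∑ q, if at' p (x p) ≤ key q (x q) ∧
      key q (x q) < at' p (x p) + 1 then val q (x q) else 0) := by
    funext x p
    congr 1
    exact Finset.sum_congr rfl fun q _ => if_congr (by omega) rfl rfl
  rw [e]
  exact this

/-- The additional step covers `T = 0`: even the identity has to translate between two arbitrary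
encodings. -/
theorem Computes.iterate {F : ℕ → (Fin m.N → X) → Fin m.N → X} {r : ℕ} (hX : Fits m.K X)
    (hF : ∀ t, m.Computes r (F t)) (T : ℕ) [Nonempty X] :
    m.Computes (1 + T * r) (fun x => Nat.rec x (fun t y => F t y) T) := by
  induction T with
  | zero => simpa using Computes.map (m := m) fun (_ : Fin m.N) (x : X) => x
  | succ T ih =>
    have := (hF T).comp ih hX
    rwa [show 1 + T * r + r = 1 + (T + 1) * r by ring] at this

end RangeModel

/-! ### Distribution of copies to consecutive processors -/

section Expand

theorem sum_range_sum_range_offset (r G : ℕ → ℕ) (n : ℕ) :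
    ∑ p ∈ Finset.range n, ∑ c ∈ Finset.range (r p), G (∑ q ∈ Finset.range p, r q + c) =
      ∑ y ∈ Finset.range (∑ p ∈ Finset.range n, r p), G y := by
  induction n with
  | zero => simp
  | succ n ih => rw [Finset.sum_range_succ, ih, Finset.sum_range_succ _ n, Finset.sum_range_add]

/-- The first processor for the copies of the content of `p`. -/
def offset {N : ℕ} (r : Fin N → ℕ) (p : Fin N) : ℕ := ∑ q, if q < p then r q else 0

theorem offset_add_le {N : ℕ} (r : Fin N → ℕ) {p q : Fin N} (h : p < q) :
    offset r p + r p ≤ offset r q := by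
  have : offset r p + r p = ∑ s, if s ≤ p then r s else 0 := by
    rw [offset, ← Fintype.sum_ite_eq' p r, ← Finset.sum_add_distrib]
    refine Finset.sum_congr rfl fun s _ => ?_
    rcases lt_trichotomy s p with h | h | h
    · simp [h, h.ne, h.le]
    · simp [h]
    · simp [h.not_gt, h.ne', h.not_ge]
  rw [this]
  refine Finset.sum_le_sum fun s _ => ?_
  split_ifs with h1 h2
  · exact le_rfl
  · exact absurd (lt_of_le_of_lt h1 h) h2
  · exact Nat.zero_le _
  · exact le_rfl

theorem offset_add_le_sum {N : ℕ} (r : Fin N → ℕ) (p : Fin N) :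
    offset r p + r p ≤ ∑ q, r q := by
  rw [offset, ← Fintype.sum_ite_eq' p r, ← Finset.sum_add_distrib]
  refine Finset.sum_le_sum fun s _ => ?_
  rcases lt_trichotomy s p with h | h | h
  · simp [h, h.ne]
  · simp [h]
  · simp [h.not_gt, h.ne']

/-- The blocks of length `r p` that start at `offset r p` tile an initial segment of the numbers. -/
theorem sum_offset {N : ℕ} (r : Fin N → ℕ) (G : ℕ → ℕ) :
    ∑ p, ∑ c ∈ Finset.range (r p), G (offset r p + c) =
      ∑ y ∈ Finset.range (∑ p, r p), G y := by
  set r' : ℕ → ℕ := fun p => if h : p < N then r ⟨p, h⟩ else 0 with hr'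
  have h1 : ∀ p : Fin N, r' p = r p := fun p => by simp [hr']
  have h2 : ∑ p, r p = ∑ p ∈ Finset.range N, r' p := by
    rw [Finset.sum_range]
    simp [h1]
  have h3 : ∀ p : Fin N, offset r p = ∑ q ∈ Finset.range p, r' q := by
    intro p
    have : ∑ q ∈ Finset.range p, r' q =
        ∑ q ∈ Finset.range N, if q < (p : ℕ) then r' q else 0 := by
      rw [← Finset.sum_filter]
      refine Finset.sum_congr ?_ fun _ _ => rfl
      ext q
      have := p.2
      simp only [Finset.mem_range, Finset.mem_filter]
      omega
    rw [this, Finset.sum_range, offset]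
    exact Finset.sum_congr rfl fun q _ => by rw [h1]; rfl
  rw [h2, ← sum_range_sum_range_offset, Finset.sum_range]
  simp [h1, h3]

namespace RangeModel

variable {m : RangeModel} {X Y : Type}

/-- Every processor `p` with content `x` makes `r x` copies of it, and every copy, together with
its number, is assigned to a processor of its own. -/
theorem Computes.expand [Nonempty X] (r : X → ℕ) (hr : ∀ x, r x ≤ m.N)
    {a : ℕ} (hX : Fits (m.Q ^ a) X) (hc : a + 2 ≤ m.c) :
    ∃ F : (Fin m.N → X) → Fin m.N → X × Option (X × Fin m.Q),
      m.Computes 3 F ∧ (∀ x p, (F x p).1 = x p) ∧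
      ∀ x, ∑ p, r (x p) ≤ m.N → ∀ g : X → ℕ → ℕ,
        (∑ y, (F x y).2.elim 0 fun z => g z.1 z.2) =
          ∑ p, ∑ c ∈ Finset.range (r (x p)), g (x p) c := by
  have hNQ : m.N < m.Q := m.hQ
  have hQK := m.Q_le_K
  have hQQ : m.Q + m.Q ≤ m.K := by
    have := m.sq_le_K
    have := m.hQ2
    nlinarith
  have hX1 : Fits m.K (X × Fin m.Q) := (hX.prod_pow (Fits.fin_pow le_rfl)).mono
    (Nat.pow_le_pow_right m.Q_pos (by omega))
  have hX2 : Fits m.K (X × Fin m.Q × Fin m.Q) :=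
    (hX.prod_pow ((Fits.fin_pow le_rfl).prod_pow (Fits.fin_pow le_rfl))).mono
    (Nat.pow_le_pow_right m.Q_pos (by omega))
  obtain ⟨e, he, hb⟩ := hX.mono (Nat.pow_le_pow_right m.Q_pos (show a ≤ m.c by omega))
  have hrK : ∀ x, r x ≤ m.K := fun x => (hr x).trans (hNQ.le.trans hQK)
  have : Nonempty (Fin m.Q) := ⟨⟨0, m.Q_pos⟩⟩
  -- The sum of `r` over the smaller indices: the start of the block of processors reserved for `p`.
  have s1 := Computes.rangeSum (m := m) (X := X) (fun q _ => q) (fun _ x => r x) (fun _ _ => 0)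
    (fun p _ => p) (fun p _ => (p.2.le.trans hNQ.le).trans hQK) (fun _ => hrK) (by simp)
    (fun p _ => (p.2.le.trans hNQ.le).trans hQK) (fun _ x v => (x, m.clip v))
  -- Processor `y` sums `r` over all blocks that start at or before `y`. This is the end of the
  -- block that contains `y`, or a number at most `y` if there is none.
  have s2 := Computes.rangeSum (m := m) (X := X × Fin m.Q) (fun _ x => x.2) (fun _ x => r x.1)
    (fun _ _ => 0) (fun p _ => p + 1) (fun _ x => x.2.2.le.trans hQK) (fun _ _ => hrK _) (by simp)
    (fun p _ => (Nat.succ_le_of_lt p.2).trans (hNQ.le.trans hQK))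
    (fun _ x v => (x.1, x.2, m.clip v))
  -- The end of a block identifies its owner once empty blocks, which may end at the same place, are
  -- given the value 0. The answer is then the code of the owner's content, and the number of the
  -- copy follows from the distance to the end.
  have s3 := Computes.lookup (m := m) (X := X × Fin m.Q × Fin m.Q) (fun _ x => x.2.1 + r x.1)
    (fun _ x => if 0 < r x.1 then e x.1 else 0) (fun _ x => x.2.2)
    (fun _ x => by have := hr x.1; have := x.2.1.2; omega)
    (fun _ x => by
      split_ifs
      · exact (hb _).le
      · exact Nat.zero_le _)
    (fun _ x => x.2.2.2.trans_le hQK)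
    (fun y x v => (x.1, if (y : ℕ) < x.2.2 then
      some (Function.invFun e v, m.clip (y + r (Function.invFun e v) - x.2.2)) else none))
  have s4 := s3.comp (s2.comp s1 hX1) hX2
  refine ⟨_, s4, fun x p => rfl, ?_⟩
  intro x hsum g
  set R : Fin m.N → ℕ := fun p => r (x p) with hR
  replace hsum : ∑ p, R p ≤ m.N := hsum
  have ho : ∀ p : Fin m.N, (∑ q : Fin m.N, if 0 ≤ (q : ℕ) ∧ (q : ℕ) < p then r (x q) else 0) =
      offset R p := by
    intro p
    rw [offset]
    exact Finset.sum_congr rfl fun q _ => if_congr (by rw [Fin.lt_def]; omega) rfl rfl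
  have hclipo : ∀ p, (m.clip (offset R p) : ℕ) = offset R p := fun p => by
    have := offset_add_le_sum R p
    exact m.clip_val (by omega)
  simp only [ho, hclipo]
  have hend : ∀ y, (∑ q : Fin m.N, if 0 ≤ offset R q ∧ offset R q < y + 1 then r (x q) else 0) ≤
      ∑ p, R p := fun y => Finset.sum_le_sum fun q _ => by split_ifs <;> simp [hR]
  have hclipe : ∀ y, (m.clip (∑ q : Fin m.N, if 0 ≤ offset R q ∧ offset R q < y + 1 then r (x q)
      else 0) : ℕ) = ∑ q : Fin m.N, if 0 ≤ offset R q ∧ offset R q < y + 1 then r (x q) else 0 :=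
    fun y => m.clip_val (by have := hend y; omega)
  simp only [hclipe]
  have hin : ∀ p y, offset R p ≤ y → y < offset R p + R p →
      (∑ q : Fin m.N, if 0 ≤ offset R q ∧ offset R q < y + 1 then r (x q) else 0) =
        offset R p + R p := by
    intro p y h1 h2
    rw [offset, ← Fintype.sum_ite_eq' p R, ← Finset.sum_add_distrib]
    refine Finset.sum_congr rfl fun q _ => ?_
    rcases lt_trichotomy q p with h | h | h
    · have := offset_add_le R h
      rw [if_pos (by omega), if_pos h, if_neg h.ne]
      rfl
    · subst h
      rw [if_pos (by omega), if_neg (lt_irrefl _), if_pos rfl]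
      simp [hR]
    · have := offset_add_le R h
      rw [if_neg (by omega), if_neg h.not_gt, if_neg h.ne', add_zero]
  have hans : ∀ p y, offset R p ≤ y → y < offset R p + R p →
      (∑ q : Fin m.N, if offset R q + r (x q) = (∑ q : Fin m.N, if 0 ≤ offset R q ∧
        offset R q < y + 1 then r (x q) else 0) then (if 0 < r (x q) then e (x q) else 0) else 0) =
        e (x p) := by
    intro p y h1 h2
    rw [hin p y h1 h2, Finset.sum_eq_single p]
    · rw [if_pos rfl, if_pos (show 0 < R p by omega)]
    · intro q _ hq
      by_cases h0 : 0 < r (x q)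
      · rw [if_neg]
        change offset R q + R q ≠ _
        have h0' : 0 < R q := h0
        rcases lt_or_gt_of_ne hq with h | h
        · have := offset_add_le R h
          omega
        · have := offset_add_le R h
          omega
      · rw [if_neg h0, ite_self]
    · simp
  set G : ℕ → ℕ := fun y => (if y < (∑ q : Fin m.N, if 0 ≤ offset R q ∧ offset R q < y + 1 then
      r (x q) else 0) then some (Function.invFun e (∑ q : Fin m.N, if offset R q + r (x q) =
        (∑ q : Fin m.N, if 0 ≤ offset R q ∧
        offset R q < y + 1 then r (x q) else 0) then (if 0 < r (x q) then e (x q) else 0) else 0),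
        m.clip (y + r (Function.invFun e (∑ q : Fin m.N, if offset R q + r (x q) =
        (∑ q : Fin m.N, if 0 ≤ offset R q ∧
        offset R q < y + 1 then r (x q) else 0) then (if 0 < r (x q) then e (x q) else 0) else 0)) -
        (∑ q : Fin m.N, if 0 ≤ offset R q ∧
        offset R q < y + 1 then r (x q) else 0))) else none).elim 0 fun z => g z.1 z.2 with hG
  change ∑ y : Fin m.N, G y = _
  rw [← Finset.sum_range]
  have hG0 : ∀ y, ∑ p, R p ≤ y → G y = 0 := by
    intro y hy
    rw [hG]
    dsimp only
    rw [if_neg (by have := hend y; omega)]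
    rfl
  have hG1 : ∀ p c, c < R p → G (offset R p + c) = g (x p) c := by
    intro p c hcR
    have h1 : offset R p ≤ offset R p + c := by omega
    have h2 : offset R p + c < offset R p + R p := by omega
    rw [hG]
    dsimp only
    rw [hans p _ h1 h2, hin p _ h1 h2, if_pos h2, Function.leftInverse_invFun he]
    simp only [Option.elim_some]
    rw [m.clip_val]
    · congr 1
      change offset R p + c + R p - _ = _
      omega
    · change offset R p + c + R p - _ < _
      have := offset_add_le_sum R p
      omega
  have hsum' : ∑ y ∈ Finset.range m.N, G y = ∑ y ∈ Finset.range (∑ p, R p), G y := by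
    refine (Finset.sum_subset (Finset.range_subset_range.2 hsum) fun y _ hy => hG0 y ?_).symm
    simpa using hy
  rw [hsum', ← sum_offset R G]
  exact Finset.sum_congr rfl fun p _ => Finset.sum_congr rfl fun c hc' =>
    hG1 p c (Finset.mem_range.1 hc')

end RangeModel

end Expand

/-! ### Arc lists, peeling and orientation by range sums -/

section ArcList

variable {N n : ℕ}

/-- The processors hold the pairs of the relation `R`, each pair exactly once. -/
def ListsArcs (f : Fin N → Option (Fin n × Fin n)) (R : Fin n → Fin n → Prop) [DecidableRel R] :
    Prop :=
  ∀ g : Fin n → Fin n → ℕ, ∑ p, (f p).elim 0 (fun a => g a.1 a.2) =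
    ∑ u, ∑ v, if R u v then g u v else 0

variable {f : Fin N → Option (Fin n × Fin n)} {R : Fin n → Fin n → Prop} [DecidableRel R]

/-- Testing with the indicator of the complement of `R` gives the sum 0. -/
theorem ListsArcs.rel (h : ListsArcs f R) {p : Fin N} {a : Fin n × Fin n} (hp : f p = some a) :
    R a.1 a.2 := by
  by_contra hR
  have h1 := h fun u v => if R u v then 0 else 1
  have h2 : (∑ u, ∑ v, if R u v then (if R u v then 0 else 1) else 0) = 0 :=
    Finset.sum_eq_zero fun u _ => Finset.sum_eq_zero fun v _ => by split_ifs <;> rfl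
  rw [h2] at h1
  have := (Finset.sum_eq_zero_iff.1 h1) p (Finset.mem_univ _)
  simp [hp, hR] at this

theorem ListsArcs.filter (h : ListsArcs f R) (P : Fin n → Fin n → Prop) [DecidableRel P] :
    ListsArcs (fun p => (f p).bind fun a => if P a.1 a.2 then some a else none)
      (fun u v => R u v ∧ P u v) := by
  intro g
  have := h fun u v => if P u v then g u v else 0
  simp only [ite_and]
  rw [← this]
  refine Finset.sum_congr rfl fun p _ => ?_
  cases f p with
  | none => rfl
  | some a =>
    simp only [Option.bind_some, Option.elim_some]
    split_ifs <;> rfl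

theorem ListsArcs.sum_out (h : ListsArcs f R) (u : Fin n) (P : Fin n → Prop) [DecidablePred P] :
    ∑ p, (f p).elim 0 (fun a => if a.1 = u ∧ P a.2 then 1 else 0) =
      (Finset.univ.filter fun v => R u v ∧ P v).card := by
  have h1 := h fun a v => if a = u ∧ P v then 1 else 0
  rw [h1, Finset.card_filter, Finset.sum_eq_single u]
  · refine Finset.sum_congr rfl fun v _ => ?_
    simp [ite_and]
  · intro w _ hw
    simp [hw]
  · simp

theorem card_filter_fin_le (P : Fin n → Prop) [DecidablePred P] :
    (Finset.univ.filter P).card ≤ n := by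
  simpa using Finset.card_filter_le Finset.univ P

theorem lookup_option {A : Type*} (x : Fin N → Option A) (k val : A → ℕ) (a : ℕ) :
    (∑ q, if (x q).elim 0 k = a then (x q).elim 0 val else 0) =
      ∑ q, (x q).elim 0 fun b => if k b = a then val b else 0 := by
  refine Finset.sum_congr rfl fun q _ => ?_
  rcases x q with _ | b
  · split_ifs <;> rfl
  · rfl

end ArcList

/-! ### Peeling by range sums and the resulting orientation -/

section Peel

variable {n : ℕ}

/-- The stamps of the vertices after `t` phases of peeling: a vertex gets past phase `t` if it
reached it and has more than `thr t` neighbors that reached it. -/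
def peelStamp (R : Fin n → Fin n → Prop) [DecidableRel R] (thr : ℕ → ℕ) : ℕ → Fin n → ℕ
  | 0, _ => 0
  | t + 1, v => if peelStamp R thr t v = t ∧
      thr t < (Finset.univ.filter fun w => R v w ∧ peelStamp R thr t w = t).card
      then t + 1 else peelStamp R thr t v

variable {R : Fin n → Fin n → Prop} [DecidableRel R] {thr : ℕ → ℕ}

theorem peelStamp_le (t : ℕ) (v : Fin n) : peelStamp R thr t v ≤ t := by
  induction t with
  | zero => exact le_rfl
  | succ t ih =>
    rw [peelStamp]
    split_ifs
    · exact le_rfl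
    · omega

namespace RangeModel

variable (m : RangeModel)

/-- The contents of the processors after some phases of peeling. -/
def stamped (f : Fin m.N → Option (Fin n × Fin n)) (σ : Fin n → ℕ) (p : Fin m.N) :
    Option ((Fin n × Fin n) × Fin m.Q × Fin m.Q) :=
  (f p).map fun a => (a, m.clip (σ a.1), m.clip (σ a.2))

variable {m}

/-- Each arc carries the stamps of both its ends. Two lookups by tail give the numbers of alive
neighbors of the one and the other end, after which every copy of a stamp is updated locally and by
the same rule. -/
theorem Computes.peelPhase (hn : n < m.Q) (hc : 6 ≤ m.c) (thr : ℕ → ℕ) (t : ℕ) :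
    ∃ F : (Fin m.N → Option ((Fin n × Fin n) × Fin m.Q × Fin m.Q)) →
        Fin m.N → Option ((Fin n × Fin n) × Fin m.Q × Fin m.Q),
      m.Computes 2 F ∧ ∀ (R : Fin n → Fin n → Prop) [DecidableRel R]
        (f : Fin m.N → Option (Fin n × Fin n)), ListsArcs f R → t + 1 < m.Q →
        F (m.stamped f (peelStamp R thr t)) = m.stamped f (peelStamp R thr (t + 1)) := by
  have hK := m.Q_le_K
  have hX1 : Fits m.K (Option ((Fin n × Fin n) × Fin m.Q × Fin m.Q) × Fin m.Q) :=
    ((((Fits.fin_pow hn.le).prod_pow (Fits.fin_pow hn.le)).prod_pow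
      ((Fits.fin_pow le_rfl).prod_pow (Fits.fin_pow le_rfl))).option_pow m.hQ2).prod_pow
      (Fits.fin_pow le_rfl) |>.mono (Nat.pow_le_pow_right m.Q_pos hc)
  have : Nonempty (Fin m.Q) := ⟨⟨0, m.Q_pos⟩⟩
  have hval : ∀ a : (Fin n × Fin n) × Fin m.Q × Fin m.Q,
      (if (a.2.1 : ℕ) = t ∧ (a.2.2 : ℕ) = t then 1 else 0) ≤ m.K := by
    intro a
    have := m.Q_pos
    split_ifs <;> omega
  have s1 := Computes.lookup (m := m) (X := Option ((Fin n × Fin n) × Fin m.Q × Fin m.Q))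
    (fun _ x => x.elim 0 fun a => a.1.1)
    (fun _ x => x.elim 0 fun a => if (a.2.1 : ℕ) = t ∧ (a.2.2 : ℕ) = t then 1 else 0)
    (fun _ x => x.elim 0 fun a => a.1.1)
    (fun _ x => by cases x with
      | none => exact Nat.zero_le _
      | some a => exact a.1.1.2.le.trans (hn.le.trans hK))
    (fun _ x => by cases x with
      | none => exact Nat.zero_le _
      | some a => exact hval a)
    (fun _ x => by cases x with
      | none => exact m.Q_pos.trans_le hK
      | some a => exact a.1.1.2.trans (hn.trans_le hK))
    (fun _ x v => (x, m.clip v))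
  have s2 := Computes.lookup (m := m) (X := Option ((Fin n × Fin n) × Fin m.Q × Fin m.Q) × Fin m.Q)
    (fun _ x => x.1.elim 0 fun a => a.1.1)
    (fun _ x => x.1.elim 0 fun a => if (a.2.1 : ℕ) = t ∧ (a.2.2 : ℕ) = t then 1 else 0)
    (fun _ x => x.1.elim 0 fun a => a.1.2)
    (fun _ x => by cases x.1 with
      | none => exact Nat.zero_le _
      | some a => exact a.1.1.2.le.trans (hn.le.trans hK))
    (fun _ x => by cases x.1 with
      | none => exact Nat.zero_le _
      | some a => exact hval a)
    (fun _ x => by cases x.1 with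
      | none => exact m.Q_pos.trans_le hK
      | some a => exact a.1.2.2.trans (hn.trans_le hK))
    (fun _ x v => x.1.map fun a => (a.1,
      if (a.2.1 : ℕ) = t ∧ thr t < x.2 then m.clip (t + 1) else a.2.1,
      if (a.2.2 : ℕ) = t ∧ thr t < v then m.clip (t + 1) else a.2.2))
  refine ⟨_, s2.comp s1 hX1, ?_⟩
  intro R _ f hf ht
  set σ := peelStamp R thr t with hσ
  have hclip : ∀ v, (m.clip (σ v) : ℕ) = σ v := fun v => m.clip_val (by
    have : σ v ≤ t := peelStamp_le t v
    omega)
  have hdeg : ∀ u : Fin n, (∑ q, if (m.stamped f σ q).elim 0 (fun a => (a.1.1 : ℕ)) = (u : ℕ) then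
      (m.stamped f σ q).elim 0 (fun a => if (a.2.1 : ℕ) = t ∧ (a.2.2 : ℕ) = t then 1 else 0)
      else 0) = if σ u = t then (Finset.univ.filter fun w => R u w ∧ σ w = t).card else 0 := by
    intro u
    rw [lookup_option]
    split_ifs with hu
    · rw [← hf.sum_out u fun w => σ w = t]
      refine Finset.sum_congr rfl fun q _ => ?_
      rw [stamped]
      cases f q with
      | none => rfl
      | some a =>
        simp only [Option.map_some, Option.elim_some, hclip, ← Fin.ext_iff, ← ite_and]
        refine if_congr ⟨fun h => ⟨h.1, h.2.2⟩, fun h => ⟨h.1, ?_, h.2⟩⟩ rfl rfl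
        rw [h.1, hu]
    · refine Finset.sum_eq_zero fun q _ => ?_
      rw [stamped]
      cases f q with
      | none => rfl
      | some a =>
        simp only [Option.map_some, Option.elim_some, hclip, ← Fin.ext_iff, ← ite_and]
        refine if_neg fun h => hu ?_
        rw [← h.1, h.2.1]
  funext p
  dsimp only
  cases hp : f p with
  | none => simp [stamped, hp]
  | some a =>
    have e1 : m.stamped f σ p = some (a, m.clip (σ a.1), m.clip (σ a.2)) := by
      simp [stamped, hp]
    have hb : ∀ u : Fin n, (if σ u = t then (Finset.univ.filter fun w => R u w ∧ σ w = t).card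
        else 0) < m.Q := by
      intro u
      split_ifs
      · exact (card_filter_fin_le _).trans_lt hn
      · exact m.Q_pos
    have e2 : ∀ u : Fin n, (if (m.clip (σ u) : ℕ) = t ∧ thr t < (if σ u = t then
        (Finset.univ.filter fun w => R u w ∧ σ w = t).card else 0) then m.clip (t + 1)
        else m.clip (σ u)) = m.clip (peelStamp R thr (t + 1) u) := by
      intro u
      rw [hclip, peelStamp, ← hσ]
      by_cases hu : σ u = t
      · simp only [hu, if_true, true_and]
        split_ifs <;> rfl
      · simp [hu]
    have h1 := hdeg a.1
    have h2 := hdeg a.2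
    simp only [e1, Option.elim_some, Option.map_some] at h1 h2 ⊢
    rw [h1, h2, m.clip_val (hb _), e2, e2]
    simp [stamped, hp]

theorem Computes.peel (hn : n < m.Q) (hc : 6 ≤ m.c) (thr : ℕ → ℕ) (T : ℕ) (hT : T < m.Q) :
    ∃ F : (Fin m.N → Option (Fin n × Fin n)) →
        Fin m.N → Option ((Fin n × Fin n) × Fin m.Q × Fin m.Q),
      m.Computes (2 + 2 * T) F ∧ ∀ (R : Fin n → Fin n → Prop) [DecidableRel R]
        (f : Fin m.N → Option (Fin n × Fin n)), ListsArcs f R →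
        F f = m.stamped f (peelStamp R thr T) := by
  choose F hF hF' using fun t => Computes.peelPhase hn hc thr t
  have hX : Fits m.K (Option ((Fin n × Fin n) × Fin m.Q × Fin m.Q)) :=
    ((((Fits.fin_pow hn.le).prod_pow (Fits.fin_pow hn.le)).prod_pow
      ((Fits.fin_pow le_rfl).prod_pow (Fits.fin_pow le_rfl))).option_pow m.hQ2)
      |>.mono (Nat.pow_le_pow_right m.Q_pos (by omega))
  have h0 := Computes.map (m := m) fun _ (x : Option (Fin n × Fin n)) =>
    x.map fun a => (a, m.clip 0, m.clip 0)
  have h1 := (Computes.iterate hX hF T).comp h0 hX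
  rw [show 1 + (1 + T * 2) = 2 + 2 * T by ring] at h1
  refine ⟨_, h1, ?_⟩
  intro R _ f hf
  have key : ∀ t, t ≤ T → (Nat.rec (fun p => (f p).map fun a => (a, m.clip 0, m.clip 0))
      (fun t y => F t y) t : Fin m.N → Option ((Fin n × Fin n) × Fin m.Q × Fin m.Q)) =
      m.stamped f (peelStamp R thr t) := by
    intro t
    induction t with
    | zero => intro _; rfl
    | succ t ih =>
      intro ht
      rw [← hF' t R f hf (by omega), ← ih (by omega)]
  exact key T le_rfl

/-- The pairs of vertices that go up in the order of stamps. -/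
def StampLT (σ : Fin n → ℕ) (u v : Fin n) : Prop := σ u < σ v ∨ σ u = σ v ∧ u < v

instance (σ : Fin n → ℕ) : DecidableRel (StampLT σ) := fun _ _ => inferInstanceAs (Decidable (_ ∨ _))

/-- Peeling and orientation of the arcs. -/
theorem Computes.orient (hn : n < m.Q) (hc : 6 ≤ m.c) (thr : ℕ → ℕ) (T : ℕ) (hT : T < m.Q) :
    ∃ F : (Fin m.N → Option (Fin n × Fin n)) → Fin m.N → Option (Fin n × Fin n),
      m.Computes (3 + 2 * T) F ∧ ∀ (R : Fin n → Fin n → Prop) [DecidableRel R]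
        (f : Fin m.N → Option (Fin n × Fin n)), ListsArcs f R →
        ListsArcs (F f) fun u v => R u v ∧ StampLT (peelStamp R thr T) u v := by
  obtain ⟨F, hF, hF'⟩ := Computes.peel hn hc thr T hT
  have hX : Fits m.K (Option ((Fin n × Fin n) × Fin m.Q × Fin m.Q)) :=
    ((((Fits.fin_pow hn.le).prod_pow (Fits.fin_pow hn.le)).prod_pow
      ((Fits.fin_pow le_rfl).prod_pow (Fits.fin_pow le_rfl))).option_pow m.hQ2)
      |>.mono (Nat.pow_le_pow_right m.Q_pos (by omega))
  have h0 := Computes.map (m := m) fun _ (x : Option ((Fin n × Fin n) × Fin m.Q × Fin m.Q)) =>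
    x.bind fun a => if a.2.1 < a.2.2 ∨ a.2.1 = a.2.2 ∧ a.1.1 < a.1.2 then some a.1 else none
  have h1 := h0.comp hF hX
  rw [show 2 + 2 * T + 1 = 3 + 2 * T by ring] at h1
  refine ⟨_, h1, ?_⟩
  intro R _ f hf
  have h2 := hf.filter (StampLT (peelStamp R thr T))
  have hclip : ∀ v, (m.clip (peelStamp R thr T v) : ℕ) = peelStamp R thr T v :=
    fun v => m.clip_val ((peelStamp_le T v).trans_lt hT)
  convert h2 using 2 with p
  rw [hF' R f hf, stamped]
  cases f p with
  | none => rfl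
  | some a =>
    simp only [Option.map_some, Option.bind_some, StampLT, Fin.lt_def, Fin.ext_iff, hclip]

/-- The arcs, in both directions, of some edges. -/
def arcsOf (x : Fin 4 → Option (Fin n × Fin n)) : List (Fin n × Fin n) :=
  (List.finRange 4).flatMap fun b => (x b).elim [] fun a => [a, a.swap]

theorem sum_map_arcsOf (x : Fin 4 → Option (Fin n × Fin n)) (g : Fin n × Fin n → ℕ) :
    ((arcsOf x).map g).sum = ∑ b, (x b).elim 0 fun a => g a + g a.swap := by
  rw [arcsOf, List.flatMap, List.map_flatten, List.sum_flatten, List.map_map, List.map_map,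
    Fin.sum_univ_def]
  congr 1
  refine List.map_congr_left fun b _ => ?_
  simp only [Function.comp]
  cases x b <;> simp

theorem sum_range_getElem? {A : Type*} (l : List A) (g : A → ℕ) :
    ∑ c ∈ Finset.range l.length, (l[c]?).elim 0 g = (l.map g).sum := by
  induction l with
  | nil => simp
  | cons a l ih =>
    rw [List.length_cons, Finset.sum_range_succ']
    simp [ih, add_comm]

/-- Distribution of the edges of the input, as arcs in both directions. -/
theorem Computes.unpack (hn : n < m.Q) (hc : 26 ≤ m.c) :
    ∃ F : (Fin m.N → Fin 4 → Option (Fin n × Fin n)) → Fin m.N → Option (Fin n × Fin n),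
      m.Computes 4 F ∧ ∀ (R : Fin n → Fin n → Prop) [DecidableRel R]
        (x : Fin m.N → Fin 4 → Option (Fin n × Fin n)),
        (∀ g : Fin n → Fin n → ℕ,
          (∑ p, ∑ b, (x p b).elim 0 fun a => g a.1 a.2 + g a.2 a.1) =
            ∑ u, ∑ v, if R u v then g u v else 0) →
        (∑ u, ∑ v, if R u v then 1 else 0) ≤ m.N → ListsArcs (F x) R := by
  have hX : Fits (m.Q ^ 12) (Fin 4 → Option (Fin n × Fin n)) :=
    ((((Fits.fin_pow hn.le).prod_pow (Fits.fin_pow hn.le)).option_pow m.hQ2).pi_pow 4)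
  -- `Computes.expand` asks for a bound on the number of copies for every conceivable content, hence
  -- the cap by `m.N`. It is inactive on the lists that occur.
  obtain ⟨F, hF, -, hF'⟩ := Computes.expand (m := m) (X := Fin 4 → Option (Fin n × Fin n))
    (fun x => min (arcsOf x).length m.N) (fun x => min_le_right _ _) hX (by omega)
  -- The exponent is `12 + (12 + 1 + 1)`, which accounts for the bound 26 on `m.c`.
  have hX' : Fits m.K ((Fin 4 → Option (Fin n × Fin n)) ×
      Option ((Fin 4 → Option (Fin n × Fin n)) × Fin m.Q)) :=
    (hX.prod_pow ((hX.prod_pow (Fits.fin_pow le_rfl)).option_pow m.hQ2)).mono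
      (Nat.pow_le_pow_right m.Q_pos hc)
  have h0 := Computes.map (m := m) fun _ (x : (Fin 4 → Option (Fin n × Fin n)) ×
    Option ((Fin 4 → Option (Fin n × Fin n)) × Fin m.Q)) =>
    x.2.bind fun z => (arcsOf z.1)[(z.2 : ℕ)]?
  refine ⟨_, h0.comp hF hX', ?_⟩
  intro R _ x hx hN g
  have hlen : ∑ p, (arcsOf (x p)).length ≤ m.N := by
    refine le_trans (le_of_eq ?_) hN
    rw [← hx fun _ _ => 1]
    refine Finset.sum_congr rfl fun p _ => ?_
    rw [← sum_map_arcsOf (x p) fun _ => 1]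
    simp
  have hlen' : ∀ p, (arcsOf (x p)).length ≤ m.N := fun p =>
    (Finset.single_le_sum (f := fun p => (arcsOf (x p)).length) (by simp)
      (Finset.mem_univ p)).trans hlen
  have h1 := hF' x (by simpa only [min_eq_left (hlen' _)] using hlen)
    fun x c => ((arcsOf x)[c]?).elim 0 fun a => g a.1 a.2
  simp only [min_eq_left (hlen' _), sum_range_getElem?] at h1
  rw [← hx g]
  refine Eq.trans ?_ (h1.trans (Finset.sum_congr rfl fun p _ => ?_))
  · refine Finset.sum_congr rfl fun y _ => ?_
    dsimp only
    cases (F x y).2 <;> rfl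
  · rw [sum_map_arcsOf]
    rfl

end RangeModel

end Peel

/-! ### Counting chains of arcs by range sums -/

section ArcIndex

variable {N n : ℕ}

/-- The number of arcs out of a vertex. -/
def outDeg (R : Fin n → Fin n → Prop) [DecidableRel R] (u : Fin n) : ℕ :=
  (Finset.univ.filter fun v => R u v).card

/-- The number of earlier arcs with the same tail. -/
def arcIndex (f : Fin N → Option (Fin n × Fin n)) (p : Fin N) : ℕ :=
  (f p).elim 0 fun a => ∑ q, (f q).elim 0 fun b => if b.1 = a.1 ∧ q < p then 1 else 0

/-- The head of the arc number `i` out of `u`. -/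
def arcHead (f : Fin N → Option (Fin n × Fin n)) (u : Fin n) (i : ℕ) : ℕ :=
  ∑ q, (f q).elim 0 fun b => if b.1 = u ∧ arcIndex f q = i then (b.2 : ℕ) else 0

variable {f : Fin N → Option (Fin n × Fin n)} {R : Fin n → Fin n → Prop} [DecidableRel R]

theorem ListsArcs.card_eq_one (h : ListsArcs f R) {u v : Fin n} (huv : R u v) :
    (Finset.univ.filter fun p => f p = some (u, v)).card = 1 := by
  have h1 := h fun a b => if a = u ∧ b = v then 1 else 0
  have h2 : (∑ a, ∑ b, if R a b then (if a = u ∧ b = v then 1 else 0) else 0) = 1 := by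
    rw [Finset.sum_eq_single u]
    · rw [Finset.sum_eq_single v]
      · simp [huv]
      · intro b _ hb
        simp [hb]
      · simp
    · intro a _ ha
      simp [ha]
    · simp
  rw [h2] at h1
  rw [Finset.card_filter]
  refine Eq.trans ?_ h1
  refine Finset.sum_congr rfl fun p _ => ?_
  cases f p with
  | none => simp
  | some a => simp [Prod.ext_iff]

theorem ListsArcs.inj (h : ListsArcs f R) {p q : Fin N} {a : Fin n × Fin n} (hp : f p = some a)
    (hq : f q = some a) : p = q := by
  have := h.card_eq_one (h.rel hp)
  obtain ⟨x, hx⟩ := Finset.card_eq_one.1 this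
  have h1 : p ∈ ({x} : Finset (Fin N)) := by rw [← hx]; simp [hp]
  have h2 : q ∈ ({x} : Finset (Fin N)) := by rw [← hx]; simp [hq]
  rw [Finset.mem_singleton.1 h1, Finset.mem_singleton.1 h2]

theorem ListsArcs.exists_eq (h : ListsArcs f R) {u v : Fin n} (huv : R u v) :
    ∃ p, f p = some (u, v) := by
  have := h.card_eq_one huv
  obtain ⟨x, hx⟩ := Finset.card_pos.1 (by omega : 0 < (Finset.univ.filter fun p => f p = some (u, v)).card)
  exact ⟨x, by simpa using hx⟩

/-- The numbers of the arcs out of `u` enumerate the neighbors of `u`. -/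
theorem ListsArcs.exists_equiv (h : ListsArcs f R) (u : Fin n) :
    ∃ e : Fin (outDeg R u) ≃ {v // R u v}, ∀ i : Fin (outDeg R u), arcHead f u i = (e i).1 := by
  classical
  let S := {q : Fin N // ∃ v, f q = some (u, v)}
  have hS : ∀ q : S, f q.1 = some (u, q.2.choose) := fun q => q.2.choose_spec
  have hbij : Function.Bijective fun q : S => (⟨q.2.choose, h.rel (hS q)⟩ : {v // R u v}) := by
    constructor
    · intro p q hpq
      have h1 : p.2.choose = q.2.choose := by simpa using hpq
      exact Subtype.ext (h.inj (hS p) (by rw [h1]; exact hS q))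
    · rintro ⟨v, hv⟩
      obtain ⟨p, hp⟩ := h.exists_eq hv
      refine ⟨⟨p, v, hp⟩, ?_⟩
      have := hp.symm.trans (hS ⟨p, v, hp⟩)
      exact Subtype.ext (Prod.mk.inj (Option.some.inj this)).2.symm
  let e1 : S ≃ {v // R u v} := Equiv.ofBijective _ hbij
  have hcard : Fintype.card S = outDeg R u := by
    rw [Fintype.card_congr e1, Fintype.card_subtype]
    rfl
  -- The arcs out of `u` are ranked by the processors that hold them, and this rank is `arcIndex`.
  let e2 : S ≃ Fin (outDeg R u) := rankEquiv (fun q : S => q.1) Subtype.val_injective hcard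
  have hidx : ∀ q : S, arcIndex f q.1 = e2 q := by
    intro q
    rw [arcIndex, hS q, Option.elim_some, rankEquiv_val, rankOf]
    refine Eq.trans ?_ (Finset.sum_subtype (Finset.univ.filter fun p => ∃ v, f p = some (u, v))
      (by simp) fun p : Fin N => if p < q.1 then 1 else 0)
    rw [Finset.sum_filter]
    refine Finset.sum_congr rfl fun p _ => ?_
    cases hf : f p with
    | none => simp
    | some a =>
      have : (∃ v, some a = some (u, v)) ↔ a.1 = u := by
        simp only [Option.some.injEq, Prod.ext_iff]
        exact ⟨fun ⟨v, h1, _⟩ => h1, fun h1 => ⟨a.2, h1, rfl⟩⟩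
      simp only [Option.elim_some, this, ite_and]
  refine ⟨e2.symm.trans e1, fun i => ?_⟩
  obtain ⟨q, rfl⟩ := e2.surjective i
  rw [Equiv.trans_apply, Equiv.symm_apply_apply, arcHead,
    Finset.sum_eq_single q.1]
  · rw [hS q, Option.elim_some, if_pos ⟨rfl, hidx q⟩]
    rfl
  · intro p _ hp
    cases hf : f p with
    | none => rfl
    | some a =>
      rw [Option.elim_some, if_neg]
      rintro ⟨h1, h2⟩
      have h3 : f p = some (u, a.2) := by rw [hf, ← h1]
      have h4 := hidx ⟨p, a.2, h3⟩
      rw [h2] at h4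
      exact hp (congrArg Subtype.val (e2.injective (Fin.ext h4))).symm
  · simp

end ArcIndex

/-! ### Creation and testing of candidates for chains -/

section Chains

/-- Keys of the form `a * Q + b` encode pairs; all lookups by a pair of numbers rely on this. -/
theorem Nat.mul_add_inj_of_lt {a a' b b' Q : ℕ} (hb : b < Q) (hb' : b' < Q) :
    a * Q + b = a' * Q + b' ↔ a = a' ∧ b = b' := by
  constructor
  · intro h
    have h3 : a = a' := by
      rcases Nat.lt_trichotomy a a' with h1 | h1 | h1
      · have : (a + 1) * Q ≤ a' * Q := Nat.mul_le_mul_right _ h1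
        rw [add_mul] at this
        omega
      · exact h1
      · have : (a' + 1) * Q ≤ a * Q := Nat.mul_le_mul_right _ h1
        rw [add_mul] at this
        omega
    subst h3
    exact ⟨rfl, by omega⟩
  · rintro ⟨rfl, rfl⟩
    rfl

variable {n : ℕ}

namespace RangeModel

variable {m : RangeModel}

/-- Out-degrees of the tails and numbers of the arcs. -/
theorem Computes.degIndex (hn : n < m.Q) (hc : 5 ≤ m.c) :
    ∃ F : (Fin m.N → Option (Fin n × Fin n)) →
        Fin m.N → Option (Fin n × Fin n) × Fin m.Q × Fin m.Q,
      m.Computes 2 F ∧ ∀ (R : Fin n → Fin n → Prop) [DecidableRel R]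
        (f : Fin m.N → Option (Fin n × Fin n)), ListsArcs f R →
        F f = fun p => (f p, m.clip ((f p).elim 0 fun a => outDeg R a.1),
          m.clip (arcIndex f p)) := by
  have hK := m.Q_le_K
  have hQ := m.Q_pos
  have hNQ : m.N < m.Q := m.hQ
  have hsq := m.sq_le_K
  have hX1 : Fits m.K (Option (Fin n × Fin n) × Fin m.Q) :=
    (((Fits.fin_pow hn.le).prod_pow (Fits.fin_pow hn.le)).option_pow m.hQ2).prod_pow
      (Fits.fin_pow le_rfl) |>.mono (Nat.pow_le_pow_right m.Q_pos (by omega))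
  have : Nonempty (Fin m.Q) := ⟨⟨0, m.Q_pos⟩⟩
  have s1 := Computes.lookup (m := m) (X := Option (Fin n × Fin n))
    (fun _ x => x.elim 0 fun a => a.1) (fun _ x => x.elim 0 fun _ => 1)
    (fun _ x => x.elim 0 fun a => a.1)
    (fun _ x => by cases x with
      | none => exact Nat.zero_le _
      | some a => exact a.1.2.le.trans (hn.le.trans hK))
    (fun _ x => by cases x with
      | none => exact Nat.zero_le _
      | some a => exact (Nat.succ_le_of_lt hQ).trans hK)
    (fun _ x => by cases x with
      | none => exact m.Q_pos.trans_le hK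
      | some a => exact a.1.2.trans (hn.trans_le hK))
    (fun _ x v => (x, m.clip (x.elim 0 fun _ => v)))
  have hkey : ∀ (a : Fin n) (q : ℕ), q ≤ m.Q → (a : ℕ) * m.Q + q ≤ m.K := by
    intro a q hq
    have : ((a : ℕ) + 1) * m.Q ≤ m.Q * m.Q := Nat.mul_le_mul_right _ (a.2.trans hn)
    rw [add_mul] at this
    omega
  -- The key of an arc is its tail times `m.Q` plus its position. As positions are below `m.Q`, the
  -- arcs in `[a.1 * m.Q, a.1 * m.Q + p)` are those with tail `a.1` before position `p`; processors
  -- without an arc contribute 0.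
  have s2 := Computes.rangeSum (m := m) (X := Option (Fin n × Fin n) × Fin m.Q)
    (fun q x => x.1.elim 0 fun a => a.1 * m.Q + q) (fun _ x => x.1.elim 0 fun _ => 1)
    (fun _ x => x.1.elim 0 fun a => a.1 * m.Q) (fun p x => x.1.elim 0 fun a => a.1 * m.Q + p)
    (fun p x => by cases x.1 with
      | none => exact Nat.zero_le _
      | some a => exact hkey _ _ (p.2.le.trans hNQ.le))
    (fun _ x => by cases x.1 with
      | none => exact Nat.zero_le _
      | some a => exact (Nat.succ_le_of_lt hQ).trans hK)
    (fun _ x => by cases x.1 with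
      | none => exact Nat.zero_le _
      | some a => exact hkey a.1 0 (Nat.zero_le _))
    (fun p x => by cases x.1 with
      | none => exact Nat.zero_le _
      | some a => exact hkey _ _ (p.2.le.trans hNQ.le))
    (fun _ x v => (x.1, x.2, m.clip v))
  refine ⟨_, s2.comp s1 hX1, ?_⟩
  intro R _ f hf
  funext p
  dsimp only
  cases hp : f p with
  | none =>
    have e : arcIndex f p = 0 := by rw [arcIndex, hp]; rfl
    rw [e]
    exact Prod.ext rfl (Prod.ext rfl
      (congrArg m.clip (Finset.sum_eq_zero fun q _ => if_neg (by simp))))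
  | some a =>
    refine Prod.ext rfl (Prod.ext (congrArg m.clip ?_) (congrArg m.clip ?_))
    · simp only [Option.elim_some]
      have h1 := hf.sum_out a.1 fun _ => True
      simp only [and_true] at h1
      rw [outDeg, ← h1]
      refine (lookup_option f _ _ _).trans (Finset.sum_congr rfl fun q _ => ?_)
      simp only [← Fin.ext_iff]
    · rw [arcIndex, hp]
      simp only [Option.elim_some]
      refine Finset.sum_congr rfl fun q _ => ?_
      cases f q with
      | none => simp
      | some b =>
        simp only [Option.elim_some]
        refine if_congr ?_ rfl rfl
        have hq : (q : ℕ) < m.Q := q.2.trans hNQ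
        have hp : (p : ℕ) < m.Q := p.2.trans hNQ
        rw [Fin.ext_iff, Fin.lt_def]
        constructor
        · rintro ⟨h1, h2⟩
          have h3 : (b.1 : ℕ) = a.1 := by
            rcases Nat.lt_trichotomy b.1 a.1 with h | h | h
            · have : ((b.1 : ℕ) + 1) * m.Q ≤ a.1 * m.Q := Nat.mul_le_mul_right _ h
              rw [add_mul] at this
              omega
            · exact h
            · have : ((a.1 : ℕ) + 1) * m.Q ≤ b.1 * m.Q := Nat.mul_le_mul_right _ h
              rw [add_mul] at this
              omega
          rw [h3] at h2
          exact ⟨h3, by omega⟩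
        · rintro ⟨h1, h2⟩
          rw [h1]
          omega

/-- The number of range-sum steps that evaluate all chains. -/
def chainSteps (j : ℕ) : ℕ := 2 + 3 + 1 + (1 + j) + 1 + (1 + (j + 1) * (j + 1)) + 1

/-- The vertices of the candidate number `code` at an arc. -/
def candidate [NeZero n] {N : ℕ} (f : Fin N → Option (Fin n × Fin n)) (j : ℕ) (a : Fin n × Fin n)
    (d code : ℕ) : Fin (j + 1) → Fin n :=
  Fin.cons a.2 fun b : Fin j => Fin.ofNat n (arcHead f a.1 (code / d ^ (b : ℕ) % d))

/-- The pair with the number `t` of entries of `w` is an arc, if it is an increasing pair. -/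
def PairOK (R : Fin n → Fin n → Prop) {j : ℕ} (w : Fin (j + 1) → Fin n) (t : ℕ) : Prop :=
  Fin.ofNat (j + 1) (t / (j + 1)) < Fin.ofNat (j + 1) (t % (j + 1)) →
    R (w (Fin.ofNat (j + 1) (t / (j + 1)))) (w (Fin.ofNat (j + 1) (t % (j + 1))))

instance (R : Fin n → Fin n → Prop) [DecidableRel R] {j : ℕ} (w : Fin (j + 1) → Fin n) (t : ℕ) :
    Decidable (PairOK R w t) := inferInstanceAs (Decidable (_ → _))

/-- Quotient and remainder by `j + 1` enumerate all pairs of indices. -/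
theorem forall_pairOK {R : Fin n → Fin n → Prop} {j : ℕ} {w : Fin (j + 1) → Fin n} :
    (∀ t < (j + 1) * (j + 1), PairOK R w t) ↔ ∀ b c, b < c → R (w b) (w c) := by
  constructor
  · intro h b c hbc
    have := h (b * (j + 1) + c) (by
      have h1 := b.2
      have h2 := c.2
      nlinarith)
    have e1 : ((b : ℕ) * (j + 1) + c) / (j + 1) = b := by
      rw [mul_comm, Nat.mul_add_div (Nat.succ_pos j), Nat.div_eq_of_lt c.2, add_zero]
    have e2 : ((b : ℕ) * (j + 1) + c) % (j + 1) = c := by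
      rw [mul_comm, Nat.mul_add_mod, Nat.mod_eq_of_lt c.2]
    have e3 : ∀ b : Fin (j + 1), Fin.ofNat (j + 1) (b : ℕ) = b := fun b =>
      Fin.ext (Nat.mod_eq_of_lt b.2)
    rw [PairOK, e1, e2, e3, e3] at this
    exact this hbc
  · intro h t _ hlt
    exact h _ _ hlt

theorem arcIndex_le {N : ℕ} (f : Fin N → Option (Fin n × Fin n)) (p : Fin N) :
    arcIndex f p ≤ N := by
  rw [arcIndex]
  cases f p with
  | none => exact Nat.zero_le _
  | some a =>
    refine (Finset.sum_le_card_nsmul _ _ 1 fun q _ => ?_).trans (by simp)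
    cases f q with
    | none => exact Nat.zero_le _
    | some b =>
      simp only [Option.elim_some]
      split_ifs <;> simp

/-- Candidates for chains: every arc is followed by all tuples of out-neighbors of its tail. -/
theorem Computes.candidates [NeZero n] (j : ℕ) (hn : n < m.Q) (hc : 15 + j ≤ m.c) :
    ∃ F : (Fin m.N → Option (Fin n × Fin n)) →
        Fin m.N → Option (Fin n × Fin n) × Option (Fin (j + 1) → Fin n),
      m.Computes (2 + 3 + 1 + (1 + j) + 1) F ∧ ∀ (R : Fin n → Fin n → Prop) [DecidableRel R]
        (f : Fin m.N → Option (Fin n × Fin n)), ListsArcs f R →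
        (∑ u, ∑ v, if R u v then outDeg R u ^ j else 0) ≤ m.N →
        (∀ p, (F f p).1 = f p) ∧ ∀ g : (Fin (j + 1) → Fin n) → ℕ,
          ∑ y, (F f y).2.elim 0 g = ∑ p, (f p).elim 0 fun a =>
            ∑ c ∈ Finset.range (outDeg R a.1 ^ j), g (candidate f j a (outDeg R a.1) c) := by
  have hK := m.Q_le_K
  have hQ := m.Q_pos
  have hNQ : m.N < m.Q := m.hQ
  have hsq := m.sq_le_K
  have h1 : Fits (m.Q ^ 1) (Fin n) := Fits.fin_pow hn.le
  have hq : Fits (m.Q ^ 1) (Fin m.Q) := Fits.fin_pow le_rfl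
  have ha : Fits (m.Q ^ 2) (Fin n × Fin n) := h1.prod_pow h1
  have hX4 : Fits (m.Q ^ 5) (Option (Fin n × Fin n) × Fin m.Q × Fin m.Q) :=
    (ha.option_pow m.hQ2).prod_pow (hq.prod_pow hq)
  have hX5 : Fits m.K ((Option (Fin n × Fin n) × Fin m.Q × Fin m.Q) ×
      Option ((Option (Fin n × Fin n) × Fin m.Q × Fin m.Q) × Fin m.Q)) :=
    (hX4.prod_pow ((hX4.prod_pow hq).option_pow m.hQ2)).mono
      (Nat.pow_le_pow_right m.Q_pos (by omega))
  have hX6 : Fits m.K ((Option (Fin n × Fin n) × Fin m.Q) ×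
      Option ((Fin n × Fin n) × Fin m.Q × Fin m.Q × (Fin j → Fin n))) :=
    (((ha.option_pow m.hQ2).prod_pow hq).prod_pow
      ((ha.prod_pow (hq.prod_pow (hq.prod_pow (h1.pi_pow j)))).option_pow m.hQ2)).mono
      (Nat.pow_le_pow_right m.Q_pos (by omega))
  have : Nonempty (Fin m.Q) := ⟨⟨0, m.Q_pos⟩⟩
  have hkey : ∀ (a : Fin n) (q : ℕ), q < m.Q → (a : ℕ) * m.Q + q < m.K := by
    intro a q hq
    have : ((a : ℕ) + 1) * m.Q ≤ m.Q * m.Q := Nat.mul_le_mul_right _ (a.2.trans hn)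
    rw [add_mul] at this
    omega
  have hdiv : ∀ (d code : Fin m.Q) (t : ℕ), (code : ℕ) / (d : ℕ) ^ t % d < m.Q := fun d code t =>
    ((Nat.mod_le _ _).trans (Nat.div_le_self _ _)).trans_lt code.2
  obtain ⟨A, hA, hA'⟩ := Computes.degIndex (m := m) hn (by omega)
  -- An arc whose tail has out-degree `d` makes `d ^ j` copies. The digits of the copy number in
  -- base `d` will select `j` out-neighbors of the tail.
  obtain ⟨E, hE, hE1, hE2⟩ := Computes.expand (m := m)
    (X := Option (Fin n × Fin n) × Fin m.Q × Fin m.Q)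
    (fun x => x.1.elim 0 fun _ => min ((x.2.1 : ℕ) ^ j) m.N)
    (fun x => by cases x.1 with
      | none => exact Nat.zero_le _
      | some a => exact min_le_right _ _) hX4 (by omega)
  have hC := Computes.map (m := m) (X := (Option (Fin n × Fin n) × Fin m.Q × Fin m.Q) ×
      Option ((Option (Fin n × Fin n) × Fin m.Q × Fin m.Q) × Fin m.Q))
    (Y := (Option (Fin n × Fin n) × Fin m.Q) ×
      Option ((Fin n × Fin n) × Fin m.Q × Fin m.Q × (Fin j → Fin n)))
    fun _ x => ((x.1.1, x.1.2.2), x.2.bind fun z => z.1.1.map fun a =>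
      (a, z.1.2.1, z.2, fun _ => 0))
  -- Step `t` turns digit `t` of the copy number into a vertex: the head of the arc listed under the
  -- tail and this digit as `arcIndex`.
  have hG : ∀ t : ℕ, ∃ G : (Fin m.N → (Option (Fin n × Fin n) × Fin m.Q) ×
      Option ((Fin n × Fin n) × Fin m.Q × Fin m.Q × (Fin j → Fin n))) → Fin m.N →
      (Option (Fin n × Fin n) × Fin m.Q) ×
      Option ((Fin n × Fin n) × Fin m.Q × Fin m.Q × (Fin j → Fin n)), m.Computes 1 G ∧
      ∀ x p, G x p = ((x p).1, (x p).2.map fun z => (z.1, z.2.1, z.2.2.1, fun b : Fin j =>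
        if (b : ℕ) = t then Fin.ofNat n (∑ q, if (x q).1.1.elim 0
          (fun a => (a.1 : ℕ) * m.Q + (x q).1.2) =
          (x p).2.elim 0 (fun z => (z.1.1 : ℕ) * m.Q + (z.2.2.1 : ℕ) / (z.2.1 : ℕ) ^ t % z.2.1)
          then (x q).1.1.elim 0 (fun a => (a.2 : ℕ)) else 0) else z.2.2.2 b)) := fun t =>
    ⟨_, Computes.lookup (m := m) (X := (Option (Fin n × Fin n) × Fin m.Q) ×
      Option ((Fin n × Fin n) × Fin m.Q × Fin m.Q × (Fin j → Fin n)))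
    (fun _ x => x.1.1.elim 0 fun a => (a.1 : ℕ) * m.Q + x.1.2)
    (fun _ x => x.1.1.elim 0 fun a => (a.2 : ℕ))
    (fun _ x => x.2.elim 0 fun z => (z.1.1 : ℕ) * m.Q + (z.2.2.1 : ℕ) / (z.2.1 : ℕ) ^ t % z.2.1)
    (fun _ x => by cases x.1.1 with
      | none => exact Nat.zero_le _
      | some a => exact (hkey _ _ x.1.2.2).le)
    (fun _ x => by cases x.1.1 with
      | none => exact Nat.zero_le _
      | some a => exact (a.2.2.trans hn).le.trans hK)
    (fun _ x => by cases x.2 with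
      | none => exact m.Q_pos.trans_le hK
      | some z => exact hkey _ _ (hdiv _ _ _))
    (fun _ x v => (x.1, x.2.map fun z => (z.1, z.2.1, z.2.2.1, fun b : Fin j =>
      if (b : ℕ) = t then Fin.ofNat n v else z.2.2.2 b))), fun x p => rfl⟩
  choose G hG hG' using hG
  have hD := Computes.iterate hX6 hG j
  rw [mul_one] at hD
  have hM := Computes.map (m := m) (X := (Option (Fin n × Fin n) × Fin m.Q) ×
      Option ((Fin n × Fin n) × Fin m.Q × Fin m.Q × (Fin j → Fin n)))
    (Y := Option (Fin n × Fin n) × Option (Fin (j + 1) → Fin n))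
    fun _ x => (x.1.1, x.2.map fun z => Fin.cons z.1.2 z.2.2.2)
  refine ⟨_, hM.comp (hD.comp (hC.comp (hE.comp hA (hX4.mono
    (Nat.pow_le_pow_right m.Q_pos (by omega)))) hX5) hX6) hX6, ?_⟩
  intro R _ f hf hsum
  have hans : ∀ (u : Fin n) (i : ℕ), i < m.Q → (∑ q, if (f q).elim 0
      (fun a => (a.1 : ℕ) * m.Q + m.clip (arcIndex f q)) = (u : ℕ) * m.Q + i
      then (f q).elim 0 (fun a => (a.2 : ℕ)) else 0) = arcHead f u i := by
    intro u i hi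
    rw [arcHead]
    refine Finset.sum_congr rfl fun q _ => ?_
    cases f q with
    | none => exact ite_self 0
    | some b =>
      simp only [Option.elim_some]
      have hq := (arcIndex_le f q).trans_lt hNQ
      refine if_congr ?_ rfl rfl
      rw [m.clip_val hq, Nat.mul_add_inj_of_lt hq hi, Fin.ext_iff]
  have hdeg : ∀ u, outDeg R u < m.Q := fun u =>
    ((Finset.card_le_univ _).trans (by simp)).trans_lt hn
  rw [hA' R f hf]
  set x4 : Fin m.N → Option (Fin n × Fin n) × Fin m.Q × Fin m.Q := fun p =>
    (f p, m.clip ((f p).elim 0 fun a => outDeg R a.1), m.clip (arcIndex f p)) with hx4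
  set y0 : Fin m.N → (Option (Fin n × Fin n) × Fin m.Q) ×
      Option ((Fin n × Fin n) × Fin m.Q × Fin m.Q × (Fin j → Fin n)) := fun p =>
    (((E x4 p).1.1, (E x4 p).1.2.2), (E x4 p).2.bind fun z => z.1.1.map fun a =>
      (a, z.1.2.1, z.2, fun _ => 0)) with hy0
  have hy01 : ∀ p, (y0 p).1 = (f p, m.clip (arcIndex f p)) := fun p => by
    rw [hy0]
    simp only [hE1, hx4]
  have key : ∀ t, ((Nat.rec y0 (fun t y => G t y) t : Fin m.N → (Option (Fin n × Fin n) × Fin m.Q) ×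
      Option ((Fin n × Fin n) × Fin m.Q × Fin m.Q × (Fin j → Fin n)))) = fun p => ((y0 p).1,
      (y0 p).2.map fun z => (z.1, z.2.1, z.2.2.1, fun b : Fin j => if (b : ℕ) < t then
        Fin.ofNat n (arcHead f z.1.1 ((z.2.2.1 : ℕ) / (z.2.1 : ℕ) ^ (b : ℕ) % z.2.1))
        else z.2.2.2 b)) := by
    intro t
    induction t with
    | zero =>
      funext p
      refine Prod.ext rfl ?_
      simp only [Nat.not_lt_zero, if_false]
      cases (y0 p).2 <;> rfl
    | succ t ih =>
      funext p
      change G t (Nat.rec y0 (fun t y => G t y) t) p = _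
      rw [ih, hG']
      refine Prod.ext rfl ?_
      simp only [hy01]
      cases (y0 p).2 with
      | none => rfl
      | some z =>
        simp only [Option.map_some, Option.elim_some, Option.some.injEq, Prod.mk.injEq, true_and]
        funext b
        refine Eq.trans (congrArg (fun v => if (b : ℕ) = t then Fin.ofNat n v else _)
          (hans z.1.1 _ (hdiv z.2.1 z.2.2.1 t))) ?_
        by_cases hb : (b : ℕ) = t
        · rw [if_pos hb, if_pos (by omega), hb]
        · rw [if_neg hb]
          exact if_congr (by omega) rfl rfl
  constructor
  · intro p
    dsimp only
    rw [key]
    dsimp only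
    rw [hy01]
  · intro g
    dsimp only
    rw [key]
    dsimp only
    have hle : ∑ p, (f p).elim 0 (fun a => outDeg R a.1 ^ j) ≤ m.N := by
      have := hf fun u _ => outDeg R u ^ j
      rw [← this] at hsum
      exact hsum
    have hr : ∀ p, ((x4 p).1.elim 0 fun _ => min (((x4 p).2.1 : ℕ) ^ j) m.N) =
        (f p).elim 0 fun a => outDeg R a.1 ^ j := by
      intro p
      have hp := Finset.single_le_sum (f := fun p => (f p).elim 0 fun a => outDeg R a.1 ^ j)
        (fun _ _ => Nat.zero_le _) (Finset.mem_univ p)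
      have hp' := hp.trans hle
      rw [hx4]
      dsimp only at hp' ⊢
      cases hfp : f p with
      | none => rfl
      | some a =>
        rw [hfp] at hp'
        simp only [Option.elim_some] at hp' ⊢
        rw [m.clip_val (hdeg _), min_eq_left hp']
    have h5 := hE2 x4 (by simp only [hr]; exact hle) fun x c => x.1.elim 0 fun a =>
      g (candidate f j a x.2.1 c)
    simp only [hr] at h5
    refine Eq.trans (Finset.sum_congr rfl fun y _ => ?_) (h5.trans
      (Finset.sum_congr rfl fun p _ => ?_))
    · rw [hy0]
      dsimp only
      cases (E x4 y).2 with
      | none => rfl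
      | some z =>
        obtain ⟨⟨o, d, i⟩, c⟩ := z
        cases o with
        | none => rfl
        | some a =>
          simp only [Option.bind_some, Option.map_some, Option.elim_some, Fin.is_lt, if_true]
          rfl
    · rw [hx4]
      dsimp only
      cases f p with
      | none => rfl
      | some a =>
        simp only [Option.elim_some]
        rw [m.clip_val (hdeg _)]

/-- Removal of the candidates with a pair that is not an arc. -/
theorem Computes.checks (j : ℕ) (hn : n < m.Q) (hc : 5 + j ≤ m.c) :
    ∃ F : (Fin m.N → Option (Fin n × Fin n) × Option (Fin (j + 1) → Fin n)) →
        Fin m.N → Option (Fin n × Fin n) × Option (Fin (j + 1) → Fin n),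
      m.Computes (1 + (j + 1) * (j + 1)) F ∧ ∀ (R : Fin n → Fin n → Prop) [DecidableRel R]
        (f : Fin m.N → Option (Fin n × Fin n)), ListsArcs f R →
        ∀ x, (∀ p, (x p).1 = f p) → ∀ p, (F x p).2 = (x p).2.bind fun w =>
          if ∀ b c, b < c → R (w b) (w c) then some w else none := by
  have hK := m.Q_le_K
  have hQ := m.Q_pos
  have hsq := m.sq_le_K
  have hX : Fits m.K (Option (Fin n × Fin n) × Option (Fin (j + 1) → Fin n)) := by
    have h1 : Fits (m.Q ^ 1) (Fin n) := Fits.fin_pow hn.le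
    refine (((h1.prod_pow h1).option_pow m.hQ2).prod_pow ((h1.pi_pow (j + 1)).option_pow m.hQ2)).mono
      (Nat.pow_le_pow_right m.Q_pos ?_)
    omega
  have hkey : ∀ a b : Fin n, (a : ℕ) * m.Q + b < m.K := by
    intro a b
    have : ((a : ℕ) + 1) * m.Q ≤ m.Q * m.Q := Nat.mul_le_mul_right _ (a.2.trans hn)
    have := b.2
    rw [add_mul] at *
    omega
  -- An arc contributes 1 at the key of its pair of ends, so the answer 0 reveals that a pair is not
  -- an arc, and the candidate is dropped.
  have hG : ∀ t : ℕ, ∃ G : (Fin m.N → Option (Fin n × Fin n) × Option (Fin (j + 1) → Fin n)) →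
      Fin m.N → Option (Fin n × Fin n) × Option (Fin (j + 1) → Fin n), m.Computes 1 G ∧
      ∀ x p, G x p = ((x p).1, (x p).2.bind fun w =>
        if Fin.ofNat (j + 1) (t / (j + 1)) < Fin.ofNat (j + 1) (t % (j + 1)) ∧
          (∑ q, if (x q).1.elim 0 (fun a => (a.1 : ℕ) * m.Q + a.2) =
            (x p).2.elim 0 (fun w => (w (Fin.ofNat (j + 1) (t / (j + 1))) : ℕ) * m.Q +
            w (Fin.ofNat (j + 1) (t % (j + 1)))) then (x q).1.elim 0 (fun _ => 1) else 0) = 0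
        then none else some w) := fun t =>
    ⟨_, Computes.lookup (X := Option (Fin n × Fin n) × Option (Fin (j + 1) → Fin n))
    (fun _ x => x.1.elim 0 fun a => (a.1 : ℕ) * m.Q + a.2) (fun _ x => x.1.elim 0 fun _ => 1)
    (fun _ x => x.2.elim 0 fun w => (w (Fin.ofNat (j + 1) (t / (j + 1))) : ℕ) * m.Q +
      w (Fin.ofNat (j + 1) (t % (j + 1))))
    (fun _ x => by cases x.1 with
      | none => exact Nat.zero_le _
      | some a => exact (hkey _ _).le)
    (fun _ x => by cases x.1 with
      | none => exact Nat.zero_le _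
      | some a => exact (Nat.succ_le_of_lt hQ).trans hK)
    (fun _ x => by cases x.2 with
      | none => exact m.Q_pos.trans_le hK
      | some a => exact hkey _ _)
    (fun _ x v => (x.1, x.2.bind fun w =>
      if Fin.ofNat (j + 1) (t / (j + 1)) < Fin.ofNat (j + 1) (t % (j + 1)) ∧
        v = 0 then none else some w)), fun x p => rfl⟩
  choose G hG hG' using hG
  have h1 := Computes.iterate hX hG ((j + 1) * (j + 1))
  rw [mul_one] at h1
  refine ⟨_, h1, ?_⟩
  intro R _ f hf x hx p
  have hans : ∀ a b : Fin n, (∑ q, if (f q).elim 0 (fun a => (a.1 : ℕ) * m.Q + a.2) =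
      (a : ℕ) * m.Q + b then (f q).elim 0 (fun _ => 1) else 0) = if R a b then 1 else 0 := by
    intro a b
    rw [lookup_option]
    have h2 := hf fun a' b' => if a' = a ∧ b' = b then 1 else 0
    refine Eq.trans (Finset.sum_congr rfl fun q _ => ?_) (h2.trans ?_)
    · cases f q with
      | none => rfl
      | some c =>
        simp only [Option.elim_some]
        refine if_congr ?_ rfl rfl
        rw [Nat.mul_add_inj_of_lt (c.2.2.trans hn) (b.2.trans hn), Fin.ext_iff, Fin.ext_iff]
    · rw [Finset.sum_eq_single a]
      · rw [Finset.sum_eq_single b]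
        · simp
        · intro b' _ hb
          simp [hb]
        · simp
      · intro a' _ ha
        simp [ha]
      · simp
  have key : ∀ t, ((Nat.rec x (fun t y => G t y) t : Fin m.N → Option (Fin n × Fin n) ×
      Option (Fin (j + 1) → Fin n))) = fun p => (f p, (x p).2.bind fun w =>
        if ∀ s < t, PairOK R w s then some w else none) := by
    intro t
    induction t with
    | zero =>
      funext p
      refine Prod.ext (hx p) ?_
      cases (x p).2 <;> simp
    | succ t ih =>
      funext p
      change G t (Nat.rec x (fun t y => G t y) t) p = _
      rw [ih, hG']
      refine Prod.ext rfl ?_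
      dsimp only
      cases hp : (x p).2 with
      | none => rfl
      | some w =>
        simp only [Option.bind_some]
        by_cases h1 : ∀ s < t, PairOK R w s
        · simp only [if_pos h1, Option.bind_some, Option.elim_some, hans]
          by_cases h2 : PairOK R w t
          · rw [if_pos (show ∀ s < t + 1, PairOK R w s from fun s hs =>
              (Nat.lt_succ_iff_lt_or_eq.1 hs).elim (h1 s) fun h => h ▸ h2), if_neg]
            rintro ⟨h3, h4⟩
            rw [if_pos (h2 h3)] at h4
            exact one_ne_zero h4
          · rw [if_neg (show ¬ ∀ s < t + 1, PairOK R w s from fun h => h2 (h t (Nat.lt_succ_self t))),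
              if_pos]
            rw [PairOK, Classical.not_imp] at h2
            exact ⟨h2.1, if_neg h2.2⟩
        · rw [if_neg (show ¬ ∀ s < t + 1, PairOK R w s from fun h =>
            h1 fun s hs => h s (hs.trans (Nat.lt_succ_self t)))]
          simp only [if_neg h1, Option.bind_none]
  rw [key]
  simp only [forall_pairOK]

end RangeModel

end Chains

/-! ### From candidates to the number of chains -/

section ChainCount

variable {n : ℕ}

/-- The number of chains of `k` vertices. -/
def chainCount (R : Fin n → Fin n → Prop) [DecidableRel R] (k : ℕ) : ℕ :=
  (Finset.univ.filter fun w : Fin k → Fin n => ∀ b c, b < c → R (w b) (w c)).card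

/-- Codes below `d ^ j` are functions from `Fin j` to `Fin d`, and arc numbers are in bijection with
out-neighbors (`ListsArcs.exists_equiv`). So every tuple of out-neighbors arises from exactly one
code. -/
theorem ListsArcs.sum_candidate [NeZero n] {N : ℕ} {f : Fin N → Option (Fin n × Fin n)}
    {R : Fin n → Fin n → Prop} [DecidableRel R] (h : ListsArcs f R) (j : ℕ) (u v : Fin n)
    (g : (Fin (j + 1) → Fin n) → ℕ) :
    ∑ c ∈ Finset.range (outDeg R u ^ j), g (RangeModel.candidate f j (u, v) (outDeg R u) c) =
      ∑ w : Fin j → Fin n, if ∀ b, R u (w b) then g (Fin.cons v w) else 0 := by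
  obtain ⟨e, he⟩ := h.exists_equiv u
  have h1 : ∀ φ : Fin j → Fin (outDeg R u),
      RangeModel.candidate f j (u, v) (outDeg R u) (finFunctionFinEquiv φ) =
      Fin.cons v fun b => (e (φ b)).1 := by
    intro φ
    rw [RangeModel.candidate]
    congr 1
    funext b
    have h2 : (finFunctionFinEquiv φ : ℕ) / outDeg R u ^ (b : ℕ) % outDeg R u = φ b := by
      rw [← finFunctionFinEquiv_symm_apply_val, Equiv.symm_apply_apply]
    rw [h2, he]
    exact Fin.ext (Nat.mod_eq_of_lt (e (φ b)).1.2)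
  rw [Finset.sum_range fun c => g (RangeModel.candidate f j (u, v) (outDeg R u) c),
    ← finFunctionFinEquiv.sum_comp]
  simp only [h1]
  rw [← Finset.sum_filter, Finset.sum_subtype (p := fun w : Fin j → Fin n => ∀ b, R u (w b)) _
    (by simp), ← (Equiv.subtypePiEquivPi (p := fun (_ : Fin j) v => R u v)).symm.sum_comp]
  exact ((Equiv.refl (Fin j)).arrowCongr e).sum_comp
    fun ψ : Fin j → {v // R u v} => g (Fin.cons v fun b => (ψ b).1)

/-- Splitting off the first two vertices matches the form of the candidates: the pairs with `u` are
arcs by construction, and only the pairs among the other vertices have to be tested. -/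
theorem chainCount_eq_sum (R : Fin n → Fin n → Prop) [DecidableRel R] (j : ℕ) :
    chainCount R (j + 2) = ∑ u, ∑ v, if R u v then ∑ w : Fin j → Fin n, if ∀ b, R u (w b) then
      (if ∀ b c, b < c → R (Fin.cons (α := fun _ => Fin n) v w b) (Fin.cons (α := fun _ => Fin n) v w c)
        then 1 else 0) else 0 else 0 := by
  rw [chainCount, Finset.card_filter, ← (Fin.consEquiv fun _ => Fin n).sum_comp,
    Fintype.sum_prod_type]
  refine Finset.sum_congr rfl fun u _ => ?_
  rw [← (Fin.consEquiv fun _ => Fin n).sum_comp, Fintype.sum_prod_type]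
  refine Finset.sum_congr rfl fun v _ => ?_
  have h1 : ∀ w : Fin j → Fin n, (∀ b c, b < c → R (Fin.consEquiv (fun _ => Fin n) (u, Fin.consEquiv (fun _ => Fin n) (v, w)) b)
      (Fin.consEquiv (fun _ => Fin n) (u, Fin.consEquiv (fun _ => Fin n) (v, w)) c)) ↔ R u v ∧ (∀ b, R u (w b)) ∧
      ∀ b c, b < c → R (Fin.cons (α := fun _ => Fin n) v w b) (Fin.cons (α := fun _ => Fin n) v w c) := by
    intro w
    change (∀ b c, b < c → R (Fin.cons (α := fun _ => Fin n) u (Fin.cons (α := fun _ => Fin n) v w) b)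
      (Fin.cons (α := fun _ => Fin n) u (Fin.cons (α := fun _ => Fin n) v w) c)) ↔ _
    rw [Fin.forall_fin_succ]
    simp only [Fin.cons_zero, Fin.cons_succ, Fin.forall_fin_succ (n := j + 1), Fin.succ_lt_succ_iff,
      lt_irrefl, false_imp_iff, Fin.succ_pos, true_imp_iff, true_and, Fin.not_lt_zero]
    rw [Fin.forall_fin_succ (P := fun i => R u _)]
    simp only [Fin.cons_zero, Fin.cons_succ, and_assoc]
  simp only [h1, ite_and]
  split_ifs with h
  · rfl
  · simp

namespace RangeModel

variable {m : RangeModel}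

/-- Counting of chains, in one vertex more than `j + 1`. -/
theorem Computes.chains [NeZero n] (j : ℕ) (hn : n < m.Q) (hc : 15 + j ≤ m.c) :
    ∃ F : (Fin m.N → Option (Fin n × Fin n)) → Fin m.N → Fin m.Q,
      m.Computes (chainSteps j) F ∧ ∀ (R : Fin n → Fin n → Prop) [DecidableRel R]
        (f : Fin m.N → Option (Fin n × Fin n)), ListsArcs f R →
        (∑ u, ∑ v, if R u v then outDeg R u ^ j else 0) ≤ m.N →
        ∀ p, (F f p : ℕ) = chainCount R (j + 2) := by
  have hQ := m.Q_pos
  have hNQ : m.N < m.Q := m.hQ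
  have h1 : Fits (m.Q ^ 1) (Fin n) := Fits.fin_pow hn.le
  have hX : Fits m.K (Option (Fin n × Fin n) × Option (Fin (j + 1) → Fin n)) :=
    (((h1.prod_pow h1).option_pow m.hQ2).prod_pow ((h1.pi_pow (j + 1)).option_pow m.hQ2)).mono
      (Nat.pow_le_pow_right m.Q_pos (by omega))
  obtain ⟨A, hA, hA'⟩ := Computes.candidates (m := m) j hn hc
  obtain ⟨E, hE, hE'⟩ := Computes.checks (m := m) j hn (by omega)
  have hS := Computes.lookup (m := m) (X := Option (Fin n × Fin n) × Option (Fin (j + 1) → Fin n))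
    (Y := Fin m.Q) (fun _ _ => 0) (fun _ x => x.2.elim 0 fun _ => 1) (fun _ _ => 0)
    (fun _ _ => Nat.zero_le _)
    (fun _ x => by cases x.2 with
      | none => exact Nat.zero_le _
      | some a => exact (Nat.succ_le_of_lt hQ).trans m.Q_le_K)
    (fun _ _ => m.Q_pos.trans_le m.Q_le_K) (fun _ _ v => m.clip v)
  refine ⟨_, hS.comp (hE.comp hA hX) hX, ?_⟩
  intro R _ f hf hsum p
  obtain ⟨hA1, hA2⟩ := hA' R f hf hsum
  have e : (∑ q : Fin m.N, if 0 = 0 then (E (A f) q).2.elim 0 (fun _ => 1) else 0) =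
      chainCount R (j + 2) := by
    simp only [if_true]
    have h2 : ∀ q, (E (A f) q).2.elim 0 (fun _ => 1) = (A f q).2.elim 0 fun w =>
        if ∀ b c, b < c → R (w b) (w c) then 1 else 0 := by
      intro q
      rw [hE' R f hf _ hA1]
      cases (A f q).2 with
      | none => rfl
      | some w =>
        simp only [Option.bind_some, Option.elim_some]
        split_ifs <;> rfl
    simp only [h2]
    rw [hA2]
    have h3 : ∀ p, ((f p).elim 0 fun a => ∑ c ∈ Finset.range (outDeg R a.1 ^ j),
        if ∀ b c', b < c' → R (candidate f j a (outDeg R a.1) c b)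
          (candidate f j a (outDeg R a.1) c c') then 1 else 0) =
        (f p).elim 0 fun a => ∑ w : Fin j → Fin n, if ∀ b, R a.1 (w b) then
      (if ∀ b c, b < c → R (Fin.cons (α := fun _ => Fin n) a.2 w b)
        (Fin.cons (α := fun _ => Fin n) a.2 w c) then 1 else 0) else 0 := by
      intro p
      cases f p with
      | none => rfl
      | some a => exact hf.sum_candidate j a.1 a.2 fun w =>
          if ∀ b c, b < c → R (w b) (w c) then 1 else 0
    simp only [h3]
    refine (hf fun u v => ∑ w : Fin j → Fin n, if ∀ b, R u (w b) then
      (if ∀ b c, b < c → R (Fin.cons (α := fun _ => Fin n) v w b)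
        (Fin.cons (α := fun _ => Fin n) v w c) then 1 else 0) else 0).trans ?_
    rw [chainCount_eq_sum]
  rw [e, m.clip_val]
  -- There are at most as many chains as candidates, hence fewer than `m.Q`, and reduction modulo
  -- `m.Q` loses nothing.
  refine (le_trans ?_ hsum).trans_lt hNQ
  rw [chainCount_eq_sum]
  refine Finset.sum_le_sum fun u _ => Finset.sum_le_sum fun v _ => ?_
  split_ifs
  · have h3 : (∑ w : Fin j → Fin n, if ∀ b, R u (w b) then 1 else 0) = outDeg R u ^ j := by
      rw [← Finset.card_filter, outDeg, ← Fintype.card_subtype, ← Fintype.card_subtype,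
        Fintype.card_congr (Equiv.subtypePiEquivPi (p := fun (_ : Fin j) v => R u v)),
        Fintype.card_fun, Fintype.card_fin]
    rw [← h3]
    refine Finset.sum_le_sum fun w _ => ?_
    split_ifs <;> simp
  · exact le_rfl

/-- The number of range-sum steps that count cliques by `T` phases of peeling. -/
def cliqueSteps (T j : ℕ) : ℕ := 4 + (3 + 2 * T) + chainSteps j

/-- Counting of the chains of an oriented graph whose edges are listed by the processors. -/
theorem Computes.orientedChains [NeZero n] (j : ℕ) (hn : n < m.Q) (hc : 26 + j ≤ m.c)
    (thr : ℕ → ℕ) (T : ℕ) (hT : T < m.Q) :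
    ∃ F : (Fin m.N → Fin 4 → Option (Fin n × Fin n)) → Fin m.N → Fin m.Q,
      m.Computes (cliqueSteps T j) F ∧ ∀ (R : Fin n → Fin n → Prop) [DecidableRel R]
        (x : Fin m.N → Fin 4 → Option (Fin n × Fin n)),
        (∀ g : Fin n → Fin n → ℕ,
          (∑ p, ∑ b, (x p b).elim 0 fun a => g a.1 a.2 + g a.2 a.1) =
            ∑ u, ∑ v, if R u v then g u v else 0) →
        (∑ u, ∑ v, if R u v then 1 else 0) ≤ m.N →
        (∑ u, ∑ v, if R u v ∧ StampLT (peelStamp R thr T) u v then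
          outDeg (fun u v => R u v ∧ StampLT (peelStamp R thr T) u v) u ^ j else 0) ≤ m.N →
        ∀ p, (F x p : ℕ) =
          chainCount (fun u v => R u v ∧ StampLT (peelStamp R thr T) u v) (j + 2) := by
  obtain ⟨A, hA, hA'⟩ := Computes.unpack (m := m) hn (by omega)
  obtain ⟨E, hE, hE'⟩ := Computes.orient (m := m) hn (by omega) thr T hT
  obtain ⟨G, hG, hG'⟩ := Computes.chains (m := m) j hn (by omega)
  have h1 : Fits (m.Q ^ 1) (Fin n) := Fits.fin_pow hn.le
  have hX : Fits m.K (Option (Fin n × Fin n)) := ((h1.prod_pow h1).option_pow m.hQ2).mono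
      (Nat.pow_le_pow_right m.Q_pos (by omega))
  exact ⟨_, hG.comp (hE.comp hA hX) hX, fun R _ x h2 h3 h4 => hG' _ _ (hE' R _ (hA' R x h2 h3)) h4⟩

end RangeModel

end ChainCount

/-! ### Cliques as chains of the oriented graph -/

section CliqueCount

open RangeModel

variable {n : ℕ}

/-- An embedding into a linear order that represents the order of stamps. -/
theorem stampLT_iff (σ : Fin n → ℕ) (u v : Fin n) :
    StampLT σ u v ↔ toLex (σ u, u) < toLex (σ v, v) := by
  rw [Prod.Lex.toLex_lt_toLex]
  rfl

/-- Every clique is the set of the vertices of exactly one chain. -/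
theorem chainCount_stampLT (G : SimpleGraph (Fin n)) [DecidableRel G.Adj] (σ : Fin n → ℕ) (k : ℕ) :
    chainCount (fun u v => G.Adj u v ∧ StampLT σ u v) k = (G.cliqueFinset k).card := by
  rw [chainCount]
  have hmono : ∀ w : Fin k → Fin n, (∀ b c, b < c → G.Adj (w b) (w c) ∧ StampLT σ (w b) (w c)) →
      StrictMono fun b => toLex (σ (w b), w b) := fun w hw b c hbc =>
    (stampLT_iff σ _ _).1 (hw b c hbc).2
  have hinj : ∀ w : Fin k → Fin n, (∀ b c, b < c → G.Adj (w b) (w c) ∧ StampLT σ (w b) (w c)) →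
      Function.Injective w := fun w hw b c hbc => (hmono w hw).injective (by simp [hbc])
  refine Finset.card_bij (fun w _ => Finset.univ.image w) ?_ ?_ ?_
  · intro w hw
    rw [Finset.mem_filter] at hw
    rw [SimpleGraph.mem_cliqueFinset_iff, SimpleGraph.isNClique_iff]
    constructor
    · intro u hu v hv huv
      simp only [Finset.coe_image, Finset.coe_univ, Set.image_univ, Set.mem_range] at hu hv
      obtain ⟨b, rfl⟩ := hu
      obtain ⟨c, rfl⟩ := hv
      rcases lt_trichotomy b c with h | h | h
      · exact (hw.2 b c h).1
      · exact absurd (congrArg w h) huv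
      · exact (hw.2 c b h).1.symm
    · rw [Finset.card_image_of_injective _ (hinj w hw.2)]
      simp
  · intro w hw w' hw' h
    rw [Finset.mem_filter] at hw hw'
    have h1 : Set.range w = Set.range w' := by
      simpa [Finset.ext_iff, Set.ext_iff] using h
    -- Both tuples increase in the linear order by stamp and vertex, and an increasing tuple is
    -- determined by its range.
    have h2 := ((hmono w hw.2).range_inj (hmono w' hw'.2)).1 (by
      have e : ∀ w : Fin k → Fin n, (Set.range fun b => toLex (σ (w b), w b)) =
          (fun v => toLex (σ v, v)) '' Set.range w := fun w => by
        rw [← Set.range_comp]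
        rfl
      rw [e, e, h1])
    funext b
    have h3 := congrFun h2 b
    simpa using (Prod.mk.inj (toLex.injective h3)).2
  · intro s hs
    rw [SimpleGraph.mem_cliqueFinset_iff, SimpleGraph.isNClique_iff] at hs
    -- Conversely, the vertices of a clique, listed in this order, form a chain.
    let φ : Fin n → ℕ ×ₗ Fin n := fun v => toLex (σ v, v)
    have hφ : Function.Injective φ := fun u v h => (Prod.mk.inj (toLex.injective h)).2
    have hc : (s.image φ).card = k := by rw [Finset.card_image_of_injective _ hφ, hs.2]
    have hmem : ∀ b, ∃ v ∈ s, φ v = (s.image φ).orderEmbOfFin hc b := fun b =>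
      Finset.mem_image.1 ((s.image φ).orderEmbOfFin_mem hc b)
    choose w hw hw' using hmem
    have hlt : ∀ b c, b < c → StampLT σ (w b) (w c) := fun b c hbc => by
      rw [stampLT_iff]
      change φ (w b) < φ (w c)
      rw [hw', hw']
      exact ((s.image φ).orderEmbOfFin hc).strictMono hbc
    have hne : ∀ b c, b < c → w b ≠ w c := fun b c hbc h => by
      have := hlt b c hbc
      rw [h, stampLT_iff] at this
      exact lt_irrefl _ this
    have hgood : ∀ b c, b < c → G.Adj (w b) (w c) ∧ StampLT σ (w b) (w c) := fun b c hbc =>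
      ⟨hs.1 (hw b) (hw c) (hne b c hbc), hlt b c hbc⟩
    refine ⟨w, by simpa using hgood, ?_⟩
    refine Finset.eq_of_subset_of_card_le (fun v hv => ?_) ?_
    · obtain ⟨b, -, rfl⟩ := Finset.mem_image.1 hv
      exact hw b
    · rw [Finset.card_image_of_injective _ (hinj w hgood), hs.2]
      simp

end CliqueCount

/-! ### Sparsity of graphs of bounded arboricity -/

section Density

/-- A forest extends to a spanning tree of the complete graph, so it has fewer edges than vertices
unless there are no vertices. -/
theorem SimpleGraph.IsAcyclic.sum_degree_le {V : Type*} [Fintype V] {F : SimpleGraph V}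
    [DecidableRel F.Adj] (h : F.IsAcyclic) :
    ∑ u, (Finset.univ.filter fun v => F.Adj u v).card ≤ 2 * Fintype.card V := by
  classical
  have h1 : ∑ u, (Finset.univ.filter fun v => F.Adj u v).card = 2 * F.edgeFinset.card := by
    rw [← F.sum_degrees_eq_twice_card_edges]
    refine Finset.sum_congr rfl fun u _ => ?_
    rw [← F.card_neighborFinset_eq_degree]
    congr 1
    ext v
    simp
  rw [h1]
  rcases isEmpty_or_nonempty V with hV | hV
  · have : F.edgeFinset = ∅ := by
      ext e
      induction e with
      | _ u v => exact isEmptyElim u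
    simp [this]
  · obtain ⟨T, hT, -, hT'⟩ :=
      SimpleGraph.connected_top.exists_isTree_le_of_le_of_isAcyclic (le_top : F ≤ ⊤) h
    have h2 := hT'.card_edgeFinset
    have h3 := Finset.card_le_card (SimpleGraph.edgeFinset_mono hT)
    omega

/-- A set of vertices spans at most twice as many arcs as it has elements, per forest. -/
theorem SimpleGraph.sum_card_adj_le {V : Type*} [Fintype V] (G : SimpleGraph V) [DecidableRel G.Adj]
    (S : Finset V) :
    ∑ u ∈ S, (S.filter fun v => G.Adj u v).card ≤ 2 * G.arboricity * S.card := by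
  classical
  obtain ⟨F, hF, hG⟩ := G.exists_forests_arboricity
  have hadj : ∀ u v, G.Adj u v ↔ ∃ i, (F i).Adj u v := fun u v => by
    rw [← SimpleGraph.iSup_adj, hG]
  have h1 : ∀ i, ∑ u ∈ S, (S.filter fun v => (F i).Adj u v).card ≤ 2 * S.card := by
    intro i
    have h2 := ((hF i).induce (S : Set V)).sum_degree_le
    rw [show Fintype.card (S : Set V) = S.card by simp] at h2
    refine le_trans (le_of_eq ?_) h2
    rw [← Finset.sum_coe_sort]
    refine Finset.sum_congr rfl fun u _ => ?_
    rw [Finset.card_filter, Finset.card_filter, ← Finset.sum_coe_sort]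
    rfl
  calc ∑ u ∈ S, (S.filter fun v => G.Adj u v).card
      ≤ ∑ u ∈ S, ∑ i, (S.filter fun v => (F i).Adj u v).card := by
        refine Finset.sum_le_sum fun u _ => ?_
        refine le_trans (Finset.card_le_card ?_) Finset.card_biUnion_le
        intro v hv
        simpa [hadj] using hv
    _ = ∑ i, ∑ u ∈ S, (S.filter fun v => (F i).Adj u v).card := Finset.sum_comm
    _ ≤ ∑ _i : Fin G.arboricity, 2 * S.card := Finset.sum_le_sum fun i _ => h1 i
    _ = 2 * G.arboricity * S.card := by
        rw [Finset.sum_const, Finset.card_univ, Fintype.card_fin, smul_eq_mul]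
        ring

/-- Degrees are at most `n` anyway. Capping the given bound `α` at `n` keeps the number of
processors polynomial in `n`, however large `α` is. -/
theorem SimpleGraph.sum_card_adj_le_min {n α : ℕ} (G : SimpleGraph (Fin n)) [DecidableRel G.Adj]
    (hα : G.arboricity ≤ α) (S : Finset (Fin n)) :
    ∑ u ∈ S, (S.filter fun v => G.Adj u v).card ≤ 2 * min α n * S.card := by
  rcases le_total α n with h | h
  · rw [min_eq_left h]
    exact (G.sum_card_adj_le S).trans (by gcongr)
  · rw [min_eq_right h]
    have h1 : ∑ u ∈ S, (S.filter fun v => G.Adj u v).card ≤ ∑ _u ∈ S, n :=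
      Finset.sum_le_sum fun u _ => (Finset.card_le_univ _).trans (by simp)
    rw [Finset.sum_const, smul_eq_mul] at h1
    nlinarith

end Density

/-! ### The number of arcs that survive the phases of peeling -/

section Peeling

open RangeModel

variable {n : ℕ}

/-- The number of neighbors that reach phase `t`. -/
def aliveDeg (R : Fin n → Fin n → Prop) [DecidableRel R] (thr : ℕ → ℕ) (t : ℕ) (u : Fin n) : ℕ :=
  (Finset.univ.filter fun w => R u w ∧ peelStamp R thr t w = t).card

/-- The number of arcs between vertices that reach phase `t`. -/
def aliveArcs (R : Fin n → Fin n → Prop) [DecidableRel R] (thr : ℕ → ℕ) (t : ℕ) : ℕ :=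
  ∑ u, if peelStamp R thr t u = t then aliveDeg R thr t u else 0

variable {R : Fin n → Fin n → Prop} [DecidableRel R] {thr : ℕ → ℕ}

theorem peelStamp_succ_eq_iff {t : ℕ} {v : Fin n} :
    peelStamp R thr (t + 1) v = t + 1 ↔ peelStamp R thr t v = t ∧ thr t < aliveDeg R thr t v := by
  rw [peelStamp]
  have := peelStamp_le (R := R) (thr := thr) t v
  change (if peelStamp R thr t v = t ∧ thr t < aliveDeg R thr t v then _ else _) = _ ↔ _
  split_ifs with h
  · simp [h]
  · constructor
    · intro h'
      omega
    · intro h'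
      exact absurd h' h

/-- A stamp that fails to advance in one phase never changes again, so any later stamp tells whether
a vertex reached phase `t`. -/
theorem le_peelStamp_iff {t T : ℕ} (h : t ≤ T) {v : Fin n} :
    t ≤ peelStamp R thr T v ↔ peelStamp R thr t v = t := by
  induction T, h using Nat.le_induction with
  | base =>
    have := peelStamp_le (R := R) (thr := thr) t v
    omega
  | succ T hT ih =>
    rw [← ih, peelStamp]
    split_ifs with h'
    · omega
    · rfl

/-- A survivor of phase `t` has more than `thr t` alive neighbors, which bounds the number of
survivors by the alive arcs. Sparsity then bounds the arcs that they span. -/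
theorem aliveArcs_succ_mul_le {β : ℕ}
    (hβ : ∀ S : Finset (Fin n), ∑ u ∈ S, (S.filter fun v => R u v).card ≤ 2 * β * S.card) (t : ℕ) :
    aliveArcs R thr (t + 1) * thr t ≤ 2 * β * aliveArcs R thr t := by
  set S := Finset.univ.filter fun v => peelStamp R thr (t + 1) v = t + 1 with hS
  have h1 : aliveArcs R thr (t + 1) ≤ 2 * β * S.card := by
    refine le_trans (le_of_eq ?_) (hβ S)
    rw [aliveArcs, ← Finset.sum_filter]
    refine Finset.sum_congr rfl fun u _ => ?_
    rw [aliveDeg, hS, Finset.filter_filter]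
    simp only [and_comm]
  have h2 : S.card * thr t ≤ aliveArcs R thr t := by
    rw [aliveArcs, ← smul_eq_mul, ← Finset.sum_const, ← Finset.sum_filter]
    refine le_trans (Finset.sum_le_sum (g := aliveDeg R thr t) fun u hu => ?_)
      (Finset.sum_le_sum_of_subset fun u hu => ?_)
    · exact (peelStamp_succ_eq_iff.1 (Finset.mem_filter.1 hu).2).2.le
    · exact Finset.mem_filter.2 ⟨Finset.mem_univ _,
        (peelStamp_succ_eq_iff.1 (Finset.mem_filter.1 hu).2).1⟩
  calc aliveArcs R thr (t + 1) * thr t ≤ 2 * β * S.card * thr t := Nat.mul_le_mul_right _ h1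
    _ = 2 * β * (S.card * thr t) := by ring
    _ ≤ _ := Nat.mul_le_mul_left _ h2

/-- Out-degrees after the last phase. -/
theorem outDeg_stampLT_le (T : ℕ) (u : Fin n) :
    outDeg (fun u v => R u v ∧ StampLT (peelStamp R thr T) u v) u ≤
      aliveDeg R thr (peelStamp R thr T u) u := by
  refine Finset.card_le_card fun v hv => ?_
  simp only [Finset.mem_filter, Finset.mem_univ, true_and] at hv ⊢
  refine ⟨hv.1, (le_peelStamp_iff (peelStamp_le T u)).1 ?_⟩
  rcases hv.2 with h | h
  · exact h.le
  · exact h.1.le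

/-- With more alive neighbors the vertex would have got past the phase given by its stamp. -/
theorem aliveDeg_le (T : ℕ) {u : Fin n} (hu : peelStamp R thr T u < T) :
    aliveDeg R thr (peelStamp R thr T u) u ≤ thr (peelStamp R thr T u) := by
  by_contra h
  have h1 := (le_peelStamp_iff (R := R) (thr := thr) (v := u) (peelStamp_le T u)).1 le_rfl
  have h2 := peelStamp_succ_eq_iff.2 ⟨h1, not_le.1 h⟩
  have h3 := (le_peelStamp_iff (R := R) (thr := thr) (Nat.succ_le_of_lt hu)).2 h2
  omega

/-- The out-neighbors of `u` are alive in the phase at which `u` stops. One factor of the out-degree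
is charged to the alive arcs of that phase, and the other `j` factors are at most its threshold. A
vertex that passes all phases has out-degree 0 by `hT`. -/
theorem sum_outDeg_pow_le (T j : ℕ) (hT : aliveArcs R thr T = 0) :
    (∑ u, ∑ v, if R u v ∧ StampLT (peelStamp R thr T) u v then
      outDeg (fun u v => R u v ∧ StampLT (peelStamp R thr T) u v) u ^ j else 0) ≤
      ∑ t ∈ Finset.range T, aliveArcs R thr t * thr t ^ j := by
  have h1 : ∀ u, (∑ v, if R u v ∧ StampLT (peelStamp R thr T) u v then
      outDeg (fun u v => R u v ∧ StampLT (peelStamp R thr T) u v) u ^ j else 0) =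
      outDeg (fun u v => R u v ∧ StampLT (peelStamp R thr T) u v) u *
      outDeg (fun u v => R u v ∧ StampLT (peelStamp R thr T) u v) u ^ j := fun u => by
    rw [← Finset.sum_filter, Finset.sum_const, smul_eq_mul]
    rfl
  simp only [h1]
  simp only [aliveArcs, Finset.sum_mul]
  rw [Finset.sum_comm]
  refine Finset.sum_le_sum fun u _ => ?_
  have h2 := outDeg_stampLT_le (R := R) (thr := thr) T u
  set i := peelStamp R thr T u with hi
  rcases (peelStamp_le (R := R) (thr := thr) T u).lt_or_eq with h | h
  · have h3 := h2.trans (aliveDeg_le T h)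
    refine le_trans ?_ (Finset.single_le_sum (fun _ _ => Nat.zero_le _) (Finset.mem_range.2 h))
    rw [if_pos ((le_peelStamp_iff (peelStamp_le T u)).1 le_rfl)]
    exact Nat.mul_le_mul h2 (Nat.pow_le_pow_left h3 _)
  · have h4 := (Finset.sum_eq_zero_iff.1 hT) u (Finset.mem_univ u)
    rw [if_pos h, ← h, ← hi] at h4
    rw [h4] at h2
    rw [Nat.le_zero.1 h2]
    simp

/-- The logarithms of the thresholds of peeling, relative to the arboricity. -/
def peelExp (J : ℕ) : ℕ → ℕ
  | 0 => J + 2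
  | t + 1 => peelExp J t + (peelExp J t - 2) / J

theorem le_peelExp (J t : ℕ) : J + 2 ≤ peelExp J t := by
  induction t with
  | zero => exact le_rfl
  | succ t ih => exact ih.trans (Nat.le_add_right _ _)

theorem peelExp_mono {J : ℕ} : Monotone (peelExp J) :=
  monotone_nat_of_le_succ fun _ => Nat.le_add_right _ _

theorem peelExp_add {J : ℕ} (t s : ℕ) :
    peelExp J t + s * ((peelExp J t - 2) / J) ≤ peelExp J (t + s) := by
  induction s with
  | zero => simp
  | succ s ih =>
    rw [← add_assoc, peelExp, add_mul, one_mul]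
    have := Nat.div_le_div_right (c := J) (Nat.sub_le_sub_right (peelExp_mono (J := J) (Nat.le_add_right t s)) 2)
    omega

/-- The excess of the exponent over 2 at least doubles in `2 * J` phases: it is at least `J`, so
rounding down its quotient by `J` loses less than a factor of 2. -/
theorem two_pow_mul_add_two_le_peelExp {J : ℕ} (hJ : 0 < J) (s : ℕ) :
    2 ^ s * J + 2 ≤ peelExp J (2 * J * s) := by
  induction s with
  | zero => simp [peelExp]
  | succ s ih =>
    have h1 := peelExp_add (J := J) (2 * J * s) (2 * J)
    have h2 := le_peelExp J (2 * J * s)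
    rw [show 2 * J * s + 2 * J = 2 * J * (s + 1) by ring] at h1
    set a := peelExp J (2 * J * s)
    have h3 : a - 2 ≤ 2 * J * ((a - 2) / J) := by
      have h4 := Nat.div_add_mod (a - 2) J
      have h5 := Nat.mod_lt (a - 2) hJ
      have h6 : 1 ≤ (a - 2) / J := (Nat.one_le_div_iff hJ).2 (by omega)
      nlinarith
    rw [pow_succ]
    have : 2 ^ s * 2 * J = 2 ^ s * J + 2 ^ s * J := by ring
    omega

/-- The thresholds of peeling. -/
def peelThreshold (J β t : ℕ) : ℕ := 2 ^ peelExp J t * β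

/-- With `a = peelExp J t`, phase `t` divides the number of arcs by `2 ^ (a - 1)`, while `J *
peelExp J t` grows by at most `a - 2`. The unit to spare yields the summand `t` in the exponent,
that is, one halving per phase. -/
theorem aliveArcs_mul_two_pow_le {J β : ℕ} (hJ : 0 < J) (hβ0 : 0 < β)
    (hβ : ∀ S : Finset (Fin n), ∑ u ∈ S, (S.filter fun v => R u v).card ≤ 2 * β * S.card) (t : ℕ) :
    aliveArcs R (peelThreshold J β) t * 2 ^ (J * peelExp J t + t) ≤
      aliveArcs R (peelThreshold J β) 0 * 2 ^ (J * (J + 2)) := by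
  induction t with
  | zero => exact le_rfl
  | succ t ih =>
    refine le_trans ?_ ih
    have h1 := aliveArcs_succ_mul_le (thr := peelThreshold J β) hβ t
    set E := aliveArcs R (peelThreshold J β) (t + 1)
    set E' := aliveArcs R (peelThreshold J β) t
    have h2 : E * 2 ^ peelExp J t ≤ 2 * E' := by
      refine Nat.le_of_mul_le_mul_right ?_ hβ0
      rw [peelThreshold] at h1
      linarith
    have h3 := le_peelExp J t
    rw [peelExp]
    set a := peelExp J t
    have h4 : J * ((a - 2) / J) ≤ a - 2 := Nat.mul_div_le _ _
    obtain ⟨x, hx⟩ : ∃ x, J * a + t = x + 1 := ⟨J * a + t - 1, by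
      have : 1 * 1 ≤ J * a := Nat.mul_le_mul hJ (by omega)
      omega⟩
    calc E * 2 ^ (J * (a + (a - 2) / J) + (t + 1)) ≤ E * 2 ^ (a + x) := by
          refine Nat.mul_le_mul_left _ (Nat.pow_le_pow_right (by norm_num) ?_)
          rw [mul_add]
          omega
      _ = E * 2 ^ a * 2 ^ x := by rw [pow_add, mul_assoc]
      _ ≤ 2 * E' * 2 ^ x := Nat.mul_le_mul_right _ h2
      _ = E' * 2 ^ (J * a + t) := by rw [hx, pow_succ]; ring

theorem sum_le_two_mul_of_mul_two_pow_le {s : ℕ → ℕ} {K : ℕ} (h : ∀ t, s t * 2 ^ t ≤ K) (T : ℕ) :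
    ∑ t ∈ Finset.range T, s t ≤ 2 * K := by
  have h1 : ∀ t ∈ Finset.range T, s t ≤ K / 2 ^ t := fun t _ =>
    (Nat.le_div_iff_mul_le (by positivity)).2 (h t)
  refine (Finset.sum_le_sum h1).trans ((Nat.geom_sum_le le_rfl K T).trans ?_)
  omega

/-- The exponent in `aliveArcs_mul_two_pow_le` for `J = j + 1` has room for the power `j` of the
threshold, and its summand `t` makes the phases sum like a geometric series. -/
theorem sum_aliveArcs_mul_le {j β : ℕ} (hβ0 : 0 < β)
    (hβ : ∀ S : Finset (Fin n), ∑ u ∈ S, (S.filter fun v => R u v).card ≤ 2 * β * S.card) (T : ℕ) :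
    ∑ t ∈ Finset.range T, aliveArcs R (peelThreshold (j + 1) β) t * peelThreshold (j + 1) β t ^ j ≤
      2 * (aliveArcs R (peelThreshold (j + 1) β) 0 * 2 ^ ((j + 1) * (j + 3)) * β ^ j) := by
  refine sum_le_two_mul_of_mul_two_pow_le (fun t => ?_) T
  refine le_trans ?_ (Nat.mul_le_mul_right (β ^ j)
    (aliveArcs_mul_two_pow_le (J := j + 1) (Nat.succ_pos j) hβ0 hβ t))
  set E := aliveArcs R (peelThreshold (j + 1) β) t
  rw [peelThreshold, mul_pow, ← pow_mul, pow_add]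
  calc E * (2 ^ (peelExp (j + 1) t * j) * β ^ j) * 2 ^ t
      = E * (2 ^ (peelExp (j + 1) t * j) * 2 ^ t) * β ^ j := by ring
    _ ≤ _ := by
      have := le_peelExp (j + 1) t
      refine Nat.mul_le_mul_right _ (Nat.mul_le_mul_left _ (Nat.mul_le_mul_right _
        (Nat.pow_le_pow_right (by norm_num) ?_)))
      rw [mul_comm]
      exact Nat.mul_le_mul_right _ (Nat.le_succ j)

/-- The number of phases of peeling. -/
def peelPhases (J n : ℕ) : ℕ := 2 * J * (Nat.log 2 (Nat.log 2 n) + 3)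

/-- With `l = Nat.log 2 n`, an arc left at the end would force `J * peelExp J T < 2 * (l + 1) + J *
(J + 2)`. But by then the exponent has doubled often enough to be at least `4 * (l + 1) * J + 2`. -/
theorem aliveArcs_peelPhases {J β : ℕ} (hJ : 0 < J) (hβ0 : 0 < β)
    (hβ : ∀ S : Finset (Fin n), ∑ u ∈ S, (S.filter fun v => R u v).card ≤ 2 * β * S.card) :
    aliveArcs R (peelThreshold J β) (peelPhases J n) = 0 := by
  by_contra h0
  have h1 := aliveArcs_mul_two_pow_le hJ hβ0 hβ (peelPhases J n)
  set T := peelPhases J n with hT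
  have h2 : aliveArcs R (peelThreshold J β) 0 ≤ n * n := by
    rw [aliveArcs]
    refine (Finset.sum_le_card_nsmul _ _ n fun u _ => ?_).trans (by simp)
    split_ifs
    · exact (Finset.card_le_univ _).trans (by simp)
    · exact Nat.zero_le _
  set l := Nat.log 2 n with hl
  have h3 : n < 2 ^ (l + 1) := Nat.lt_pow_succ_log_self (by norm_num) n
  have h4 : l < 2 ^ (Nat.log 2 l + 1) := Nat.lt_pow_succ_log_self (by norm_num) l
  have h5 := two_pow_mul_add_two_le_peelExp hJ (Nat.log 2 l + 3)
  change _ ≤ peelExp J T at h5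
  have h6 : 4 * (l + 1) ≤ 2 ^ (Nat.log 2 l + 3) := by
    have : 2 ^ (Nat.log 2 l + 3) = 4 * 2 ^ (Nat.log 2 l + 1) := by ring
    omega
  have h7 : 2 ^ (J * peelExp J T) < 2 ^ (2 * (l + 1) + J * (J + 2)) := by
    calc 2 ^ (J * peelExp J T) ≤ aliveArcs R (peelThreshold J β) T * 2 ^ (J * peelExp J T + T) := by
          rw [pow_add]
          have : 1 ≤ 2 ^ T := Nat.one_le_two_pow
          have h8 : 1 ≤ aliveArcs R (peelThreshold J β) T := Nat.one_le_iff_ne_zero.2 h0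
          calc 2 ^ (J * peelExp J T) = 1 * (2 ^ (J * peelExp J T) * 1) := by ring
            _ ≤ _ := by gcongr
      _ ≤ n * n * 2 ^ (J * (J + 2)) := h1.trans (Nat.mul_le_mul_right _ h2)
      _ < 2 ^ (2 * (l + 1) + J * (J + 2)) := by
          rw [pow_add, two_mul, pow_add]
          gcongr
  have h8 := (Nat.pow_lt_pow_iff_right (by norm_num : 1 < 2)).1 h7
  have h9 : J * (4 * (l + 1) * J + 2) ≤ J * peelExp J T := by
    refine Nat.mul_le_mul_left _ (le_trans ?_ h5)
    gcongr
  have : 1 ≤ J * J := Nat.mul_pos hJ hJ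
  nlinarith

end Peeling

/-! ### Sums over edges and arcs, and cliques by range sums -/

theorem Multiset.sum_map_finset_sum {ι α : Type*} (f : α → ℕ) (s : Finset ι) (F : ι → Multiset α) :
    ((∑ i ∈ s, F i).map f).sum = ∑ i ∈ s, ((F i).map f).sum :=
  map_sum (Multiset.sumAddMonoidHom.comp (Multiset.mapAddMonoidHom f)) F s

/-- Each edge is the image of exactly two arcs. This translates the distribution of the edges into a
list of arcs. -/
theorem SimpleGraph.sum_edgeFinset_lift {V : Type*} [Fintype V] [DecidableEq V] (G : SimpleGraph V)
    [DecidableRel G.Adj] (g : V → V → ℕ) :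
    ∑ e ∈ G.edgeFinset, Sym2.lift ⟨fun u v => g u v + g v u, fun _ _ => add_comm _ _⟩ e =
      ∑ u, ∑ v, if G.Adj u v then g u v else 0 := by
  rw [← Fintype.sum_prod_type' fun u v => if G.Adj u v then g u v else 0, ← Finset.sum_filter,
    ← Finset.sum_fiberwise_of_maps_to (t := G.edgeFinset) (g := fun p : V × V => s(p.1, p.2))
      (fun p hp => by simpa using hp)]
  refine Finset.sum_congr rfl fun e he => ?_
  induction e with
  | _ u v =>
    have huv : G.Adj u v := by simpa using he
    have h1 : ((Finset.univ.filter fun p : V × V => G.Adj p.1 p.2).filter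
        fun p => s(p.1, p.2) = s(u, v)) = {(u, v), (v, u)} := by
      ext ⟨a, b⟩
      simp only [Finset.mem_filter, Finset.mem_univ, true_and, Finset.mem_insert,
        Finset.mem_singleton, Prod.mk.injEq, Sym2.eq_iff]
      constructor
      · exact fun h => h.2
      · rintro (⟨rfl, rfl⟩ | ⟨rfl, rfl⟩)
        · exact ⟨huv, by simp⟩
        · exact ⟨huv.symm, by simp⟩
    rw [h1, Finset.sum_pair fun h => huv.ne (Prod.mk.inj h).1]
    rfl

theorem SimpleGraph.sum_adj_one {V : Type*} [Fintype V] [DecidableEq V] (G : SimpleGraph V)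
    [DecidableRel G.Adj] :
    (∑ u, ∑ v, if G.Adj u v then 1 else 0) = 2 * G.edgeFinset.card := by
  rw [← G.sum_edgeFinset_lift fun _ _ => 1, mul_comm, ← smul_eq_mul, ← Finset.sum_const]
  refine Finset.sum_congr rfl fun e _ => ?_
  induction e with
  | _ u v => rfl

namespace RangeModel

variable {m : RangeModel} {n : ℕ}

/-- Counting of the cliques of a graph whose edges are listed by the processors. -/
theorem Computes.cliques [NeZero n] (j : ℕ) (hn : n < m.Q) (hc : 26 + j ≤ m.c) {β : ℕ}
    (hβ0 : 0 < β) (hT : peelPhases (j + 1) n < m.Q) :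
    ∃ F : (Fin m.N → Fin 4 → Option (Fin n × Fin n)) → Fin m.N → Fin m.Q,
      m.Computes (cliqueSteps (peelPhases (j + 1) n) j) F ∧
      ∀ (G : SimpleGraph (Fin n)) [DecidableRel G.Adj] (x : Fin m.N → Fin 4 → Option (Fin n × Fin n)),
        (∀ S : Finset (Fin n), ∑ u ∈ S, (S.filter fun v => G.Adj u v).card ≤ 2 * β * S.card) →
        2 * (2 * G.edgeFinset.card * 2 ^ ((j + 1) * (j + 3)) * β ^ j) ≤ m.N →
        (∑ p, ∑ b, ((x p b).elim 0 fun a => {s(a.1, a.2)} : Multiset (Sym2 (Fin n)))) =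
          G.edgeFinset.val →
        ∀ p, (F x p : ℕ) = (G.cliqueFinset (j + 2)).card := by
  obtain ⟨F, hF, hF'⟩ := Computes.orientedChains (m := m) j hn hc (peelThreshold (j + 1) β)
    (peelPhases (j + 1) n) hT
  refine ⟨F, hF, ?_⟩
  intro G _ x hβ hN hx p
  have h0 : aliveArcs G.Adj (peelThreshold (j + 1) β) 0 = 2 * G.edgeFinset.card := by
    rw [← G.sum_adj_one, aliveArcs]
    refine Finset.sum_congr rfl fun u _ => ?_
    rw [if_pos (show peelStamp G.Adj (peelThreshold (j + 1) β) 0 u = 0 from rfl), aliveDeg,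
      Finset.card_filter]
    simp [peelStamp]
  rw [hF' G.Adj x ?_ ?_ ?_, chainCount_stampLT]
  · intro g
    rw [← G.sum_edgeFinset_lift g]
    change _ = (Multiset.map _ G.edgeFinset.val).sum
    rw [← hx, Multiset.sum_map_finset_sum]
    refine Finset.sum_congr rfl fun p _ => ?_
    rw [Multiset.sum_map_finset_sum]
    refine Finset.sum_congr rfl fun b _ => ?_
    cases x p b with
    | none => rfl
    | some a => simp
  · rw [G.sum_adj_one]
    refine le_trans ?_ hN
    have h1 : 1 ≤ 2 ^ ((j + 1) * (j + 3)) := Nat.one_le_two_pow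
    have h2 : 1 ≤ β ^ j := Nat.one_le_pow _ _ hβ0
    calc 2 * G.edgeFinset.card ≤ 2 * (2 * G.edgeFinset.card * 1 * 1) := by omega
      _ ≤ _ := by gcongr
  · refine le_trans (sum_outDeg_pow_le _ _ (aliveArcs_peelPhases (Nat.succ_pos j) hβ0 hβ)) ?_
    refine (sum_aliveArcs_mul_le hβ0 hβ _).trans ?_
    rw [h0]
    exact hN

end RangeModel

/-! ### Input of edges -/

section Input

theorem List.sum_range_getElem?_elim {α A : Type*} [AddCommMonoid A] (F : α → A) (l : List α) {K : ℕ}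
    (h : l.length ≤ K) : ∑ i ∈ Finset.range K, (l[i]?).elim 0 F = (l.map F).sum := by
  induction l generalizing K with
  | nil => simp
  | cons a l ih =>
    obtain ⟨K, rfl⟩ : ∃ K', K = K' + 1 := ⟨K - 1, by simp at h; omega⟩
    rw [Finset.sum_range_succ', List.map_cons, List.sum_cons]
    simp only [List.getElem?_cons_succ, List.getElem?_cons_zero, Option.elim_some]
    rw [ih (by simpa using h), add_comm]

/-- The indices `b * L + s` run through the numbers below `k * L` once each. -/
theorem List.sum_fin_sum_fin_getElem?_elim {α A : Type*} [AddCommMonoid A] (F : α → A) (l : List α)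
    {k L : ℕ} (h : l.length ≤ k * L) :
    ∑ s : Fin L, ∑ b : Fin k, (l[(b : ℕ) * L + s]?).elim 0 F = (l.map F).sum := by
  rw [Finset.sum_comm, ← Fintype.sum_prod_type' fun (b : Fin k) (s : Fin L) =>
    (l[(b : ℕ) * L + s]?).elim 0 F, ← l.sum_range_getElem?_elim F h, Finset.sum_range,
    ← finProdFinEquiv.sum_comp]
  refine Finset.sum_congr rfl fun p _ => ?_
  rw [finProdFinEquiv_apply_val]
  congr 2
  ring

/-- The edge number `i` in a memory that holds edges. -/
def edgeAt (n : ℕ) [NeZero n] (l : List ℕ) (i : ℕ) : Option (Fin n × Fin n) :=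
  if h : 2 * i + 1 < l.length then some (Fin.ofNat n l[2 * i], Fin.ofNat n l[2 * i + 1]) else none

theorem edgeAt_edgeWords {n : ℕ} [NeZero n] (l : List (Fin n × Fin n)) (i : ℕ) :
    edgeAt n (MPCAlgorithm.edgeWords l) i = l[i]? := by
  induction l generalizing i with
  | nil => simp [edgeAt, MPCAlgorithm.edgeWords]
  | cons a l ih =>
    have h1 : MPCAlgorithm.edgeWords (a :: l) =
        (a.1 : ℕ) :: (a.2 : ℕ) :: MPCAlgorithm.edgeWords l := rfl
    rw [h1]
    cases i with
    | zero => simp [edgeAt]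
    | succ i =>
      rw [List.getElem?_cons_succ, ← ih]
      simp only [edgeAt, List.length_cons]
      split_ifs with h2 h3 h3
      · rfl
      · omega
      · omega
      · rfl

theorem MPCAlgorithm.length_edgeWords {n : ℕ} (l : List (Fin n × Fin n)) :
    (edgeWords l).length = 2 * l.length := by
  induction l with
  | nil => rfl
  | cons a l ih =>
    change ((a.1 : ℕ) :: (a.2 : ℕ) :: edgeWords l).length = _
    simp only [List.length_cons, ih]
    ring

theorem MPCAlgorithm.lt_of_mem_edgeWords {n : ℕ} {l : List (Fin n × Fin n)} {w : ℕ}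
    (h : w ∈ edgeWords l) : w < n := by
  simp only [edgeWords, List.mem_flatMap, List.mem_cons, List.not_mem_nil, or_false] at h
  obtain ⟨a, -, rfl | rfl⟩ := h
  · exact a.1.2
  · exact a.2.2

theorem sum_range_take_drop {α : Type*} (l : List α) (q k : ℕ) :
    ∑ i ∈ Finset.range k, (((l.drop (i * q)).take q : List α) : Multiset α) =
      ((l.take (k * q) : List α) : Multiset α) := by
  induction k with
  | zero => simp
  | succ k ih => rw [Finset.sum_range_succ, ih, add_mul, one_mul, List.take_add, Multiset.coe_add]

/-- The edges can be distributed if the machines have room for them. -/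
theorem MPCAlgorithm.exists_isDistribution (A : MPCAlgorithm) {n : ℕ} (G : SimpleGraph (Fin n))
    [DecidableRel G.Adj] (h : G.edgeFinset.card ≤ A.machines * (A.space / 2)) :
    ∃ I, A.IsDistribution G I := by
  set l : List (Fin n × Fin n) := G.edgeFinset.toList.map Quot.out with hl
  have hlen : l.length ≤ A.machines * (A.space / 2) := by simpa [hl] using h
  refine ⟨fun i => (l.drop (i * (A.space / 2))).take (A.space / 2), ?_, fun i => ?_⟩
  · have h1 := sum_range_take_drop l (A.space / 2) A.machines
    rw [List.take_of_length_le hlen, Finset.sum_range] at h1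
    have h2 : (∑ i : Fin A.machines, Multiset.map (fun e : Fin n × Fin n => s(e.1, e.2))
        (((l.drop (i * (A.space / 2))).take (A.space / 2) : List _) : Multiset _)) =
        Multiset.map (fun e : Fin n × Fin n => s(e.1, e.2)) (l : Multiset _) := by
      rw [← h1]
      symm
      exact map_sum (Multiset.mapAddMonoidHom fun e : Fin n × Fin n => s(e.1, e.2))
        (fun i : Fin A.machines => (((l.drop (i * (A.space / 2))).take (A.space / 2) :
          List (Fin n × Fin n)) : Multiset (Fin n × Fin n))) Finset.univ
    refine h2.trans ?_
    rw [hl, Multiset.map_coe, List.map_map]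
    have h3 : (fun e : Fin n × Fin n => s(e.1, e.2)) ∘ Quot.out = id := by
      funext e
      exact Quot.out_eq e
    rw [h3, List.map_id, Finset.coe_toList]
  · have h1 : ((l.drop (i * (A.space / 2))).take (A.space / 2)).length ≤ A.space / 2 :=
      List.length_take_le _ _
    dsimp only
    omega

end Input

/-! ### The algorithm within the limits of the model -/

namespace RangeModel

variable (m : RangeModel)

/-- The range-sum steps count the cliques within the limits of the model. -/
theorem exists_algorithm {n : ℕ} [NeZero n] (j : ℕ) (hn : n < m.Q) (hc : 26 + j ≤ m.c) {β : ℕ}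
    (hβ0 : 0 < β) (hT : peelPhases (j + 1) n < m.Q) (hM : 0 < m.M) (hL : 0 < m.L)
    (hBL : m.B * m.B = m.L) (hW8 : 8 * m.L ≤ m.W) {bits : ℕ} (hbits : m.W ^ 8 ≤ 2 ^ bits) :
    ∃ A : MPCAlgorithm, A.machines = m.M ∧ A.space = 8 * m.L ∧ A.wordBits = bits ∧
      A.rounds = cliqueSteps (peelPhases (j + 1) n) j * m.stepRounds + 2 ∧
      ∀ (G : SimpleGraph (Fin n)) [DecidableRel G.Adj],
        (∀ S : Finset (Fin n), ∑ u ∈ S, (S.filter fun v => G.Adj u v).card ≤ 2 * β * S.card) →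
        2 * (2 * G.edgeFinset.card * 2 ^ ((j + 1) * (j + 3)) * β ^ j) ≤ m.N →
        A.CountsCliques G (j + 2) := by
  -- `L + 3 * L + 2 * L + 2 * B * B` slots, where `B * B = L`.
  have hcard : Fintype.card (RSlot m.B m.L) = 8 * m.L := by
    simp only [RSlot, Fintype.card_sum, Fintype.card_prod, Fintype.card_bool, Fintype.card_fin]
    rw [hBL]
    ring
  obtain ⟨F, hF, hF'⟩ := Computes.cliques (m := m) j hn hc hβ0 hT
  obtain ⟨e, he, hb⟩ : Fits m.K (Fin 4 → Option (Fin n × Fin n)) :=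
    ((((Fits.fin_pow hn.le).prod_pow (Fits.fin_pow hn.le)).option_pow m.hQ2).pi_pow 4).mono
      (Nat.pow_le_pow_right m.Q_pos (by omega))
  obtain ⟨prog, hprog, hexec⟩ := hF e Fin.val he Fin.val_injective hb fun y => y.2.trans_le m.Q_le_K
  have hKW : m.K ≤ m.W := by
    have := m.hW
    exact le_trans (Nat.le_add_left _ _) this
  have hW0 : 0 < m.W := by omega
  have hW2 : m.W ≤ 2 ^ bits := (Nat.le_self_pow (by norm_num) _).trans hbits
  -- A memory of `8 * L` words holds at most `4 * L` edges, which is four per main slot.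
  let start : Fin m.M → List ℕ → RSlot m.B m.L → Option Cell := fun _ l x =>
    x.elim (fun s : Fin m.L => some (e fun b : Fin 4 => edgeAt n l (b * m.L + s), 0, 0)) fun _ => none
  let out : (RSlot m.B m.L → Option Cell) → ℕ := fun f => mainOf f ⟨0, hL⟩
  refine ⟨pushAlgorithm start prog out ⟨0, hM⟩ bits, rfl, hcard, rfl, ?_, ?_⟩
  · change prog.length + 2 = _
    rw [hprog]
  intro G _ hdens hN
  constructor
  · refine MPCAlgorithm.exists_isDistribution _ G ?_
    change _ ≤ m.M * (Fintype.card (RSlot m.B m.L) / 2)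
    rw [hcard]
    have h1 : G.edgeFinset.card * 1 * 1 ≤
        G.edgeFinset.card * 2 ^ ((j + 1) * (j + 3)) * β ^ j := by
      gcongr
      · exact Nat.one_le_two_pow
      · exact Nat.one_le_pow _ _ hβ0
    have h2 : m.M * (8 * m.L / 2) = 4 * m.N := by
      rw [show 8 * m.L = 4 * m.L * 2 by ring, Nat.mul_div_cancel _ (by norm_num)]
      ring
    rw [h2]
    nlinarith
  · intro I hI
    let x : Fin m.N → Fin 4 → Option (Fin n × Fin n) := fun p b =>
      (I (finProdFinEquiv.symm p).1)[(b : ℕ) * m.L + (finProdFinEquiv.symm p).2]?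
    have hlen : ∀ i, (I i).length ≤ 4 * m.L := fun i => by
      have := hI.2 i
      change 2 * (I i).length ≤ Fintype.card (RSlot m.B m.L) at this
      omega
    have hx : (∑ p, ∑ b, ((x p b).elim 0 fun a => {s(a.1, a.2)} : Multiset (Sym2 (Fin n)))) =
        G.edgeFinset.val := by
      rw [← hI.1, ← finProdFinEquiv.sum_comp, Fintype.sum_prod_type]
      refine Finset.sum_congr rfl fun i _ => ?_
      simp only [x, Equiv.symm_apply_apply]
      rw [List.sum_fin_sum_fin_getElem?_elim _ _ (hlen i), Multiset.map_coe]
      induction I i with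
      | nil => rfl
      | cons a l ih =>
        rw [List.map_cons, List.sum_cons, ih, List.map_cons, Multiset.singleton_add,
          Multiset.cons_coe]
    have hstart : (fun i => start i (MPCAlgorithm.edgeWords (I i))) = rangeConf m.B (e ∘ x) := by
      funext i s
      rcases s with s | s | ⟨b, s⟩ | ⟨b, a, d⟩
      · simp only [start, Sum.elim_inl, edgeAt_edgeWords, rangeConf, mkConf, Function.comp, x,
          Equiv.symm_apply_apply]
      · rfl
      · rfl
      · rfl
    have hfin : ∀ i, out (rangeConf m.B (Fin.val ∘ F x) i) = (G.cliqueFinset (j + 2)).card :=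
      fun i => hF' G x hdens hN hx _
    have h := pushAlgorithm_spec (W := m.W) (start := start) (out := out) (o := ⟨0, hM⟩)
      (bits := bits) (prog := prog) (input := fun i => MPCAlgorithm.edgeWords (I i))
      (c₁ := rangeConf m.B (Fin.val ∘ F x)) (by rw [hcard]; exact hW8) (by rw [hcard]; omega) hbits
      (fun i => ⟨by rw [MPCAlgorithm.length_edgeWords]; exact hI.2 i, fun w hw =>
        (MPCAlgorithm.lt_of_mem_edgeWords hw).trans ((hn.trans_le (m.Q_le_K.trans hKW)).trans_le hW2)⟩)
      (by
        rw [hstart]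
        intro i s v hv
        rcases s with s | s | ⟨b, s⟩ | ⟨b, a, d⟩
        · obtain rfl := Option.some.inj hv
          exact ⟨(hb _).trans_le hKW, hW0, hW0⟩
        · cases hv
        · cases hv
        · cases hv)
      (by
        rw [hstart]
        exact hexec x)
      (fun i => by
        change (F x _ : ℕ) < _
        exact (F x _).2.trans_le ((m.Q_le_K.trans hKW).trans hW2))
    refine ⟨h.1, h.2.trans (congrArg some (hfin _))⟩

end RangeModel

/-! ### Choice of the parameters -/

section Parameters

/-- The exponent of the bound on the number of processors. -/
def procExp (j : ℕ) : ℕ := (j + 1) * (j + 3) + j + 7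

/-- The exponent of the bound on contents. -/
def cellExp (j : ℕ) : ℕ := procExp j * (26 + j)

/-- The number of bits of a word, in multiples of the length of the name of a vertex. -/
def wordFactor (j : ℕ) : ℕ := 16 * cellExp j + 16

/-- The number of rounds of a range-sum step if `n` is at most the `2 * s`-th power of the base. -/
def roundFactor (j s : ℕ) : ℕ := (2 * s * (cellExp j + 2) + 1) * (2 * s * procExp j + 2) + 2

/-- The ratio of the total space and the bound on the number of cliques. -/
def spaceFactor (j : ℕ) : ℕ := 8 * (2 ^ ((j + 1) * (j + 3)) * 4 + 8)

/-- All quantities are polynomial in `n`, and `n ≤ B ^ (2 * s)` turns a bound `n ^ a` into `2 * s *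
a` digits or scan levels. The processors must outnumber the candidates and the arcs, which fixes
`N₀`. -/
theorem exists_algorithm_of_base {n j B s e β : ℕ} (hn : 3 ≤ n) (hB : 2 ≤ B)
    (hnB : n ≤ B ^ (2 * s)) (hen : e ≤ n * n) (hβ0 : 1 ≤ β) (hβn : β ≤ n)
    (hBe : B * B ≤ 8 * e) :
    ∃ A : MPCAlgorithm, A.space = 8 * (B * B) ∧
      A.machines * A.space ≤ spaceFactor j * (e * β ^ j) ∧
      A.wordBits = wordFactor j * (Nat.log 2 n + 1) ∧
      A.rounds = RangeModel.cliqueSteps (peelPhases (j + 1) n) j * roundFactor j s + 2 ∧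
      ∀ (G : SimpleGraph (Fin n)) [DecidableRel G.Adj], G.edgeFinset.card = e →
        (∀ S : Finset (Fin n), ∑ u ∈ S, (S.filter fun v => G.Adj u v).card ≤ 2 * β * S.card) →
        A.CountsCliques G (j + 2) := by
  have : NeZero n := ⟨by omega⟩
  have hn1 : 1 < n := by omega
  obtain ⟨N₀, hN₀⟩ : ∃ N₀, N₀ = 2 * (2 * e * 2 ^ ((j + 1) * (j + 3)) * β ^ j) := ⟨_, rfl⟩
  have hL : 0 < B * B := Nat.mul_pos (by omega) (by omega)
  -- The memory lost by rounding up is a multiple of `B * B`, which `hBe` bounds by a multiple of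
  -- `e`, so it fits into the total space.
  obtain ⟨M, hM⟩ : ∃ M, M = N₀ / (B * B) + 1 := ⟨_, rfl⟩
  have hM0 : 0 < M := hM ▸ Nat.succ_pos _
  have hN1 : N₀ ≤ M * (B * B) := by
    have := Nat.lt_mul_div_succ N₀ hL
    rw [mul_comm] at this
    rw [hM]
    exact this.le
  have hN2 : M * (B * B) ≤ N₀ + 8 * e := by
    rw [hM, add_mul, one_mul]
    exact add_le_add (Nat.div_mul_le_self _ _) hBe
  have hβj : 1 ≤ β ^ j := Nat.one_le_pow _ _ hβ0
  have hN3 : M * (B * B) ≤ (2 ^ ((j + 1) * (j + 3)) * 4 + 8) * (e * β ^ j) := by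
    refine hN2.trans ?_
    have h1 : e * 1 ≤ e * β ^ j := Nat.mul_le_mul_left _ hβj
    have h2 : N₀ = 2 ^ ((j + 1) * (j + 3)) * 4 * (e * β ^ j) := by rw [hN₀]; ring
    rw [h2, add_mul _ 8]
    omega
  have hpow : ∀ a b, a < b → n ^ a < n ^ b := fun a b h => Nat.pow_lt_pow_right hn1 h
  have hpow' : ∀ a b, a ≤ b → n ^ a ≤ n ^ b := fun a b h => Nat.pow_le_pow_right (by omega) h
  have h2n : ∀ a, 2 ^ a ≤ n ^ a := fun a => Nat.pow_le_pow_left (by omega) a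
  -- The exponent is made up of `(j + 1) * (j + 3) + 4` for the constant factor, 2 for `e`, `j` for
  -- `β ^ j`, and 1 for strictness.
  have hNQ : M * (B * B) < n ^ procExp j := by
    refine (hN3.trans (?_ : _ ≤ n ^ ((j + 1) * (j + 3) + 4 + (2 + j)))).trans_lt
      (hpow _ _ (by rw [procExp]; omega))
    rw [pow_add n _ (2 + j), pow_add n 2 j, sq]
    refine Nat.mul_le_mul (le_trans ?_ (h2n _)) (Nat.mul_le_mul hen (Nat.pow_le_pow_left hβn j))
    rw [pow_add]
    have : 1 ≤ 2 ^ ((j + 1) * (j + 3)) := Nat.one_le_two_pow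
    omega
  have hnQ : n < n ^ procExp j := by
    calc n = n ^ 1 := (pow_one n).symm
      _ < _ := hpow _ _ (by rw [procExp]; omega)
  have hTQ : peelPhases (j + 1) n < n ^ procExp j := by
    refine lt_of_le_of_lt (?_ : _ ≤ n ^ (j + 1 + 2)) (hpow _ _ (by rw [procExp]; omega))
    have h1 : Nat.log 2 (Nat.log 2 n) ≤ n := (Nat.log_le_self _ _).trans (Nat.log_le_self _ _)
    have h2 : j + 1 ≤ 2 ^ j := Nat.lt_two_pow_self
    have h3 : 2 * (j + 1) ≤ n ^ (j + 1) := by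
      refine le_trans ?_ (h2n (j + 1))
      rw [pow_succ]
      omega
    rw [peelPhases, pow_add n (j + 1) 2]
    refine Nat.mul_le_mul h3 ?_
    nlinarith
  have hKdef : (n ^ procExp j) ^ (26 + j) = n ^ cellExp j := by rw [cellExp, pow_mul]
  have hQK : n ^ procExp j ≤ n ^ cellExp j := hpow' _ _ (by
    rw [cellExp]
    exact Nat.le_mul_of_pos_right _ (by omega))
  have hK3 : 3 ≤ n ^ cellExp j := by omega
  have hMQ : M ≤ n ^ procExp j := (Nat.le_mul_of_pos_right _ hL).trans hNQ.le
  have hBpow : ∀ a, n ^ a ≤ B ^ (2 * s * a) := fun a => by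
    rw [pow_mul]
    exact Nat.pow_le_pow_left hnB a
  have hKK : ∀ K, 1 ≤ K → K * (3 * K + 3) + K ≤ K * K * (3 * 3) := fun K hK => by nlinarith
  have h33 : 3 * 3 ≤ n ^ 2 := by rw [sq]; exact Nat.mul_le_mul hn hn
  obtain ⟨m, hmM, hmB, hmL, hmQ, hmc, hmW, hmr⟩ : ∃ m : RangeModel, m.M = M ∧ m.B = B ∧
      m.L = B * B ∧ m.Q = n ^ procExp j ∧ m.c = 26 + j ∧
      m.W = (M * (B * B) + 1) * (3 * n ^ cellExp j + 3) + n ^ cellExp j ∧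
      m.stepRounds = roundFactor j s := by
    refine ⟨
      { M := M, B := B, L := B * B, lev := 2 * s * procExp j, D := 2 * s * (cellExp j + 2),
        Q := n ^ procExp j, c := 26 + j,
        W := (M * (B * B) + 1) * (3 * n ^ cellExp j + 3) + n ^ cellExp j
        hB := by omega
        hlev := hMQ.trans (hBpow _)
        hD := ?_
        hW := by rw [hKdef]
        hQ := hNQ
        hQ2 := by omega
        hc := by omega }, rfl, rfl, rfl, rfl, rfl, rfl, rfl⟩
    rw [hKdef]
    refine le_trans ?_ (hBpow _)
    rw [pow_add]
    have := Nat.mul_le_mul_left (n ^ cellExp j) h33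
    omega
  have hW : m.W ≤ n ^ (2 * cellExp j + 2) := by
    rw [hmW]
    have h1 : M * (B * B) + 1 ≤ n ^ cellExp j := (Nat.succ_le_of_lt hNQ).trans hQK
    rw [pow_add, two_mul, pow_add]
    calc _ ≤ n ^ cellExp j * (3 * n ^ cellExp j + 3) + n ^ cellExp j :=
          Nat.add_le_add_right (Nat.mul_le_mul_right _ h1) _
      _ ≤ n ^ cellExp j * n ^ cellExp j * (3 * 3) := hKK _ (by omega)
      _ ≤ _ := Nat.mul_le_mul_left _ h33
  have hbits : m.W ^ 8 ≤ 2 ^ (wordFactor j * (Nat.log 2 n + 1)) := by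
    calc m.W ^ 8 ≤ (n ^ (2 * cellExp j + 2)) ^ 8 := Nat.pow_le_pow_left hW 8
      _ = n ^ wordFactor j := by rw [← pow_mul, wordFactor]; congr 1; ring
      _ ≤ (2 ^ (Nat.log 2 n + 1)) ^ wordFactor j :=
          Nat.pow_le_pow_left (Nat.lt_pow_succ_log_self (by norm_num) n).le _
      _ = _ := by rw [← pow_mul, mul_comm]
  have hW8 : 8 * m.L ≤ m.W := by
    rw [hmL, hmW]
    have h1 : 1 * (B * B) ≤ M * (B * B) := Nat.mul_le_mul_right _ hM0
    have h2 : (M * (B * B) + 1) * 12 ≤ (M * (B * B) + 1) * (3 * n ^ cellExp j + 3) :=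
      Nat.mul_le_mul_left _ (by omega)
    omega
  obtain ⟨A, hA1, hA2, hA3, hA4, hA5⟩ := m.exists_algorithm (n := n) j (by rw [hmQ]; exact hnQ)
    hmc.ge (β := β) hβ0 (by rw [hmQ]; exact hTQ) (by rw [hmM]; exact hM0) (by rw [hmL]; exact hL)
    (by rw [hmB, hmL]) hW8 hbits
  refine ⟨A, by rw [hA2, hmL], ?_, hA3, by rw [hA4, hmr], ?_⟩
  · rw [hA1, hA2, spaceFactor, mul_assoc 8, hmM, hmL]
    calc M * (8 * (B * B)) = 8 * (M * (B * B)) := by ring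
      _ ≤ _ := Nat.mul_le_mul_left _ hN3
  · intro G _ hG hdens
    refine hA5 G hdens ?_
    rw [hG, RangeModel.N, hmM, hmL, ← hN₀]
    exact hN1

/-- The graph whose edges are listed in a memory. -/
def memoryGraph (n : ℕ) [NeZero n] (l : List ℕ) : SimpleGraph (Fin n) :=
  SimpleGraph.fromEdgeSet {e | ∃ i a, edgeAt n l i = some a ∧ s(a.1, a.2) = e}

/-- A single machine counts the cliques locally. -/
noncomputable def localAlgorithm (n e k bits : ℕ) [NeZero n] : MPCAlgorithm where
  machines := 1
  space := 2 * e
  wordBits := bits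
  rounds := 1
  step _ _ l := ([Nat.card {s // (memoryGraph n l).IsNClique k s}], fun _ => [])
  outputMachine := 0

theorem card_cliqueFinset_eq_natCard {n : ℕ} (G : SimpleGraph (Fin n)) [DecidableRel G.Adj] (k : ℕ) :
    Nat.card {s // G.IsNClique k s} = (G.cliqueFinset k).card := by
  rw [Nat.card_eq_fintype_card, Fintype.card_subtype]
  rfl

/-- The only machine sees the whole graph, and the count is at most `n ^ k`, so it fits into a word.
-/
theorem localAlgorithm_countsCliques {n e k bits : ℕ} [NeZero n] (he : 1 ≤ e)
    (hbits : n ^ k < 2 ^ bits) (hn : n ≤ 2 ^ bits) (G : SimpleGraph (Fin n)) [DecidableRel G.Adj]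
    (hG : G.edgeFinset.card = e) : (localAlgorithm n e k bits).CountsCliques G k := by
  constructor
  · refine MPCAlgorithm.exists_isDistribution _ G ?_
    change _ ≤ 1 * (2 * e / 2)
    omega
  · intro I hI
    have h1 : ∀ i, memoryGraph n (MPCAlgorithm.edgeWords (I i)) = G := by
      intro i
      have h2 := hI.1
      change (∑ i : Fin 1, _) = _ at h2
      rw [Fin.sum_univ_one] at h2
      have hi : i = (0 : Fin 1) := Subsingleton.elim (α := Fin 1) _ _
      rw [hi, memoryGraph]
      refine Eq.trans (congrArg _ ?_) (SimpleGraph.fromEdgeSet_edgeSet G)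
      ext e'
      rw [← SimpleGraph.mem_edgeFinset, Finset.mem_def, ← h2]
      simp only [edgeAt_edgeWords, Set.mem_ofPred_eq, Multiset.mem_map, Multiset.mem_coe,
        List.mem_iff_getElem?]
      constructor
      · rintro ⟨i, a, h, h'⟩
        exact ⟨a, ⟨i, h⟩, h'⟩
      · rintro ⟨a, ⟨i, h⟩, h'⟩
        exact ⟨i, a, h, h'⟩
    have hmem : ∀ i, (localAlgorithm n e k bits).memory (fun i => MPCAlgorithm.edgeWords (I i)) 1 i =
        [(G.cliqueFinset k).card] := by
      intro i
      simp only [MPCAlgorithm.memory, localAlgorithm]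
      rw [h1, card_cliqueFinset_eq_natCard]
      simp
    have hle : (G.cliqueFinset k).card ≤ n ^ k := by
      have h3 : (G.cliqueFinset k).card ≤ (Finset.powersetCard k (Finset.univ : Finset (Fin n))).card :=
        Finset.card_le_card fun s hs => by
          rw [SimpleGraph.mem_cliqueFinset_iff] at hs
          exact Finset.mem_powersetCard.2 ⟨Finset.subset_univ _, hs.card_eq⟩
      rw [Finset.card_powersetCard, Finset.card_univ, Fintype.card_fin] at h3
      exact h3.trans (Nat.choose_le_pow n k)
    refine ⟨⟨?_, ?_⟩, ?_⟩
    · intro t ht i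
      change t ≤ 1 at ht
      change _ ≤ 2 * e ∧ ∀ w ∈ _, w < 2 ^ bits
      interval_cases t
      · refine ⟨?_, fun w hw => (MPCAlgorithm.lt_of_mem_edgeWords hw).trans_le hn⟩
        change (MPCAlgorithm.edgeWords (I i)).length ≤ _
        rw [MPCAlgorithm.length_edgeWords]
        exact hI.2 i
      · rw [hmem]
        refine ⟨by simp; omega, fun w hw => ?_⟩
        rw [List.mem_singleton.1 hw]
        exact hle.trans_lt hbits
    · intro t _ i
      simp [MPCAlgorithm.sent, localAlgorithm]
    · rw [MPCAlgorithm.result]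
      change ((localAlgorithm n e k bits).memory _ 1 _).head? = _
      rw [hmem]
      rfl

end Parameters

/-! ### Estimates in real numbers and the case distinction by size -/

section Bounds

theorem Real.one_lt_log_of_three_le {n : ℕ} (hn : 3 ≤ n) : 1 < Real.log n := by
  rw [Real.lt_log_iff_exp_lt (by positivity)]
  have h1 := Real.exp_one_lt_d9
  have h2 : (3 : ℝ) ≤ n := by exact_mod_cast hn
  linarith

theorem Nat.cast_log_two_le {n : ℕ} (hn : 1 ≤ n) : (Nat.log 2 n : ℝ) ≤ 2 * Real.log n := by
  have h1 : (Nat.log 2 n : ℝ) * Real.log 2 ≤ Real.log n := by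
    rw [← Real.log_pow]
    refine Real.log_le_log (by positivity) ?_
    exact_mod_cast Nat.pow_log_le_self 2 (by omega)
  have h2 := Real.log_two_gt_d9
  have h3 : (0 : ℝ) ≤ Nat.log 2 n := Nat.cast_nonneg _
  nlinarith

theorem Nat.cast_log_two_log_two_le {n : ℕ} (hn : 3 ≤ n) :
    (Nat.log 2 (Nat.log 2 n) : ℝ) ≤ 2 + 2 * Real.log (Real.log n) := by
  have h0 : 1 ≤ Nat.log 2 n := Nat.log_pos (by norm_num) (by omega)
  have h1 := Nat.cast_log_two_le h0
  have h2 := Nat.cast_log_two_le (show 1 ≤ n by omega)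
  have h3 := Real.one_lt_log_of_three_le hn
  have h4 : Real.log (Nat.log 2 n) ≤ Real.log 2 + Real.log (Real.log n) := by
    rw [← Real.log_mul (by norm_num) (by linarith)]
    exact Real.log_le_log (by exact_mod_cast h0) h2
  have h5 := Real.log_two_lt_d9
  linarith

/-- The base of the digits for memories of size `x ^ 2`. -/
theorem exists_base {x : ℝ} (hx : 1 ≤ x) :
    ∃ B : ℕ, 2 ≤ B ∧ (B : ℝ) ≤ 2 * x ∧ x ≤ (B : ℝ) ^ 2 := by
  refine ⟨max 2 ⌊x⌋₊, le_max_left _ _, ?_, ?_⟩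
  · rw [Nat.cast_max]
    refine max_le (by push_cast; linarith) ?_
    have := Nat.floor_le (show 0 ≤ x by linarith)
    linarith
  · have h1 : (2 : ℝ) ≤ ((max 2 ⌊x⌋₊ : ℕ) : ℝ) := by exact_mod_cast le_max_left _ _
    have h2 : ((⌊x⌋₊ : ℕ) : ℝ) ≤ ((max 2 ⌊x⌋₊ : ℕ) : ℝ) := by exact_mod_cast le_max_right _ _
    have h3 := Nat.lt_floor_add_one x
    set b := ((max 2 ⌊x⌋₊ : ℕ) : ℝ)
    nlinarith

/-- The bound on the number of rounds. -/
noncomputable def roundConst (j s : ℕ) : ℝ :=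
  (2 + (7 + 20 * (j + 1) + RangeModel.chainSteps j) * roundFactor j s) / Real.log (Real.log 3) +
    8 * (j + 1) * roundFactor j s

/-- For `n ≥ 3`, `log (log n)` is at least the positive number `log (log 3)`, and dividing by the
latter absorbs the additive constants. -/
theorem rounds_le_roundConst_mul {j s n : ℕ} (hn : 3 ≤ n) :
    ((RangeModel.cliqueSteps (peelPhases (j + 1) n) j * roundFactor j s + 2 : ℕ) : ℝ) ≤
      roundConst j s * Real.log (Real.log n) := by
  have h0 : (1 : ℝ) < Real.log 3 := by exact_mod_cast Real.one_lt_log_of_three_le (n := 3) le_rfl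
  have h1 : Real.log (Real.log 3) ≤ Real.log (Real.log n) :=
    Real.log_le_log (by linarith) (Real.log_le_log (by norm_num) (by exact_mod_cast hn))
  have h2 : 0 < Real.log (Real.log 3) := Real.log_pos h0
  have h3 := Nat.cast_log_two_log_two_le hn
  rw [RangeModel.cliqueSteps, peelPhases, roundConst]
  push_cast
  set l := Real.log (Real.log n)
  set ε := Real.log (Real.log 3)
  set x := (Nat.log 2 (Nat.log 2 n) : ℝ)
  have hR : (0 : ℝ) ≤ roundFactor j s := Nat.cast_nonneg _
  have hc : (0 : ℝ) ≤ RangeModel.chainSteps j := Nat.cast_nonneg _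
  have hj : (0 : ℝ) ≤ j := Nat.cast_nonneg _
  set R := (roundFactor j s : ℝ)
  set c := (RangeModel.chainSteps j : ℝ)
  have h4 : (2 + (7 + 20 * ((j : ℝ) + 1) + c) * R) ≤
      (2 + (7 + 20 * ((j : ℝ) + 1) + c) * R) / ε * l := by
    rw [div_mul_eq_mul_div, le_div_iff₀ h2]
    exact mul_le_mul_of_nonneg_left h1 (by positivity)
  have h5 : ((j : ℝ) + 1) * R * x ≤ ((j : ℝ) + 1) * R * (2 + 2 * l) :=
    mul_le_mul_of_nonneg_left h3 (by positivity)
  rw [add_mul]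
  linarith

theorem one_le_roundConst_mul {j s n : ℕ} (hn : 3 ≤ n) :
    1 ≤ roundConst j s * Real.log (Real.log n) := by
  refine le_trans ?_ (rounds_le_roundConst_mul hn)
  exact_mod_cast (show 1 ≤ _ + 2 by omega)

/-- The constant of the bounds on space and word length. -/
def resourceFactor (j : ℕ) : ℕ := 32 + spaceFactor j + 3 * wordFactor j

theorem bits_le {j n : ℕ} (hn : 3 ≤ n) :
    ((wordFactor j * (Nat.log 2 n + 1) : ℕ) : ℝ) ≤ resourceFactor j * Real.log n := by
  have h1 := Nat.cast_log_two_le (show 1 ≤ n by omega)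
  have h2 := Real.one_lt_log_of_three_le hn
  have h3 : (3 * wordFactor j : ℝ) ≤ resourceFactor j := by
    rw [resourceFactor]
    push_cast
    have : (0 : ℝ) ≤ spaceFactor j := Nat.cast_nonneg _
    linarith
  push_cast
  calc (wordFactor j : ℝ) * (Nat.log 2 n + 1) ≤ wordFactor j * (3 * Real.log n) := by
        refine mul_le_mul_of_nonneg_left ?_ (Nat.cast_nonneg _)
        linarith
    _ = 3 * wordFactor j * Real.log n := by ring
    _ ≤ _ := mul_le_mul_of_nonneg_right h3 (by linarith)

theorem exists_cliqueCounter (j : ℕ) {δ : ℝ} (hδ : 0 < δ) {n e α : ℕ} (hn : 3 ≤ n) (he : 1 ≤ e)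
    (hen : e ≤ n * n) (hα : 1 ≤ α) :
    ∃ A : MPCAlgorithm,
      (∀ (G : SimpleGraph (Fin n)) [DecidableRel G.Adj], G.edgeFinset.card = e →
        G.arboricity ≤ α → A.CountsCliques G (j + 2)) ∧
      (A.rounds : ℝ) ≤ roundConst j ⌈2 / δ⌉₊ * Real.log (Real.log n) ∧
      (A.space : ℝ) ≤ resourceFactor j * (n : ℝ) ^ δ ∧
      (A.machines : ℝ) * A.space ≤ resourceFactor j * (e * (α : ℝ) ^ j) ∧
      (A.wordBits : ℝ) ≤ resourceFactor j * Real.log n := by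
  have : NeZero n := ⟨by omega⟩
  have hn0 : (0 : ℝ) ≤ n := Nat.cast_nonneg _
  have hn1 : (1 : ℝ) ≤ n := by exact_mod_cast (show 1 ≤ n by omega)
  have hC : (32 : ℝ) + spaceFactor j ≤ resourceFactor j := by
    rw [resourceFactor]
    push_cast
    have : (0 : ℝ) ≤ wordFactor j := Nat.cast_nonneg _
    linarith
  have hs0 : (0 : ℝ) ≤ spaceFactor j := Nat.cast_nonneg _
  have hαj : 1 ≤ α ^ j := Nat.one_le_pow _ _ hα
  have hpos : 0 < (n : ℝ) ^ δ := Real.rpow_pos_of_pos (by linarith) _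
  -- With few edges even one machine of `n ^ δ` words could exceed the total space, so a single
  -- machine of size `2 * e` takes all edges.
  by_cases hsmall : (2 * e : ℝ) ≤ (n : ℝ) ^ δ
  · have hlog : n < 2 ^ (Nat.log 2 n + 1) := Nat.lt_pow_succ_log_self (by norm_num) n
    have hw : j + 2 ≤ wordFactor j := by
      have : 1 * (26 + j) ≤ procExp j * (26 + j) := Nat.mul_le_mul_right _ (by rw [procExp]; omega)
      rw [wordFactor, cellExp]
      omega
    have h1 : n ^ (j + 2) < 2 ^ (wordFactor j * (Nat.log 2 n + 1)) := by
      calc n ^ (j + 2) < (2 ^ (Nat.log 2 n + 1)) ^ (j + 2) :=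
            Nat.pow_lt_pow_left hlog (by omega)
        _ ≤ (2 ^ (Nat.log 2 n + 1)) ^ wordFactor j :=
            Nat.pow_le_pow_right (by positivity) hw
        _ = _ := by rw [← pow_mul, mul_comm]
    have h2 : n ≤ 2 ^ (wordFactor j * (Nat.log 2 n + 1)) :=
      (Nat.le_self_pow (by omega) n).trans h1.le
    refine ⟨localAlgorithm n e (j + 2) (wordFactor j * (Nat.log 2 n + 1)),
      fun G _ hG _ => localAlgorithm_countsCliques he h1 h2 G hG, ?_, ?_, ?_, bits_le hn⟩
    · change ((1 : ℕ) : ℝ) ≤ _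
      rw [Nat.cast_one]
      exact one_le_roundConst_mul hn
    · change ((2 * e : ℕ) : ℝ) ≤ _
      push_cast
      exact hsmall.trans (le_mul_of_one_le_left hpos.le (by linarith))
    · change ((1 : ℕ) : ℝ) * ((2 * e : ℕ) : ℝ) ≤ _
      push_cast
      have h3 : (e : ℝ) * 1 ≤ e * (α : ℝ) ^ j := by
        refine mul_le_mul_of_nonneg_left ?_ (Nat.cast_nonneg _)
        exact_mod_cast hαj
      rw [one_mul]
      refine mul_le_mul (by linarith) (by linarith) (Nat.cast_nonneg _) (by linarith)
  · have hx : 1 ≤ (n : ℝ) ^ (δ / 2) := Real.one_le_rpow hn1 (by linarith)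
    obtain ⟨B, hB, hB1, hB2⟩ := exists_base hx
    have hx2 : ((n : ℝ) ^ (δ / 2)) ^ 2 = (n : ℝ) ^ δ := by
      rw [← Real.rpow_natCast, ← Real.rpow_mul hn0]
      congr 1
      push_cast
      ring
    have hBB : (B : ℝ) * B ≤ 4 * (n : ℝ) ^ δ := by
      rw [← hx2]
      have : (0 : ℝ) ≤ B := Nat.cast_nonneg _
      nlinarith
    -- Here `n ^ δ < 2 * e`, so a machine is not larger than the input by more than a constant
    -- factor.
    have hBe : B * B ≤ 8 * e := by
      have : (B : ℝ) * B ≤ 8 * e := by linarith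
      exact_mod_cast this
    -- `B ^ 2` is at least `n ^ (δ / 2)`, and `2 / δ` such factors make up `n`.
    have hnB : n ≤ B ^ (2 * ⌈2 / δ⌉₊) := by
      have h1 : (n : ℝ) ≤ (B : ℝ) ^ (2 * ⌈2 / δ⌉₊) := by
        calc (n : ℝ) = (n : ℝ) ^ (δ / 2 * (2 / δ)) := by
              rw [div_mul_div_comm, mul_comm δ 2, div_self (by positivity), Real.rpow_one]
          _ ≤ (n : ℝ) ^ (δ / 2 * ⌈2 / δ⌉₊) := by
              refine Real.rpow_le_rpow_of_exponent_le hn1 ?_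
              exact mul_le_mul_of_nonneg_left (Nat.le_ceil _) (by linarith)
          _ = ((n : ℝ) ^ (δ / 2)) ^ ⌈2 / δ⌉₊ := by rw [Real.rpow_mul hn0, Real.rpow_natCast]
          _ ≤ ((B : ℝ) ^ 2) ^ ⌈2 / δ⌉₊ := by gcongr
          _ = _ := by rw [pow_mul]
      exact_mod_cast h1
    obtain ⟨A, hA1, hA2, hA3, hA4, hA5⟩ := exists_algorithm_of_base (j := j) (β := min α n) hn hB
      hnB hen (le_min hα (by omega)) (min_le_right _ _) hBe
    refine ⟨A, fun G _ hG hG' => hA5 G hG (G.sum_card_adj_le_min hG'), ?_, ?_, ?_, ?_⟩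
    · rw [hA4]
      exact rounds_le_roundConst_mul hn
    · rw [hA1]
      push_cast
      have : 32 * (n : ℝ) ^ δ ≤ resourceFactor j * (n : ℝ) ^ δ :=
        mul_le_mul_of_nonneg_right (by linarith) hpos.le
      linarith
    · have h1 : A.machines * A.space ≤ spaceFactor j * (e * α ^ j) :=
        hA2.trans (Nat.mul_le_mul_left _ (Nat.mul_le_mul_left _
          (Nat.pow_le_pow_left (min_le_left _ _) _)))
      have h2 : (A.machines : ℝ) * A.space ≤ spaceFactor j * (e * (α : ℝ) ^ j) := by
        exact_mod_cast h1
      refine h2.trans (mul_le_mul_of_nonneg_right (by linarith) (by positivity))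
    · rw [hA3]
      exact bits_le hn

/-- By the density bound, arboricity 0 leaves no arcs. Hence `α ≥ 1` in the main theorem, as the
total space requires. -/
theorem SimpleGraph.one_le_arboricity {n : ℕ} (G : SimpleGraph (Fin n)) [DecidableRel G.Adj]
    (h : 1 ≤ G.edgeFinset.card) : 1 ≤ G.arboricity := by
  have h1 := G.sum_card_adj_le Finset.univ
  by_contra h0
  rw [Nat.lt_one_iff.1 (not_le.1 h0), mul_zero, zero_mul] at h1
  have h2 := G.sum_adj_one
  simp only [Finset.card_filter] at h1
  omega

theorem SimpleGraph.card_edgeFinset_le_mul {n : ℕ} (G : SimpleGraph (Fin n)) [DecidableRel G.Adj] :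
    G.edgeFinset.card ≤ n * n := by
  have h1 : (∑ u : Fin n, ∑ v : Fin n, if G.Adj u v then 1 else 0) ≤ ∑ u : Fin n, ∑ v : Fin n, 1 :=
    Finset.sum_le_sum fun u _ => Finset.sum_le_sum fun v _ => by split_ifs <;> simp
  rw [G.sum_adj_one] at h1
  simp at h1
  omega

end Bounds

/-- For every constant `k ≥ 2` and every `δ > 0` there is an MPC algorithm, which is given the
number of vertices `n`, the number of edges `m` and a bound `α` on the arboricity, that counts the
`k`-cliques exactly in `O_δ(log log n)` rounds, with `O(n ^ δ)` space per machine and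
`O(m * α ^ (k - 2))` total space, where space is measured in words of `O(log n)` bits. -/
theorem mainTheorem4 (k : ℕ) (hk : 2 ≤ k) :
    ∃ C : ℝ, ∀ δ : ℝ, 0 < δ → ∃ Cδ : ℝ, ∃ A : ℕ → ℕ → ℕ → MPCAlgorithm,
      ∀ (n m α : ℕ) (G : SimpleGraph (Fin n)) [DecidableRel G.Adj],
        3 ≤ n → 1 ≤ m → G.edgeFinset.card = m → G.arboricity ≤ α →
          (A n m α).CountsCliques G k ∧
          ((A n m α).rounds : ℝ) ≤ Cδ * Real.log (Real.log n) ∧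
          ((A n m α).space : ℝ) ≤ C * (n : ℝ) ^ δ ∧
          ((A n m α).machines : ℝ) * (A n m α).space ≤ C * (m * (α : ℝ) ^ (k - 2)) ∧
          ((A n m α).wordBits : ℝ) ≤ C * Real.log n := by

  obtain ⟨j, rfl⟩ : ∃ j, k = j + 2 := ⟨k - 2, by omega⟩
  refine ⟨resourceFactor j, fun δ hδ => ⟨roundConst j ⌈2 / δ⌉₊, ?_⟩⟩
  -- The conditions stand behind the existential quantifier so that `choose` gives an algorithm for
  -- all parameters, with an arbitrary one where the conditions fail.
  have h : ∀ n e α : ℕ, ∃ A : MPCAlgorithm, 3 ≤ n → 1 ≤ e → e ≤ n * n → 1 ≤ α →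
      (∀ (G : SimpleGraph (Fin n)) [DecidableRel G.Adj], G.edgeFinset.card = e →
        G.arboricity ≤ α → A.CountsCliques G (j + 2)) ∧
      (A.rounds : ℝ) ≤ roundConst j ⌈2 / δ⌉₊ * Real.log (Real.log n) ∧
      (A.space : ℝ) ≤ resourceFactor j * (n : ℝ) ^ δ ∧
      (A.machines : ℝ) * A.space ≤ resourceFactor j * (e * (α : ℝ) ^ j) ∧
      (A.wordBits : ℝ) ≤ resourceFactor j * Real.log n := by
    intro n e α
    by_cases h : 3 ≤ n ∧ 1 ≤ e ∧ e ≤ n * n ∧ 1 ≤ α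
    · obtain ⟨A, hA⟩ := exists_cliqueCounter j hδ h.1 h.2.1 h.2.2.1 h.2.2.2
      exact ⟨A, fun _ _ _ _ => hA⟩
    · exact ⟨localAlgorithm 1 0 0 0, fun h1 h2 h3 h4 => absurd ⟨h1, h2, h3, h4⟩ h⟩
  choose A hA using h
  refine ⟨A, fun n m α G _ hn hm hG hα => ?_⟩
  obtain ⟨h1, h2⟩ := hA n m α hn hm (hG ▸ G.card_edgeFinset_le_mul)
    ((G.one_le_arboricity (hG.symm ▸ hm)).trans hα)
  exact ⟨h1 G hG hα, h2⟩
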